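/- Let $M$ be a smooth manifold of dimension $n\ge 2$, let $D\subset TM\setminus 0$ be an open conic set, and let $F^n=(M,L)$ be a Finsler space with metric function $L$ defined on $D$: $L$ is smooth, positive, positively homogeneous of degree one in $y$, and $g_{ij}=\frac12\dot\partial_i\dot\partial_jL^2$ is positive definite on $D$. Write $h_{ij}=L\,\dot\partial_i\dot\partial_jL$, $C_{ijk}=\frac12\dot\partial_kg_{ij}$, and let $(F^i_{jk},G^i_j,C^i_{jk})$ be the Cartan connection of $F^n$, with h- and v-covariant derivatives $$X_{i|j}=\partial_jX_i-(\dot\partial_hX_i)G^h_j-F^r_{ij}X_r,\qquad X_i|_j=\dot\partial_jX_i-C^r_{ij}X_r .$$ Let $b_i(x,y)$ be an h-vector of $F^n$: a smooth covector field on $D$ with $b_i|_k=0$ and $L\,C^h_{ij}b_h=\rho\,h_{ij}$ for a nowhere vanishing scalar $\rho$. Suppose that the Kropina change ${}^*L(x,y)=L^2(x,y)/\big(b_i(x,y)y^i\big)$ defines a Finsler space ${}^*F^n=(M,{}^*L)$ on $D$ as well. Let a hypersurface be given by a smooth immersion $x^i=x^i(u^\alpha)$ of an $(n-1)$-dimensional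 manifold into $M$, with $B^i_\alpha=\partial x^i/\partial u^\alpha$ and $B^i_{\alpha\beta}=\partial^2x^i/\partial u^\alpha\partial u^\beta$, and let $F^{n-1}$, ${}^*F^{n-1}$ be the Finslerian hypersurfaces of $F^n$, ${}^*F^n$ it defines. Their line elements are the $(u,v)$ for which $(x(u),y)\in D$, where $y^i=B^i_\alpha v^\alpha$. The unit normal $N^i(u,v)$ of $F^{n-1}$ is given, up to sign, by $g_{ij}B^i_\alpha N^j=0$, $g_{ij}N^iN^j=1$. Put $N_i=g_{ij}N^j$, $g_{\alpha\beta}=g_{ij}B^i_\alpha B^j_\beta$, $B^\alpha_i=g^{\alpha\beta}g_{ij}B^j_\beta$, $B^i_{0\alpha}=B^i_{\beta\alpha}v^\beta$ and $$M_\alpha=C_{ijk}B^i_\alpha N^jN^k,\qquad M_{\alpha\beta}=C_{ijk}B^i_\alpha B^j_\beta N^k,\qquad H_\alpha=N_i(B^i_{0\alpha}+G^i_jB^j_\alpha),$$ $$H_{\alpha\beta}=N_i(B^i_{\alpha\beta}+F^i_{jk}B^j_\alpha B^k_\beta)+M_\alpha H_\beta .$$ The induced Cartan connection has coefficients $F^\alpha_{\beta\gamma}=B^\alpha_i(B^i_{\beta\gamma}+F^i_{jk}B^j_\beta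 B^k_\gamma)+g^{\alpha\delta}M_{\delta\beta}H_\gamma$ and $G^\alpha_\beta=B^\alpha_i(B^i_{0\beta}+G^i_jB^j_\beta)$. An h-path of $F^n$ is a curve of line elements $(x(t),y(t))$ with $\ddot x^i+F^i_{jk}\dot x^j\dot x^k=0$ and $\dot y^i+G^i_j\dot x^j=0$; h-paths of $F^{n-1}$ are defined in the same way from the induced connection. $F^{n-1}$ is a hyperplane of the second kind if each of its h-paths is an h-path of $F^n$. It is a hyperplane of the third kind if its unit normal is parallel along each curve $(u(t),v(t))$ of its line elements, i.e. $$\dot N^i+N^j\big(F^i_{jk}\dot x^k+C^i_{jk}(\dot y^k+G^k_l\dot x^l)\big)=0$$ for $x=x(u(t))$, $y^i=B^i_\alpha v^\alpha$. The same notions for ${}^*F^{n-1}$ are formed with ${}^*L$ and are marked by an asterisk. **Theorem.** Suppose that $b_i$ is parallel with respect to the Cartan connection of $F^n$, i.e. $b_{i|j}=0$, and tangent to $F^{n-1}$, i.e. $b_iN^i=0$ along $F^{n-1}$. Then: 1. ${}^*F^{n-1}$ is a hyperplane of the second kind if and only if $F^{n-1}$ is a hyperplane of the second kind. 2. ${}^*F^{n-1}$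 is a hyperplane of the third kind if and only if $F^{n-1}$ is a hyperplane of the third kind. 3. In terms of the characteristic tensors: ${}^*H_{\alpha\beta}=0$ if and only if $H_{\alpha\beta}=0$; and ${}^*H_{\alpha\beta}=0={}^*M_{\alpha\beta}$ if and only if $H_{\alpha\beta}=0=M_{\alpha\beta}$. -/

import Mathlib

open scoped Manifold ContDiff

noncomputable section

namespace FinslerHyp

/-! ### Finsler geometry in coordinates

A function of the position `x` and the supporting element `y` is a curried function
`A : (Fin n → ℝ) → (Fin n → ℝ) → ℝ`. -/

section Coordinates

variable {n : ℕ}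

/-- `∂A/∂xⁱ`. -/
def dx (i : Fin n) (A : (Fin n → ℝ) → (Fin n → ℝ) → ℝ) (x y : Fin n → ℝ) : ℝ :=
  fderiv ℝ (fun x' => A x' y) x (Pi.single i 1)

/-- `∂A/∂yⁱ`. -/
def dy (i : Fin n) (A : (Fin n → ℝ) → (Fin n → ℝ) → ℝ) (x y : Fin n → ℝ) : ℝ :=
  fderiv ℝ (fun y' => A x y') y (Pi.single i 1)

/-- The metric tensor `g_{ij} = (1/2) ∂²L²/∂yⁱ∂yʲ`. -/
def metric (L : (Fin n → ℝ) → (Fin n → ℝ) → ℝ) (x y : Fin n → ℝ) :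
    Matrix (Fin n) (Fin n) ℝ :=
  Matrix.of fun i j => (1 / 2) * dy i (dy j (fun x y => L x y ^ 2)) x y

/-- The angular metric tensor `h_{ij} = L ∂²L/∂yⁱ∂yʲ`. -/
def angular (L : (Fin n → ℝ) → (Fin n → ℝ) → ℝ) (i j : Fin n) (x y : Fin n → ℝ) : ℝ :=
  L x y * dy i (dy j L) x y

/-- The Cartan tensor `C_{ijk} = (1/2) ∂g_{ij}/∂yᵏ`. -/
def cartan (L : (Fin n → ℝ) → (Fin n → ℝ) → ℝ) (i j k : Fin n) (x y : Fin n → ℝ) : ℝ :=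
  (1 / 2) * dy k (fun x y => metric L x y i j) x y

/-- `C^i_{jk} = g^{ir} C_{rjk}`. -/
def cartanUp (L : (Fin n → ℝ) → (Fin n → ℝ) → ℝ) (i j k : Fin n) (x y : Fin n → ℝ) : ℝ :=
  ∑ r, (metric L x y)⁻¹ i r * cartan L r j k x y

/-- The spray coefficients `G^i = (1/4) g^{ij} (yᵏ ∂²L²/∂xᵏ∂yʲ - ∂L²/∂xʲ)`. -/
def spray (L : (Fin n → ℝ) → (Fin n → ℝ) → ℝ) (i : Fin n) (x y : Fin n → ℝ) : ℝ :=
  (1 / 4) * ∑ j, (metric L x y)⁻¹ i j *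
    ((∑ k, y k * dx k (dy j (fun x y => L x y ^ 2)) x y) - dx j (fun x y => L x y ^ 2) x y)

/-- The nonlinear connection `G^i_j = ∂G^i/∂yʲ`. -/
def nonlin (L : (Fin n → ℝ) → (Fin n → ℝ) → ℝ) (i j : Fin n) (x y : Fin n → ℝ) : ℝ :=
  dy j (spray L i) x y

/-- `δ_k A = ∂A/∂xᵏ - G^h_k ∂A/∂yʰ`. -/
def delta (L : (Fin n → ℝ) → (Fin n → ℝ) → ℝ) (k : Fin n)
    (A : (Fin n → ℝ) → (Fin n → ℝ) → ℝ) (x y : Fin n → ℝ) : ℝ :=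
  dx k A x y - ∑ h, nonlin L h k x y * dy h A x y

/-- The horizontal coefficients of the Cartan connection,
`F^i_{jk} = (1/2) g^{ir} (δ_k g_{rj} + δ_j g_{rk} - δ_r g_{jk})`. -/
def hcoef (L : (Fin n → ℝ) → (Fin n → ℝ) → ℝ) (i j k : Fin n) (x y : Fin n → ℝ) : ℝ :=
  (1 / 2) * ∑ r, (metric L x y)⁻¹ i r *
    (delta L k (fun x y => metric L x y r j) x y + delta L j (fun x y => metric L x y r k) x y
      - delta L r (fun x y => metric L x y j k) x y)

/-- The h-covariant derivative `b_{i|j}` for the Cartan connection. -/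
def hcov (L : (Fin n → ℝ) → (Fin n → ℝ) → ℝ) (b : (Fin n → ℝ) → (Fin n → ℝ) → Fin n → ℝ)
    (i j : Fin n) (x y : Fin n → ℝ) : ℝ :=
  dx j (fun x y => b x y i) x y - ∑ h, dy h (fun x y => b x y i) x y * nonlin L h j x y
    - ∑ r, hcoef L r i j x y * b x y r

/-- The v-covariant derivative `b_i|_j` for the Cartan connection. -/
def vcov (L : (Fin n → ℝ) → (Fin n → ℝ) → ℝ) (b : (Fin n → ℝ) → (Fin n → ℝ) → Fin n → ℝ)
    (i j : Fin n) (x y : Fin n → ℝ) : ℝ :=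
  dy j (fun x y => b x y i) x y - ∑ r, cartanUp L r i j x y * b x y r

/-- `L` is a Finsler metric function on the conic domain `D` of line elements: smooth, positive,
positively homogeneous of degree one, with positive definite metric tensor. -/
structure IsLocalFinsler (D : Set ((Fin n → ℝ) × (Fin n → ℝ)))
    (L : (Fin n → ℝ) → (Fin n → ℝ) → ℝ) : Prop where
  isOpen : IsOpen D
  ne_zero : ∀ x y, (x, y) ∈ D → y ≠ 0
  conic : ∀ x y, (x, y) ∈ D → ∀ c : ℝ, 0 < c → (x, c • y) ∈ D
  smooth : ContDiffOn ℝ ∞ (fun p : (Fin n → ℝ) × (Fin n → ℝ) => L p.1 p.2) D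
  pos : ∀ x y, (x, y) ∈ D → 0 < L x y
  homogeneous : ∀ x y, (x, y) ∈ D → ∀ c : ℝ, 0 < c → L x (c • y) = c * L x y
  posDef : ∀ x y, (x, y) ∈ D → (metric L x y).PosDef

/-- A differentiable curve of line elements `(x(t), y(t))`, `t ∈ I`, is an h-path of the connection
whose coefficients along the curve are `Γ t` and `P t`:
`x'' ^i + Γ^i_{jk} x'^j x'^k = 0` and `y'^i + P^i_j x'^j = 0`. -/
def IsHPath (I : Set ℝ) (Γ : ℝ → Fin n → Fin n → Fin n → ℝ) (P : ℝ → Fin n → Fin n → ℝ)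
    (x y : ℝ → Fin n → ℝ) : Prop :=
  ∀ t ∈ I, DifferentiableAt ℝ x t ∧ DifferentiableAt ℝ (deriv x) t ∧ DifferentiableAt ℝ y t ∧
    ∀ i, (deriv (deriv x) t i + ∑ j, ∑ k, Γ t i j k * deriv x t j * deriv x t k = 0) ∧
      (deriv y t i + ∑ j, P t i j * deriv x t j = 0)

/-- The absolute derivative of a vector field `Z` along a curve of line elements with respect to
the Cartan connection, `Z'^i + Z^j (F^i_{jk} x'^k + C^i_{jk} (y'^k + G^k_l x'^l))`. -/
def absDeriv (L : (Fin n → ℝ) → (Fin n → ℝ) → ℝ) (x y Z : ℝ → Fin n → ℝ) (t : ℝ) (i : Fin n) : ℝ :=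
  deriv Z t i + ∑ j, ∑ k, Z t j * (hcoef L i j k (x t) (y t) * deriv x t k +
    cartanUp L i j k (x t) (y t) *
      (deriv y t k + ∑ l, nonlin L k l (x t) (y t) * deriv x t l))

/-! ### Hypersurfaces `xⁱ = Xⁱ(u^α)` in coordinates -/

variable {m : ℕ}

/-- The projection factors `B^i_α = ∂Xⁱ/∂u^α`. -/
def proj (X : (Fin m → ℝ) → Fin n → ℝ) (α : Fin m) (i : Fin n) (u : Fin m → ℝ) : ℝ :=
  fderiv ℝ X u (Pi.single α 1) i

/-- `B^i_{αβ} = ∂²Xⁱ/∂u^α∂u^β`. -/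
def proj₂ (X : (Fin m → ℝ) → Fin n → ℝ) (α β : Fin m) (i : Fin n) (u : Fin m → ℝ) : ℝ :=
  fderiv ℝ (proj X α i) u (Pi.single β 1)

/-- The supporting element `yⁱ = B^i_α v^α`. -/
def supp (X : (Fin m → ℝ) → Fin n → ℝ) (u v : Fin m → ℝ) (i : Fin n) : ℝ :=
  ∑ α, proj X α i u * v α

/-- `g_{ij} B^i_α N^j = 0` and `g_{ij} N^i N^j = 1`. The vector `N` is determined up to sign. -/
def IsUnitNormal (L : (Fin n → ℝ) → (Fin n → ℝ) → ℝ) (X : (Fin m → ℝ) → Fin n → ℝ)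
    (u v : Fin m → ℝ) (N : Fin n → ℝ) : Prop :=
  (∀ α, ∑ i, ∑ j, metric L (X u) (supp X u v) i j * proj X α i u * N j = 0) ∧
    ∑ i, ∑ j, metric L (X u) (supp X u v) i j * N i * N j = 1

/-- `N_i = g_{ij} N^j`. -/
def lower (L : (Fin n → ℝ) → (Fin n → ℝ) → ℝ) (X : (Fin m → ℝ) → Fin n → ℝ)
    (u v : Fin m → ℝ) (N : Fin n → ℝ) (i : Fin n) : ℝ :=
  ∑ j, metric L (X u) (supp X u v) i j * N j

/-- The metric tensor `g_{αβ} = g_{ij} B^i_α B^j_β` of the hypersurface. -/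
def indMetric (L : (Fin n → ℝ) → (Fin n → ℝ) → ℝ) (X : (Fin m → ℝ) → Fin n → ℝ)
    (u v : Fin m → ℝ) : Matrix (Fin m) (Fin m) ℝ :=
  Matrix.of fun α β =>
    ∑ i, ∑ j, metric L (X u) (supp X u v) i j * proj X α i u * proj X β j u

/-- The inverse projection factors `B^α_i = g^{αβ} g_{ij} B^j_β`. -/
def invProj (L : (Fin n → ℝ) → (Fin n → ℝ) → ℝ) (X : (Fin m → ℝ) → Fin n → ℝ)
    (u v : Fin m → ℝ) (α : Fin m) (i : Fin n) : ℝ :=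
  ∑ β, (indMetric L X u v)⁻¹ α β * ∑ j, metric L (X u) (supp X u v) i j * proj X β j u

/-- `M_α = C_{ijk} B^i_α N^j N^k`. -/
def Mvec (L : (Fin n → ℝ) → (Fin n → ℝ) → ℝ) (X : (Fin m → ℝ) → Fin n → ℝ)
    (u v : Fin m → ℝ) (N : Fin n → ℝ) (α : Fin m) : ℝ :=
  ∑ i, ∑ j, ∑ k, cartan L i j k (X u) (supp X u v) * proj X α i u * N j * N k

/-- The second fundamental v-tensor `M_{αβ} = C_{ijk} B^i_α B^j_β N^k`. -/
def Mtens (L : (Fin n → ℝ) → (Fin n → ℝ) → ℝ) (X : (Fin m → ℝ) → Fin n → ℝ)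
    (u v : Fin m → ℝ) (N : Fin n → ℝ) (α β : Fin m) : ℝ :=
  ∑ i, ∑ j, ∑ k, cartan L i j k (X u) (supp X u v) * proj X α i u * proj X β j u * N k

/-- `B^i_{0α} + G^i_j B^j_α`, where `B^i_{0α} = B^i_{βα} v^β`. -/
def accNonlin (L : (Fin n → ℝ) → (Fin n → ℝ) → ℝ) (X : (Fin m → ℝ) → Fin n → ℝ)
    (u v : Fin m → ℝ) (α : Fin m) (i : Fin n) : ℝ :=
  (∑ β, proj₂ X β α i u * v β) + ∑ j, nonlin L i j (X u) (supp X u v) * proj X α j u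

/-- `B^i_{αβ} + F^i_{jk} B^j_α B^k_β`. -/
def accHcoef (L : (Fin n → ℝ) → (Fin n → ℝ) → ℝ) (X : (Fin m → ℝ) → Fin n → ℝ)
    (u v : Fin m → ℝ) (α β : Fin m) (i : Fin n) : ℝ :=
  proj₂ X α β i u +
    ∑ j, ∑ k, hcoef L i j k (X u) (supp X u v) * proj X α j u * proj X β k u

/-- The normal curvature vector `H_α = N_i (B^i_{0α} + G^i_j B^j_α)`. -/
def Hvec (L : (Fin n → ℝ) → (Fin n → ℝ) → ℝ) (X : (Fin m → ℝ) → Fin n → ℝ)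
    (u v : Fin m → ℝ) (N : Fin n → ℝ) (α : Fin m) : ℝ :=
  ∑ i, lower L X u v N i * accNonlin L X u v α i

/-- The second fundamental h-tensor
`H_{αβ} = N_i (B^i_{αβ} + F^i_{jk} B^j_α B^k_β) + M_α H_β`. -/
def Htens (L : (Fin n → ℝ) → (Fin n → ℝ) → ℝ) (X : (Fin m → ℝ) → Fin n → ℝ)
    (u v : Fin m → ℝ) (N : Fin n → ℝ) (α β : Fin m) : ℝ :=
  (∑ i, lower L X u v N i * accHcoef L X u v α β i) + Mvec L X u v N α * Hvec L X u v N β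

/-- The nonlinear part `G^α_β = B^α_i (B^i_{0β} + G^i_j B^j_β)` of the induced Cartan connection. -/
def indNonlin (L : (Fin n → ℝ) → (Fin n → ℝ) → ℝ) (X : (Fin m → ℝ) → Fin n → ℝ)
    (u v : Fin m → ℝ) (α β : Fin m) : ℝ :=
  ∑ i, invProj L X u v α i * accNonlin L X u v β i

/-- The horizontal coefficients of the induced Cartan connection,
`F^α_{βγ} = B^α_i (B^i_{βγ} + F^i_{jk} B^j_β B^k_γ) + M^α_β H_γ` with `M^α_β = g^{αδ} M_{δβ}`.
They do not change when `N` is replaced by `-N`. -/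
def indHcoef (L : (Fin n → ℝ) → (Fin n → ℝ) → ℝ) (X : (Fin m → ℝ) → Fin n → ℝ)
    (u v : Fin m → ℝ) (N : Fin n → ℝ) (α β γ : Fin m) : ℝ :=
  (∑ i, invProj L X u v α i * accHcoef L X u v β γ i) +
    (∑ δ, (indMetric L X u v)⁻¹ α δ * Mtens L X u v N δ β) * Hvec L X u v N γ

/-- The line elements `(u, v)` of the hypersurface with parameter domain `U` whose image
`(x, y)` is an admissible line element of the ambient space. -/
def hypDom (D : Set ((Fin n → ℝ) × (Fin n → ℝ))) (U : Set (Fin m → ℝ))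
    (X : (Fin m → ℝ) → Fin n → ℝ) : Set ((Fin m → ℝ) × (Fin m → ℝ)) :=
  {p | p.1 ∈ U ∧ (X p.1, supp X p.1 p.2) ∈ D}

/-- Each h-path of the hypersurface with respect to the induced connection is an h-path of the
ambient space. -/
def LocalSecondKind (D : Set ((Fin n → ℝ) × (Fin n → ℝ))) (L : (Fin n → ℝ) → (Fin n → ℝ) → ℝ)
    (U : Set (Fin m → ℝ)) (X : (Fin m → ℝ) → Fin n → ℝ) : Prop :=
  ∀ (a c : ℝ) (u v : ℝ → Fin m → ℝ) (N : ℝ → Fin n → ℝ),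
    (∀ t ∈ Set.Ioo a c, (u t, v t) ∈ hypDom D U X ∧ IsUnitNormal L X (u t) (v t) (N t)) →
    IsHPath (Set.Ioo a c) (fun t => indHcoef L X (u t) (v t) (N t))
      (fun t => indNonlin L X (u t) (v t)) u v →
    IsHPath (Set.Ioo a c) (fun t i j k => hcoef L i j k (X (u t)) (supp X (u t) (v t)))
      (fun t i j => nonlin L i j (X (u t)) (supp X (u t) (v t)))
      (fun t => X (u t)) (fun t => supp X (u t) (v t))

/-- The unit normal vector is parallel along each curve of line elements of the hypersurface. -/
def LocalThirdKind (D : Set ((Fin n → ℝ) × (Fin n → ℝ))) (L : (Fin n → ℝ) → (Fin n → ℝ) → ℝ)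
    (U : Set (Fin m → ℝ)) (X : (Fin m → ℝ) → Fin n → ℝ) : Prop :=
  ∀ (a c : ℝ) (u v : ℝ → Fin m → ℝ) (N : ℝ → Fin n → ℝ),
    (∀ t ∈ Set.Ioo a c, (u t, v t) ∈ hypDom D U X ∧ IsUnitNormal L X (u t) (v t) (N t) ∧
      DifferentiableAt ℝ u t ∧ DifferentiableAt ℝ v t ∧ DifferentiableAt ℝ N t) →
    ∀ t ∈ Set.Ioo a c, ∀ i, absDeriv L (fun s => X (u s)) (fun s => supp X (u s) (v s)) N t i = 0

end Coordinates

/-! ### Finsler geometry on manifolds, through charts -/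

section Manifolds

variable {n m : ℕ} {M : Type*} [TopologicalSpace M] [ChartedSpace (Fin n → ℝ) M]
  {S : Type*} [TopologicalSpace S] [ChartedSpace (Fin m → ℝ) S]

/-- The tangent vector with components `y` at the point with coordinates `x` in the chart `e`. -/
def tvec (e : OpenPartialHomeomorph M (Fin n → ℝ)) (x y : Fin n → ℝ) :
    TangentBundle 𝓘(ℝ, Fin n → ℝ) M :=
  ⟨e.symm x, mfderiv 𝓘(ℝ, Fin n → ℝ) 𝓘(ℝ, Fin n → ℝ) e.symm x y⟩

/-- Coordinate expression of a set of tangent vectors. -/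
def locDom (D : Set (TangentBundle 𝓘(ℝ, Fin n → ℝ) M))
    (e : OpenPartialHomeomorph M (Fin n → ℝ)) : Set ((Fin n → ℝ) × (Fin n → ℝ)) :=
  {p | p.1 ∈ e.target ∧ tvec e p.1 p.2 ∈ D}

/-- Coordinate expression of a function on the tangent bundle. -/
def locFun (L : TangentBundle 𝓘(ℝ, Fin n → ℝ) M → ℝ)
    (e : OpenPartialHomeomorph M (Fin n → ℝ)) (x y : Fin n → ℝ) : ℝ :=
  L (tvec e x y)

/-- Components `b_i(x, y)` of a direction-dependent covector field. -/
def locCov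
    (b : ∀ p : TangentBundle 𝓘(ℝ, Fin n → ℝ) M, TangentSpace 𝓘(ℝ, Fin n → ℝ) p.proj →L[ℝ] ℝ)
    (e : OpenPartialHomeomorph M (Fin n → ℝ)) (x y : Fin n → ℝ) (i : Fin n) : ℝ :=
  b (tvec e x y) (mfderiv 𝓘(ℝ, Fin n → ℝ) 𝓘(ℝ, Fin n → ℝ) e.symm x (Pi.single i (1 : ℝ)))

/-- `(M, L)` is a Finsler space, with `L` defined on the open conic set `D` of nonzero tangent
vectors. -/
def IsFinsler (D : Set (TangentBundle 𝓘(ℝ, Fin n → ℝ) M))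
    (L : TangentBundle 𝓘(ℝ, Fin n → ℝ) M → ℝ) : Prop :=
  ∀ e ∈ IsManifold.maximalAtlas 𝓘(ℝ, Fin n → ℝ) ∞ M, IsLocalFinsler (locDom D e) (locFun L e)

/-- `b` is an h-vector of `(M, L)`: a smooth covector field on `D` with `b_i|_j = 0` and
`L C^h_{ij} b_h = ρ h_{ij}` for a nowhere vanishing scalar `ρ`. -/
def IsHVector (D : Set (TangentBundle 𝓘(ℝ, Fin n → ℝ) M))
    (L : TangentBundle 𝓘(ℝ, Fin n → ℝ) M → ℝ)
    (b : ∀ p : TangentBundle 𝓘(ℝ, Fin n → ℝ) M, TangentSpace 𝓘(ℝ, Fin n → ℝ) p.proj →L[ℝ] ℝ) :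
    Prop :=
  ∃ ρ : TangentBundle 𝓘(ℝ, Fin n → ℝ) M → ℝ, (∀ p ∈ D, ρ p ≠ 0) ∧
    ∀ e ∈ IsManifold.maximalAtlas 𝓘(ℝ, Fin n → ℝ) ∞ M,
      ContDiffOn ℝ ∞ (fun p : (Fin n → ℝ) × (Fin n → ℝ) => locCov b e p.1 p.2) (locDom D e) ∧
      ∀ x y, (x, y) ∈ locDom D e → ∀ i j,
        vcov (locFun L e) (locCov b e) i j x y = 0 ∧
        locFun L e x y * ∑ h, cartanUp (locFun L e) h i j x y * locCov b e x y h =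
          locFun ρ e x y * angular (locFun L e) i j x y

/-- `b` is parallel with respect to the Cartan connection of `(M, L)`: `b_{i|j} = 0`. -/
def IsHParallel (D : Set (TangentBundle 𝓘(ℝ, Fin n → ℝ) M))
    (L : TangentBundle 𝓘(ℝ, Fin n → ℝ) M → ℝ)
    (b : ∀ p : TangentBundle 𝓘(ℝ, Fin n → ℝ) M, TangentSpace 𝓘(ℝ, Fin n → ℝ) p.proj →L[ℝ] ℝ) :
    Prop :=
  ∀ e ∈ IsManifold.maximalAtlas 𝓘(ℝ, Fin n → ℝ) ∞ M, ∀ x y, (x, y) ∈ locDom D e →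
    ∀ i j, hcov (locFun L e) (locCov b e) i j x y = 0

/-- The Kropina change `*L(x, y) = L(x, y)² / (b_i(x, y) yⁱ)`. -/
def kropina (L : TangentBundle 𝓘(ℝ, Fin n → ℝ) M → ℝ)
    (b : ∀ p : TangentBundle 𝓘(ℝ, Fin n → ℝ) M, TangentSpace 𝓘(ℝ, Fin n → ℝ) p.proj →L[ℝ] ℝ)
    (p : TangentBundle 𝓘(ℝ, Fin n → ℝ) M) : ℝ :=
  L p ^ 2 / b p p.snd

/-- `f` is smooth and its differential has rank `dim S` everywhere. -/
def IsImmersed (f : S → M) : Prop :=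
  ContMDiff 𝓘(ℝ, Fin m → ℝ) 𝓘(ℝ, Fin n → ℝ) ∞ f ∧
    ∀ s, Function.Injective (mfderiv 𝓘(ℝ, Fin m → ℝ) 𝓘(ℝ, Fin n → ℝ) f s)

/-- The equations `xⁱ = Xⁱ(u)` of the hypersurface in the charts `ψ` of `S` and `e` of `M`. -/
def locMap (f : S → M) (ψ : OpenPartialHomeomorph S (Fin m → ℝ))
    (e : OpenPartialHomeomorph M (Fin n → ℝ)) (u : Fin m → ℝ) : Fin n → ℝ :=
  e (f (ψ.symm u))

/-- The domain of the equations `xⁱ = Xⁱ(u)`. -/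
def locPar (f : S → M) (ψ : OpenPartialHomeomorph S (Fin m → ℝ))
    (e : OpenPartialHomeomorph M (Fin n → ℝ)) : Set (Fin m → ℝ) :=
  {u | u ∈ ψ.target ∧ f (ψ.symm u) ∈ e.source}

/-- `b` is tangent to the hypersurface: `b_i N^i = 0` along it. -/
def IsTangentTo (D : Set (TangentBundle 𝓘(ℝ, Fin n → ℝ) M))
    (L : TangentBundle 𝓘(ℝ, Fin n → ℝ) M → ℝ)
    (b : ∀ p : TangentBundle 𝓘(ℝ, Fin n → ℝ) M, TangentSpace 𝓘(ℝ, Fin n → ℝ) p.proj →L[ℝ] ℝ)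
    (f : S → M) : Prop :=
  ∀ e ∈ IsManifold.maximalAtlas 𝓘(ℝ, Fin n → ℝ) ∞ M,
    ∀ ψ ∈ IsManifold.maximalAtlas 𝓘(ℝ, Fin m → ℝ) ∞ S,
      ∀ u v, (u, v) ∈ hypDom (locDom D e) (locPar f ψ e) (locMap f ψ e) →
        ∀ N, IsUnitNormal (locFun L e) (locMap f ψ e) u v N →
          ∑ i, locCov b e (locMap f ψ e u) (supp (locMap f ψ e) u v) i * N i = 0

/-- The hypersurface is a hyperplane of the second kind: each h-path of it with respect to the
induced Cartan connection is an h-path of the ambient Finsler space. -/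
def IsHyperplaneSecondKind (D : Set (TangentBundle 𝓘(ℝ, Fin n → ℝ) M))
    (L : TangentBundle 𝓘(ℝ, Fin n → ℝ) M → ℝ) (f : S → M) : Prop :=
  ∀ e ∈ IsManifold.maximalAtlas 𝓘(ℝ, Fin n → ℝ) ∞ M,
    ∀ ψ ∈ IsManifold.maximalAtlas 𝓘(ℝ, Fin m → ℝ) ∞ S,
      LocalSecondKind (locDom D e) (locFun L e) (locPar f ψ e) (locMap f ψ e)

/-- The hypersurface is a hyperplane of the third kind: its unit normal vector is parallel along
each curve of it. -/
def IsHyperplaneThirdKind (D : Set (TangentBundle 𝓘(ℝ, Fin n → ℝ) M))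
    (L : TangentBundle 𝓘(ℝ, Fin n → ℝ) M → ℝ) (f : S → M) : Prop :=
  ∀ e ∈ IsManifold.maximalAtlas 𝓘(ℝ, Fin n → ℝ) ∞ M,
    ∀ ψ ∈ IsManifold.maximalAtlas 𝓘(ℝ, Fin m → ℝ) ∞ S,
      LocalThirdKind (locDom D e) (locFun L e) (locPar f ψ e) (locMap f ψ e)

/-- The second fundamental h-tensor vanishes: `H_{αβ} = 0`. -/
def HtensVanishes (D : Set (TangentBundle 𝓘(ℝ, Fin n → ℝ) M))
    (L : TangentBundle 𝓘(ℝ, Fin n → ℝ) M → ℝ) (f : S → M) : Prop :=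
  ∀ e ∈ IsManifold.maximalAtlas 𝓘(ℝ, Fin n → ℝ) ∞ M,
    ∀ ψ ∈ IsManifold.maximalAtlas 𝓘(ℝ, Fin m → ℝ) ∞ S,
      ∀ u v, (u, v) ∈ hypDom (locDom D e) (locPar f ψ e) (locMap f ψ e) →
        ∀ N, IsUnitNormal (locFun L e) (locMap f ψ e) u v N →
          ∀ α β, Htens (locFun L e) (locMap f ψ e) u v N α β = 0

/-- The second fundamental v-tensor vanishes: `M_{αβ} = 0`. -/
def MtensVanishes (D : Set (TangentBundle 𝓘(ℝ, Fin n → ℝ) M))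
    (L : TangentBundle 𝓘(ℝ, Fin n → ℝ) M → ℝ) (f : S → M) : Prop :=
  ∀ e ∈ IsManifold.maximalAtlas 𝓘(ℝ, Fin n → ℝ) ∞ M,
    ∀ ψ ∈ IsManifold.maximalAtlas 𝓘(ℝ, Fin m → ℝ) ∞ S,
      ∀ u v, (u, v) ∈ hypDom (locDom D e) (locPar f ψ e) (locMap f ψ e) →
        ∀ N, IsUnitNormal (locFun L e) (locMap f ψ e) u v N →
          ∀ α β, Mtens (locFun L e) (locMap f ψ e) u v N α β = 0

end Manifolds

end FinslerHyp

end

/-! Write l_i = ∂L/∂yⁱ, β = b_i yⁱ and τ = L/β, so that *L = τL.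

The ambient geometry comes first. The h-vector conditions amount to ∂b_i/∂yʲ = ρ ∂²L/∂yⁱ∂yʲ. With
Euler's relation this gives ∂β/∂yⁱ = b_i, and b_{i|j} = 0 then makes β, like L, constant in the
horizontal directions δ_k. Hence *L is horizontally constant for the nonlinear connection of L,
which forces the two sprays to agree (`spray_eq_of_delta_eq_zero`). In dimension at least three the
angular metric has rank at least two, and this makes ρ constant vertically and horizontally
(`dy_rho`, `delta_rho`). The metric *g is f g plus a combination of l_i l_j, l_i b_j + l_j b_i and
b_i b_j, where f = τ²(2 - ρτ) and all coefficients depend on τ and ρ only (`metric_star`). Every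
ingredient is parallel for F^i_{jk}, so uniqueness of the symmetric h-metrical connection gives
*F^i_{jk} = F^i_{jk} (`hcoef_star`).

Tangency of b enters next. The normal N is annihilated by l, because the supporting element is
tangent, and by b. Therefore *g N = f g N, and *N = N/√f up to sign. The vector dual to b is
tangent; inserting it into the Cartan tensor excludes dimension two (`three_le`). The tensors H_α
and M_{αβ} and the normal part of B_{αβ} + F B_α B_β are all multiplied by √f. The vector M_α need
not scale in this way, but v^α M_α = 0, so H_{αβ} = 0 splits into the vanishing of H_β and of that
normal part (`Htens_eq_zero_iff`), which are both invariant conditions.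

For the second kind no criterion is needed: M^α_β is divided by √f while H_γ is multiplied by it, so
the whole induced connection is unchanged (`indHcoef_star`) and both hypersurfaces have the same
h-paths. For the third kind, differentiating the orthogonality relations turns parallelism of N into
a condition on the velocity (`absDeriv_unitNormal_eq_zero_iff`). Contracted with v^α, this condition
says in either space that the vertical velocity is tangent; for such velocities it is merely
multiplied by √f. -/

namespace FinslerHyp

/-! ### Calculus of functions of position and supporting element -/

section Calculus

variable {n : ℕ} {D : Set ((Fin n → ℝ) × (Fin n → ℝ))}
  {A A' : (Fin n → ℝ) → (Fin n → ℝ) → ℝ} {x y : Fin n → ℝ}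

/-- `A` is smooth on the domain `D` of line elements. -/
def SmoothIn (D : Set ((Fin n → ℝ) × (Fin n → ℝ))) (A : (Fin n → ℝ) → (Fin n → ℝ) → ℝ) : Prop :=
  ContDiffOn ℝ ∞ (fun p : (Fin n → ℝ) × (Fin n → ℝ) => A p.1 p.2) D

/-- The derivative of `A` at `(x, y)` in the direction `w`. -/
noncomputable def pd (w : (Fin n → ℝ) × (Fin n → ℝ)) (A : (Fin n → ℝ) → (Fin n → ℝ) → ℝ)
    (x y : Fin n → ℝ) : ℝ :=
  fderiv ℝ (fun p : (Fin n → ℝ) × (Fin n → ℝ) => A p.1 p.2) (x, y) w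

theorem SmoothIn.contDiffAt (hA : SmoothIn D A) (hD : IsOpen D) (h : (x, y) ∈ D) :
    ContDiffAt ℝ ∞ (fun p : (Fin n → ℝ) × (Fin n → ℝ) => A p.1 p.2) (x, y) :=
  ContDiffOn.contDiffAt hA (hD.mem_nhds h)

theorem SmoothIn.differentiableAt (hA : SmoothIn D A) (hD : IsOpen D) (h : (x, y) ∈ D) :
    DifferentiableAt ℝ (fun p : (Fin n → ℝ) × (Fin n → ℝ) => A p.1 p.2) (x, y) :=
  (hA.contDiffAt hD h).differentiableAt (by simp)

theorem dx_eq_pd (hD : IsOpen D) (hA : SmoothIn D A) (h : (x, y) ∈ D) (i : Fin n) :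
    dx i A x y = pd (Pi.single i 1, 0) A x y := by
  have h1 := (hA.differentiableAt hD h).hasFDerivAt
  have h2 : HasFDerivAt (fun x' : Fin n → ℝ => (x', y))
      (ContinuousLinearMap.inl ℝ (Fin n → ℝ) (Fin n → ℝ)) x := hasFDerivAt_prodMk_left x y
  have h3 := (HasFDerivAt.comp x h1 h2).fderiv
  simp only [Function.comp_def] at h3
  simp [dx, pd, h3]

theorem dy_eq_pd (hD : IsOpen D) (hA : SmoothIn D A) (h : (x, y) ∈ D) (i : Fin n) :
    dy i A x y = pd (0, Pi.single i 1) A x y := by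
  have h1 := (hA.differentiableAt hD h).hasFDerivAt
  have h2 : HasFDerivAt (fun y' : Fin n → ℝ => (x, y'))
      (ContinuousLinearMap.inr ℝ (Fin n → ℝ) (Fin n → ℝ)) y := hasFDerivAt_prodMk_right x y
  have h3 := (HasFDerivAt.comp y h1 h2).fderiv
  simp only [Function.comp_def] at h3
  simp [dy, pd, h3]

theorem SmoothIn.congr (hA : SmoothIn D A) (h : ∀ x y, (x, y) ∈ D → A' x y = A x y) :
    SmoothIn D A' :=
  ContDiffOn.congr hA fun p hp => h p.1 p.2 hp

theorem SmoothIn.pd (hA : SmoothIn D A) (hD : IsOpen D) (w : (Fin n → ℝ) × (Fin n → ℝ)) :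
    SmoothIn D (pd w A) := by
  have h := ContDiffOn.fderiv_of_isOpen hA hD (m := ∞) (by simp)
  exact h.clm_apply contDiffOn_const

theorem SmoothIn.dx (hA : SmoothIn D A) (hD : IsOpen D) (i : Fin n) : SmoothIn D (dx i A) :=
  (hA.pd hD _).congr fun _ _ h => dx_eq_pd hD hA h i

theorem SmoothIn.dy (hA : SmoothIn D A) (hD : IsOpen D) (i : Fin n) : SmoothIn D (dy i A) :=
  (hA.pd hD _).congr fun _ _ h => dy_eq_pd hD hA h i

theorem smoothIn_const (c : ℝ) : SmoothIn D fun _ _ => c := contDiffOn_const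

theorem smoothIn_coord (i : Fin n) : SmoothIn D fun _ y => y i :=
  ((contDiff_apply ℝ ℝ i).comp contDiff_snd).contDiffOn

theorem SmoothIn.add (hA : SmoothIn D A) (hB : SmoothIn D A') :
    SmoothIn D fun x y => A x y + A' x y := ContDiffOn.add hA hB

theorem SmoothIn.sub (hA : SmoothIn D A) (hB : SmoothIn D A') :
    SmoothIn D fun x y => A x y - A' x y := ContDiffOn.sub hA hB

theorem SmoothIn.mul (hA : SmoothIn D A) (hB : SmoothIn D A') :
    SmoothIn D fun x y => A x y * A' x y := ContDiffOn.mul hA hB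

theorem SmoothIn.div (hA : SmoothIn D A) (hB : SmoothIn D A')
    (h : ∀ x y, (x, y) ∈ D → A' x y ≠ 0) :
    SmoothIn D fun x y => A x y / A' x y := ContDiffOn.div hA hB fun p hp => h p.1 p.2 hp

theorem SmoothIn.pow (hA : SmoothIn D A) (k : ℕ) :
    SmoothIn D fun x y => A x y ^ k := ContDiffOn.pow hA k

theorem SmoothIn.sum {ι : Type*} {s : Finset ι} {A : ι → (Fin n → ℝ) → (Fin n → ℝ) → ℝ}
    (hA : ∀ i ∈ s, SmoothIn D (A i)) : SmoothIn D fun x y => ∑ i ∈ s, A i x y :=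
  ContDiffOn.sum hA

theorem SmoothIn.prod {ι : Type*} {s : Finset ι} {A : ι → (Fin n → ℝ) → (Fin n → ℝ) → ℝ}
    (hA : ∀ i ∈ s, SmoothIn D (A i)) : SmoothIn D fun x y => ∏ i ∈ s, A i x y :=
  contDiffOn_prod hA

theorem smoothIn_det {k : ℕ} {A : (Fin n → ℝ) → (Fin n → ℝ) → Matrix (Fin k) (Fin k) ℝ}
    (hA : ∀ i j, SmoothIn D fun x y => A x y i j) : SmoothIn D fun x y => (A x y).det := by
  simp only [Matrix.det_apply']
  exact SmoothIn.sum fun σ _ => (smoothIn_const _).mul (SmoothIn.prod fun i _ => hA _ _)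

/-- Cramer's rule: the entries of the adjugate are determinants of matrices with smooth entries. -/
theorem smoothIn_inv {k : ℕ} {A : (Fin n → ℝ) → (Fin n → ℝ) → Matrix (Fin k) (Fin k) ℝ}
    (hA : ∀ i j, SmoothIn D fun x y => A x y i j) (h : ∀ x y, (x, y) ∈ D → (A x y).det ≠ 0)
    (i j : Fin k) : SmoothIn D fun x y => (A x y)⁻¹ i j := by
  have : SmoothIn D fun x y => (A x y).adjugate i j / (A x y).det := by
    refine SmoothIn.div ?_ (smoothIn_det hA) h
    simp only [Matrix.adjugate_apply]
    refine smoothIn_det fun a c => ?_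
    by_cases hc : a = j
    · subst hc
      simpa using smoothIn_const _
    · simpa [Matrix.updateRow_apply, hc] using hA a c
  refine this.congr fun x y _ => ?_
  simp [Matrix.inv_def, div_eq_inv_mul]

/-! Rules for directional derivatives. -/

theorem pd_congr (hD : IsOpen D) (h : (x, y) ∈ D) (w) (hA : ∀ x y, (x, y) ∈ D → A x y = A' x y) :
    pd w A x y = pd w A' x y := by
  have : (fun p : (Fin n → ℝ) × (Fin n → ℝ) => A p.1 p.2) =ᶠ[nhds (x, y)]
      fun p => A' p.1 p.2 := by
    filter_upwards [hD.mem_nhds h] with p hp using hA p.1 p.2 hp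
  rw [pd, pd, this.fderiv_eq]

theorem dx_congr (hD : IsOpen D) (h : (x, y) ∈ D) (i) (hA : ∀ x y, (x, y) ∈ D → A x y = A' x y) :
    dx i A x y = dx i A' x y := by
  have h1 : Filter.Tendsto (fun x' : Fin n → ℝ => (x', y)) (nhds x) (nhds (x, y)) :=
    (by fun_prop : Continuous fun x' : Fin n → ℝ => (x', y)).tendsto x
  have : (fun x' => A x' y) =ᶠ[nhds x] fun x' => A' x' y := by
    filter_upwards [h1 (hD.mem_nhds h)] with p hp using hA p y hp
  rw [dx, dx, this.fderiv_eq]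

theorem dy_congr (hD : IsOpen D) (h : (x, y) ∈ D) (i) (hA : ∀ x y, (x, y) ∈ D → A x y = A' x y) :
    dy i A x y = dy i A' x y := by
  have h1 : Filter.Tendsto (fun y' : Fin n → ℝ => (x, y')) (nhds y) (nhds (x, y)) :=
    (by fun_prop : Continuous fun y' : Fin n → ℝ => (x, y')).tendsto y
  have : (fun y' => A x y') =ᶠ[nhds y] fun y' => A' x y' := by
    filter_upwards [h1 (hD.mem_nhds h)] with p hp using hA x p hp
  rw [dy, dy, this.fderiv_eq]

theorem pd_const (w) (c : ℝ) : pd w (fun _ _ => c) x y = 0 := by simp [pd]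

theorem pd_coord (w) (i : Fin n) : pd w (fun _ y => y i) x y = w.2 i := by
  have h1 : HasFDerivAt (fun p : (Fin n → ℝ) × (Fin n → ℝ) => p.2 i)
      ((ContinuousLinearMap.proj (R := ℝ) (φ := fun _ : Fin n => ℝ) i).comp
        (ContinuousLinearMap.snd ℝ (Fin n → ℝ) (Fin n → ℝ))) (x, y) :=
    ((ContinuousLinearMap.proj (R := ℝ) (φ := fun _ : Fin n => ℝ) i).comp
        (ContinuousLinearMap.snd ℝ (Fin n → ℝ) (Fin n → ℝ))).hasFDerivAt
  rw [pd, h1.fderiv]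
  rfl

theorem pd_add (hD : IsOpen D) (h : (x, y) ∈ D) (w) (hA : SmoothIn D A) (hA' : SmoothIn D A') :
    pd w (fun x y => A x y + A' x y) x y = pd w A x y + pd w A' x y := by
  simp only [pd]
  rw [fderiv_fun_add (hA.differentiableAt hD h) (hA'.differentiableAt hD h)]
  rfl

theorem pd_sub (hD : IsOpen D) (h : (x, y) ∈ D) (w) (hA : SmoothIn D A) (hA' : SmoothIn D A') :
    pd w (fun x y => A x y - A' x y) x y = pd w A x y - pd w A' x y := by
  simp only [pd]
  rw [fderiv_fun_sub (hA.differentiableAt hD h) (hA'.differentiableAt hD h)]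
  rfl

theorem pd_mul (hD : IsOpen D) (h : (x, y) ∈ D) (w) (hA : SmoothIn D A) (hA' : SmoothIn D A') :
    pd w (fun x y => A x y * A' x y) x y = pd w A x y * A' x y + A x y * pd w A' x y := by
  simp only [pd]
  rw [fderiv_fun_mul (hA.differentiableAt hD h) (hA'.differentiableAt hD h)]
  simp
  ring

theorem pd_const_mul (hD : IsOpen D) (h : (x, y) ∈ D) (w) (c : ℝ) (hA : SmoothIn D A) :
    pd w (fun x y => c * A x y) x y = c * pd w A x y := by
  rw [pd_mul hD h w (smoothIn_const c) hA, pd_const]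
  ring

theorem pd_sum {ι : Type*} {s : Finset ι} {A : ι → (Fin n → ℝ) → (Fin n → ℝ) → ℝ}
    (hD : IsOpen D) (h : (x, y) ∈ D) (w) (hA : ∀ i ∈ s, SmoothIn D (A i)) :
    pd w (fun x y => ∑ i ∈ s, A i x y) x y = ∑ i ∈ s, pd w (A i) x y := by
  simp only [pd]
  rw [fderiv_fun_sum fun i hi => (hA i hi).differentiableAt hD h]
  simp

/-- Obtained by applying the product rule to (A/A')·A' = A. The quotient stays visible on the right,
which suits repeated use with τ = L/β. -/
theorem pd_div (hD : IsOpen D) (h : (x, y) ∈ D) (w) (hA : SmoothIn D A) (hA' : SmoothIn D A')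
    (h0 : ∀ x y, (x, y) ∈ D → A' x y ≠ 0) :
    pd w (fun x y => A x y / A' x y) x y =
      (pd w A x y - A x y / A' x y * pd w A' x y) / A' x y := by
  have h1 := pd_mul hD h w (hA.div hA' h0) hA'
  have h2 := pd_congr (A' := A) hD h w
    (fun x y hxy => (div_mul_cancel₀ (A x y) (h0 x y hxy) : A x y / A' x y * A' x y = A x y))
  rw [h2] at h1
  rw [eq_div_iff (h0 x y h)]
  linarith

theorem pd_pd_comm (hD : IsOpen D) (h : (x, y) ∈ D) (w w') (hA : SmoothIn D A) :
    pd w (pd w' A) x y = pd w' (pd w A) x y := by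
  have h1 : IsSymmSndFDerivAt ℝ (fun p : (Fin n → ℝ) × (Fin n → ℝ) => A p.1 p.2) (x, y) :=
    (hA.contDiffAt hD h).isSymmSndFDerivAt (by
      simpa using (WithTop.coe_le_coe.2 le_top : ((2 : ℕ∞) : WithTop ℕ∞) ≤ ∞))
  have h2 : DifferentiableAt ℝ
      (fderiv ℝ (fun p : (Fin n → ℝ) × (Fin n → ℝ) => A p.1 p.2)) (x, y) :=
    ((hA.contDiffAt hD h).fderiv_right (m := ∞) (by simp)).differentiableAt (by simp)
  have h3 : ∀ a c, pd a (pd c A) x y = fderiv ℝ (fderiv ℝ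
      (fun p : (Fin n → ℝ) × (Fin n → ℝ) => A p.1 p.2)) (x, y) a c := by
    intro a c
    rw [pd]
    simp only [pd, Prod.mk.eta]
    rw [fderiv_clm_apply h2 (differentiableAt_const c)]
    simp
  rw [h3, h3, h1.eq]

theorem pd_eq_sum (hD : IsOpen D) (h : (x, y) ∈ D) (hA : SmoothIn D A) (w) :
    pd w A x y = ∑ k, w.1 k * dx k A x y + ∑ k, w.2 k * dy k A x y := by
  simp only [dx_eq_pd hD hA h, dy_eq_pd hD hA h]
  have hw : w = ∑ k, w.1 k • ((Pi.single k 1, 0) : (Fin n → ℝ) × (Fin n → ℝ)) +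
      ∑ k, w.2 k • ((0, Pi.single k 1) : (Fin n → ℝ) × (Fin n → ℝ)) := by
    ext j <;> simp [Prod.fst_sum, Prod.snd_sum, Finset.sum_apply, Pi.single_apply]
  conv_lhs => rw [hw]
  simp only [pd, map_add, map_sum, map_smul, smul_eq_mul]

theorem dy_dy_comm (hD : IsOpen D) (h : (x, y) ∈ D) (hA : SmoothIn D A) (i j) :
    dy i (dy j A) x y = dy j (dy i A) x y := by
  rw [dy_eq_pd hD (hA.dy hD j) h, dy_eq_pd hD (hA.dy hD i) h,
    pd_congr hD h _ fun x y h => dy_eq_pd hD hA h j,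
    pd_congr hD h _ fun x y h => dy_eq_pd hD hA h i, pd_pd_comm hD h _ _ hA]

theorem dy_dx_comm (hD : IsOpen D) (h : (x, y) ∈ D) (hA : SmoothIn D A) (i j) :
    dy i (dx j A) x y = dx j (dy i A) x y := by
  rw [dy_eq_pd hD (hA.dx hD j) h, dx_eq_pd hD (hA.dy hD i) h,
    pd_congr hD h _ fun x y h => dx_eq_pd hD hA h j,
    pd_congr hD h _ fun x y h => dy_eq_pd hD hA h i, pd_pd_comm hD h _ _ hA]

theorem dy_mul (hD : IsOpen D) (h : (x, y) ∈ D) (i) (hA : SmoothIn D A) (hA' : SmoothIn D A') :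
    dy i (fun x y => A x y * A' x y) x y = dy i A x y * A' x y + A x y * dy i A' x y := by
  rw [dy_eq_pd hD (hA.mul hA') h, dy_eq_pd hD hA h, dy_eq_pd hD hA' h, pd_mul hD h _ hA hA']

theorem dx_mul (hD : IsOpen D) (h : (x, y) ∈ D) (i) (hA : SmoothIn D A) (hA' : SmoothIn D A') :
    dx i (fun x y => A x y * A' x y) x y = dx i A x y * A' x y + A x y * dx i A' x y := by
  rw [dx_eq_pd hD (hA.mul hA') h, dx_eq_pd hD hA h, dx_eq_pd hD hA' h, pd_mul hD h _ hA hA']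

theorem dy_sub (hD : IsOpen D) (h : (x, y) ∈ D) (i) (hA : SmoothIn D A) (hA' : SmoothIn D A') :
    dy i (fun x y => A x y - A' x y) x y = dy i A x y - dy i A' x y := by
  rw [dy_eq_pd hD (hA.sub hA') h, dy_eq_pd hD hA h, dy_eq_pd hD hA' h, pd_sub hD h _ hA hA']

theorem dy_const_mul (hD : IsOpen D) (h : (x, y) ∈ D) (i) (c : ℝ) (hA : SmoothIn D A) :
    dy i (fun x y => c * A x y) x y = c * dy i A x y := by
  rw [dy_eq_pd hD ((smoothIn_const c).mul hA) h, dy_eq_pd hD hA h, pd_const_mul hD h _ c hA]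

theorem dx_const_mul (hD : IsOpen D) (h : (x, y) ∈ D) (i) (c : ℝ) (hA : SmoothIn D A) :
    dx i (fun x y => c * A x y) x y = c * dx i A x y := by
  rw [dx_eq_pd hD ((smoothIn_const c).mul hA) h, dx_eq_pd hD hA h, pd_const_mul hD h _ c hA]

theorem dy_sum_mul {A A' : Fin n → (Fin n → ℝ) → (Fin n → ℝ) → ℝ} (hD : IsOpen D)
    (h : (x, y) ∈ D) (i) (hA : ∀ k, SmoothIn D (A k)) (hA' : ∀ k, SmoothIn D (A' k)) :
    dy i (fun x y => ∑ k, A k x y * A' k x y) x y =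
      ∑ k, dy i (A k) x y * A' k x y + ∑ k, A k x y * dy i (A' k) x y := by
  have h1 : ∀ k ∈ Finset.univ, SmoothIn D fun x y => A k x y * A' k x y :=
    fun k _ => (hA k).mul (hA' k)
  rw [dy_eq_pd hD (SmoothIn.sum h1) h, pd_sum hD h _ h1, ← Finset.sum_add_distrib]
  exact Finset.sum_congr rfl fun k _ => by
    rw [← dy_eq_pd hD (h1 k (Finset.mem_univ k)) h, dy_mul hD h i (hA k) (hA' k)]

theorem dx_sum_mul {A A' : Fin n → (Fin n → ℝ) → (Fin n → ℝ) → ℝ} (hD : IsOpen D)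
    (h : (x, y) ∈ D) (i) (hA : ∀ k, SmoothIn D (A k)) (hA' : ∀ k, SmoothIn D (A' k)) :
    dx i (fun x y => ∑ k, A k x y * A' k x y) x y =
      ∑ k, dx i (A k) x y * A' k x y + ∑ k, A k x y * dx i (A' k) x y := by
  have h1 : ∀ k ∈ Finset.univ, SmoothIn D fun x y => A k x y * A' k x y :=
    fun k _ => (hA k).mul (hA' k)
  rw [dx_eq_pd hD (SmoothIn.sum h1) h, pd_sum hD h _ h1, ← Finset.sum_add_distrib]
  exact Finset.sum_congr rfl fun k _ => by
    rw [← dx_eq_pd hD (h1 k (Finset.mem_univ k)) h, dx_mul hD h i (hA k) (hA' k)]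

theorem dy_sum_coord_mul {A : Fin n → (Fin n → ℝ) → (Fin n → ℝ) → ℝ} (hD : IsOpen D)
    (h : (x, y) ∈ D) (i) (hA : ∀ k, SmoothIn D (A k)) :
    dy i (fun x y => ∑ k, y k * A k x y) x y = A i x y + ∑ k, y k * dy i (A k) x y := by
  rw [dy_sum_mul hD h i (fun k => smoothIn_coord k) hA]
  congr 1
  simp only [dy_eq_pd hD (smoothIn_coord _) h, pd_coord]
  simp [Pi.single_apply]

theorem dx_sum_coord_mul {A : Fin n → (Fin n → ℝ) → (Fin n → ℝ) → ℝ} (hD : IsOpen D)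
    (h : (x, y) ∈ D) (i) (hA : ∀ k, SmoothIn D (A k)) :
    dx i (fun x y => ∑ k, y k * A k x y) x y = ∑ k, y k * dx i (A k) x y := by
  rw [dx_sum_mul hD h i (fun k => smoothIn_coord k) hA]
  simp only [dx_eq_pd hD (smoothIn_coord _) h, pd_coord]
  simp

/-! Homogeneity in the supporting element. -/

/-- `A` is positively homogeneous of degree `r` on `D`. -/
def HomogIn (D : Set ((Fin n → ℝ) × (Fin n → ℝ))) (r : ℕ)
    (A : (Fin n → ℝ) → (Fin n → ℝ) → ℝ) : Prop :=
  ∀ x y, (x, y) ∈ D → ∀ c : ℝ, 0 < c → A x (c • y) = c ^ r * A x y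

theorem HomogIn.deriv_dx {r : ℕ} (hA : HomogIn D r A) (hs : SmoothIn D A) (hD : IsOpen D) (i : Fin n) :
    HomogIn D r (dx i A) := by
  intro x y h c hc
  have h1 : Filter.Tendsto (fun x' : Fin n → ℝ => (x', y)) (nhds x) (nhds (x, y)) :=
    (by fun_prop : Continuous fun x' : Fin n → ℝ => (x', y)).tendsto x
  have h2 : (fun x' => A x' (c • y)) =ᶠ[nhds x] fun x' => c ^ r * A x' y := by
    filter_upwards [h1 (hD.mem_nhds h)] with p hp using hA p y hp c hc
  rw [FinslerHyp.dx, h2.fderiv_eq]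
  exact dx_const_mul hD h i (c ^ r) hs

/-- Differentiate A(x, cy) = c^(r+1) A(x, y) in y and cancel one factor c. Conicity of D is what
allows the chain rule at cy. Degrees remain natural numbers: vertical derivatives of a function of
degree 0 occur only inside Euler's relation. -/
theorem HomogIn.deriv_dy {r : ℕ} (hA : HomogIn D (r + 1) A) (hs : SmoothIn D A) (hD : IsOpen D)
    (hc : ∀ x y, (x, y) ∈ D → ∀ c : ℝ, 0 < c → (x, c • y) ∈ D) (i : Fin n) :
    HomogIn D r (dy i A) := by
  intro x y h c hc0
  have h1 : Filter.Tendsto (fun y' : Fin n → ℝ => (x, y')) (nhds y) (nhds (x, y)) :=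
    (by fun_prop : Continuous fun y' : Fin n → ℝ => (x, y')).tendsto y
  have h2 : (fun y' => A x (c • y')) =ᶠ[nhds y] fun y' => c ^ (r + 1) * A x y' := by
    filter_upwards [h1 (hD.mem_nhds h)] with p hp using hA x p hp c hc0
  have h3 := dy_const_mul hD h i (c ^ (r + 1)) hs
  rw [FinslerHyp.dy, ← h2.fderiv_eq] at h3
  have h4 : DifferentiableAt ℝ (fun y' => A x y') (c • y) :=
    ((hs.differentiableAt hD (hc x y h c hc0)).comp (c • y)
      (by fun_prop : DifferentiableAt ℝ (fun y' : Fin n → ℝ => (x, y')) (c • y)) :)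
  have h5 : HasFDerivAt (fun y' : Fin n → ℝ => c • y')
      (c • ContinuousLinearMap.id ℝ (Fin n → ℝ)) y := (hasFDerivAt_id y).const_smul c
  have h6 := (HasFDerivAt.comp y h4.hasFDerivAt h5).fderiv
  simp only [Function.comp_def] at h6
  rw [h6] at h3
  simp only [ContinuousLinearMap.comp_apply, smul_apply,
    ContinuousLinearMap.id_apply, map_smul, smul_eq_mul] at h3
  have : c * dy i A x (c • y) = c * (c ^ r * dy i A x y) := by
    rw [FinslerHyp.dy, h3]
    ring
  exact mul_left_cancel₀ hc0.ne' this

/-- Compare the derivatives at c = 1 of the two sides of A(x, cy) = c^r A(x, y). -/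
theorem HomogIn.euler {r : ℕ} (hA : HomogIn D r A) (hs : SmoothIn D A) (hD : IsOpen D)
    (h : (x, y) ∈ D) : ∑ k, y k * dy k A x y = r * A x y := by
  have h1 := pd_eq_sum hD h hs (0, y)
  simp only [Pi.zero_apply, zero_mul, Finset.sum_const_zero, zero_add] at h1
  rw [← h1]
  have h4 : HasFDerivAt (fun p : (Fin n → ℝ) × (Fin n → ℝ) => A p.1 p.2)
      (fderiv ℝ (fun p : (Fin n → ℝ) × (Fin n → ℝ) => A p.1 p.2) (x, y))
      (x, (1 : ℝ) • y) := by
    rw [one_smul]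
    exact (hs.differentiableAt hD h).hasFDerivAt
  have h5 : HasDerivAt (fun c : ℝ => (x, c • y)) (0, y) 1 := by
    have := (hasDerivAt_const (1 : ℝ) x).prodMk ((hasDerivAt_id (1 : ℝ)).smul_const y)
    simpa using this
  have h6 := (h4.comp_hasDerivAt (1 : ℝ) h5)
  have h7 : HasDerivAt (fun c : ℝ => c ^ r * A x y) (r * A x y) 1 := by
    simpa using (hasDerivAt_pow r (1 : ℝ)).mul_const (A x y)
  have h8 : (fun c : ℝ => A x (c • y)) =ᶠ[nhds 1] fun c => c ^ r * A x y := by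
    filter_upwards [lt_mem_nhds (zero_lt_one' ℝ)] with c hc using hA x y h c hc
  exact h6.unique (h7.congr_of_eventuallyEq h8)

end Calculus

/-! ### The Cartan connection in coordinates -/

section LocalFinsler

variable {n : ℕ} {D : Set ((Fin n → ℝ) × (Fin n → ℝ))}
  {L A : (Fin n → ℝ) → (Fin n → ℝ) → ℝ} {x y : Fin n → ℝ}

/-- The function `L²`. -/
def sq (L : (Fin n → ℝ) → (Fin n → ℝ) → ℝ) : (Fin n → ℝ) → (Fin n → ℝ) → ℝ :=
  fun x y => L x y ^ 2

theorem metric_eq (i j : Fin n) : metric L x y i j = 1 / 2 * dy i (dy j (sq L)) x y := rfl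

theorem spray_eq (i : Fin n) : spray L i x y = 1 / 4 * ∑ j, (metric L x y)⁻¹ i j *
    ((∑ k, y k * dx k (dy j (sq L)) x y) - dx j (sq L) x y) := rfl

namespace IsLocalFinsler

theorem smoothIn (hL : IsLocalFinsler D L) : SmoothIn D L := hL.smooth

theorem smooth_sq (hL : IsLocalFinsler D L) : SmoothIn D (sq L) := hL.smoothIn.pow 2

theorem smooth_metric (hL : IsLocalFinsler D L) (i j : Fin n) :
    SmoothIn D fun x y => metric L x y i j :=
  (smoothIn_const (1 / 2)).mul ((hL.smooth_sq.dy hL.isOpen j).dy hL.isOpen i)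

theorem det_ne_zero (hL : IsLocalFinsler D L) (h : (x, y) ∈ D) : (metric L x y).det ≠ 0 :=
  (hL.posDef x y h).det_pos.ne'

theorem smooth_spray (hL : IsLocalFinsler D L) (i : Fin n) : SmoothIn D (spray L i) := by
  refine SmoothIn.mul (smoothIn_const (1 / 4)) (SmoothIn.sum fun j _ => SmoothIn.mul ?_ ?_)
  · exact smoothIn_inv hL.smooth_metric (fun x y h => hL.det_ne_zero h) i j
  · exact (SmoothIn.sum fun k _ => (smoothIn_coord k).mul
      ((hL.smooth_sq.dy hL.isOpen j).dx hL.isOpen k)).sub (hL.smooth_sq.dx hL.isOpen j)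

theorem smooth_nonlin (hL : IsLocalFinsler D L) (i j : Fin n) : SmoothIn D (nonlin L i j) :=
  (hL.smooth_spray i).dy hL.isOpen j

theorem homog (hL : IsLocalFinsler D L) : HomogIn D 1 L := by
  intro x y h c hc
  rw [hL.homogeneous x y h c hc, pow_one]

theorem homog_sq (hL : IsLocalFinsler D L) : HomogIn D 2 (sq L) := by
  intro x y h c hc
  simp only [sq]
  rw [hL.homogeneous x y h c hc]
  ring

theorem homog_dy_sq (hL : IsLocalFinsler D L) (i : Fin n) : HomogIn D 1 (dy i (sq L)) :=
  hL.homog_sq.deriv_dy hL.smooth_sq hL.isOpen hL.conic i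

theorem homog_dy_dy_sq (hL : IsLocalFinsler D L) (i j : Fin n) :
    HomogIn D 0 (dy i (dy j (sq L))) :=
  (hL.homog_dy_sq j).deriv_dy (hL.smooth_sq.dy hL.isOpen j) hL.isOpen hL.conic i

theorem homog_metric (hL : IsLocalFinsler D L) (h : (x, y) ∈ D) {c : ℝ} (hc : 0 < c) :
    metric L x (c • y) = metric L x y := by
  ext i j
  rw [metric_eq, metric_eq, hL.homog_dy_dy_sq i j x y h c hc, pow_zero, one_mul]

theorem homog_spray (hL : IsLocalFinsler D L) (i : Fin n) : HomogIn D 2 (spray L i) := by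
  intro x y h c hc
  rw [spray_eq, spray_eq, hL.homog_metric h hc]
  simp only [((hL.homog_dy_sq _).deriv_dx (hL.smooth_sq.dy hL.isOpen _) hL.isOpen _) x y h c hc,
    (hL.homog_sq.deriv_dx hL.smooth_sq hL.isOpen _) x y h c hc, Pi.smul_apply, smul_eq_mul]
  rw [mul_left_comm, Finset.mul_sum _ _ (c ^ 2)]
  congr 1
  refine Finset.sum_congr rfl fun j _ => ?_
  rw [mul_left_comm (c ^ 2), mul_sub (c ^ 2), Finset.mul_sum]
  congr 2
  exact Finset.sum_congr rfl fun k _ => by ring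

theorem homog_nonlin (hL : IsLocalFinsler D L) (i j : Fin n) : HomogIn D 1 (nonlin L i j) :=
  (hL.homog_spray i).deriv_dy (hL.smooth_spray i) hL.isOpen hL.conic j

theorem homog_dy_nonlin (hL : IsLocalFinsler D L) (i j k : Fin n) :
    HomogIn D 0 (dy k (nonlin L i j)) :=
  (hL.homog_nonlin i j).deriv_dy (hL.smooth_nonlin i j) hL.isOpen hL.conic k

theorem dy_nonlin_comm (hL : IsLocalFinsler D L) (h : (x, y) ∈ D) (i j k : Fin n) :
    dy k (nonlin L i j) x y = dy j (nonlin L i k) x y :=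
  dy_dy_comm hL.isOpen h (hL.smooth_spray i) k j

theorem metric_symm (hL : IsLocalFinsler D L) (h : (x, y) ∈ D) (i j : Fin n) :
    metric L x y i j = metric L x y j i := by
  rw [metric_eq, metric_eq, dy_dy_comm hL.isOpen h hL.smooth_sq]

theorem sum_metric_mul_inv (hL : IsLocalFinsler D L) (h : (x, y) ∈ D) (v : Fin n → ℝ)
    (s : Fin n) : ∑ r, metric L x y s r * ∑ t, (metric L x y)⁻¹ r t * v t = v s := by
  have h1 := Matrix.mul_nonsing_inv (metric L x y) (Ne.isUnit (hL.det_ne_zero h))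
  have h2 : (metric L x y).mulVec ((metric L x y)⁻¹.mulVec v) = v := by
    rw [Matrix.mulVec_mulVec, h1, Matrix.one_mulVec]
  exact congrFun h2 s

theorem eq_of_metric_mul (hL : IsLocalFinsler D L) (h : (x, y) ∈ D) {v w : Fin n → ℝ}
    (hvw : ∀ s, ∑ r, metric L x y s r * v r = ∑ r, metric L x y s r * w r) : v = w :=
  Matrix.mulVec_injective_of_isUnit
    ((Matrix.isUnit_iff_isUnit_det _).2 (Ne.isUnit (hL.det_ne_zero h))) (funext hvw)

theorem sum_metric_mul_spray (hL : IsLocalFinsler D L) (h : (x, y) ∈ D) (j : Fin n) :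
    ∑ i, metric L x y j i * spray L i x y =
      1 / 4 * ((∑ k, y k * dx k (dy j (sq L)) x y) - dx j (sq L) x y) := by
  rw [← hL.sum_metric_mul_inv h (fun j => (∑ k, y k * dx k (dy j (sq L)) x y) -
    dx j (sq L) x y) j, Finset.mul_sum]
  exact Finset.sum_congr rfl fun i _ => by rw [spray_eq]; ring

theorem euler_sq (hL : IsLocalFinsler D L) (h : (x, y) ∈ D) :
    ∑ k, y k * dy k (sq L) x y = 2 * sq L x y := by
  simpa using hL.homog_sq.euler hL.smooth_sq hL.isOpen h

theorem euler_dx_sq (hL : IsLocalFinsler D L) (h : (x, y) ∈ D) (i : Fin n) :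
    ∑ k, y k * dx i (dy k (sq L)) x y = 2 * dx i (sq L) x y := by
  rw [← dx_sum_coord_mul hL.isOpen h i fun k => hL.smooth_sq.dy hL.isOpen k,
    dx_congr hL.isOpen h i fun x y h => hL.euler_sq h, dx_const_mul hL.isOpen h i 2 hL.smooth_sq]

theorem metric_mul_y (hL : IsLocalFinsler D L) (h : (x, y) ∈ D) (i : Fin n) :
    ∑ k, metric L x y i k * y k = 1 / 2 * dy i (sq L) x y := by
  have h1 := (hL.homog_dy_sq i).euler (hL.smooth_sq.dy hL.isOpen i) hL.isOpen h
  rw [Nat.cast_one, one_mul] at h1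
  rw [← h1, Finset.mul_sum]
  refine Finset.sum_congr rfl fun k _ => ?_
  rw [hL.metric_symm h, metric_eq]
  ring

/-- The metric function is constant along horizontal curves. -/
theorem delta_sq (hL : IsLocalFinsler D L) (h : (x, y) ∈ D) (j : Fin n) :
    delta L j (sq L) x y = 0 := by
  have hD := hL.isOpen
  -- Lowering the index of the spray and contracting with y gives 2Gⁱ ∂L²/∂yⁱ = yᵏ ∂L²/∂xᵏ. This is
  -- δL² contracted with y; the free index is recovered by a vertical derivative.
  have h1 : ∀ x y, (x, y) ∈ D → ∑ i, 2 * spray L i x y * dy i (sq L) x y =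
      ∑ k, y k * dx k (sq L) x y := by
    intro x y h
    have e1 : ∀ i, dy i (sq L) x y = 2 * ∑ k, metric L x y i k * y k := fun i => by
      rw [hL.metric_mul_y h]; ring
    have e2 : ∑ i, 2 * spray L i x y * dy i (sq L) x y =
        4 * ∑ k, y k * ∑ i, metric L x y k i * spray L i x y := by
      simp only [e1, Finset.mul_sum]
      rw [Finset.sum_comm]
      refine Finset.sum_congr rfl fun i _ => Finset.sum_congr rfl fun k _ => ?_
      rw [hL.metric_symm h]
      ring
    rw [e2]
    simp only [hL.sum_metric_mul_spray h]
    have e3 : ∑ k, y k * ∑ l, y l * dx l (dy k (sq L)) x y = 2 * ∑ k, y k * dx k (sq L) x y := by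
      simp only [Finset.mul_sum]
      rw [Finset.sum_comm]
      refine Finset.sum_congr rfl fun l _ => ?_
      have := hL.euler_dx_sq h l
      rw [mul_left_comm, ← this, Finset.mul_sum]
      exact Finset.sum_congr rfl fun k _ => by ring
    have e4 : ∀ k, y k * (1 / 4 * ((∑ l, y l * dx l (dy k (sq L)) x y) - dx k (sq L) x y)) =
        1 / 4 * (y k * ∑ l, y l * dx l (dy k (sq L)) x y) - 1 / 4 * (y k * dx k (sq L) x y) :=
      fun k => by ring
    simp only [e4]
    rw [Finset.sum_sub_distrib, ← Finset.mul_sum, ← Finset.mul_sum, e3]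
    ring
  -- In the derivative of `h1` along yʲ, the terms with second y-derivatives of L² are again given
  -- by the definition of the spray. After cancellation only δ_j L² = 0 remains.
  have h2 := dy_congr hD h j h1
  rw [dy_sum_mul hD h j (fun i => (smoothIn_const 2).mul (hL.smooth_spray i))
    (fun i => hL.smooth_sq.dy hD i), dy_sum_coord_mul hD h j fun k => hL.smooth_sq.dx hD k] at h2
  have h3 : ∑ i, 2 * spray L i x y * dy j (dy i (sq L)) x y =
      (∑ k, y k * dx k (dy j (sq L)) x y) - dx j (sq L) x y := by
    have := hL.sum_metric_mul_spray h j
    have e : ∑ i, 2 * spray L i x y * dy j (dy i (sq L)) x y =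
        4 * ∑ i, metric L x y j i * spray L i x y := by
      rw [Finset.mul_sum]
      exact Finset.sum_congr rfl fun i _ => by rw [metric_eq]; ring
    rw [e, this]
    ring
  have h4 : ∑ k, dy j (fun x y => 2 * spray L k x y) x y * dy k (sq L) x y =
      2 * ∑ k, nonlin L k j x y * dy k (sq L) x y := by
    rw [Finset.mul_sum]
    refine Finset.sum_congr rfl fun k _ => ?_
    rw [dy_const_mul hD h j 2 (hL.smooth_spray k), nonlin]
    ring
  have h5 : ∑ k, y k * dy j (dx k (sq L)) x y = ∑ k, y k * dx k (dy j (sq L)) x y :=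
    Finset.sum_congr rfl fun k _ => by rw [dy_dx_comm hD h hL.smooth_sq]
  rw [h3, h4, h5] at h2
  rw [delta]
  linarith

/-- At a fixed point δ_k is the derivative along the horizontal vector (e_k, -G^h_k), so the sum,
product and quotient rules of `pd` apply to it. -/
theorem delta_eq_pd (hL : IsLocalFinsler D L) (h : (x, y) ∈ D) (hA : SmoothIn D A) (k : Fin n) :
    delta L k A x y = pd (Pi.single k 1, fun h => -nonlin L h k x y) A x y := by
  rw [pd_eq_sum hL.isOpen h hA, delta]
  simp [Pi.single_apply, sub_eq_add_neg]

/-- Commutator of vertical and horizontal derivatives. -/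
theorem dy_delta (hL : IsLocalFinsler D L) (h : (x, y) ∈ D) (hA : SmoothIn D A) (j k : Fin n) :
    dy k (delta L j A) x y =
      delta L j (dy k A) x y - ∑ h, dy k (nonlin L h j) x y * dy h A x y := by
  have hD := hL.isOpen
  have h1 : dy k (delta L j A) x y = dy k (dx j A) x y -
      dy k (fun x y => ∑ h, nonlin L h j x y * dy h A x y) x y :=
    dy_sub hD h k (hA.dx hD j)
      (SmoothIn.sum fun i _ => (hL.smooth_nonlin i j).mul (hA.dy hD i))
  rw [h1, dy_sum_mul hD h k (fun i => hL.smooth_nonlin i j) (fun i => hA.dy hD i),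
    dy_dx_comm hD h hA, delta]
  simp only [dy_dy_comm hD h hA k]
  ring

/-- The vertical derivative of δ_j A = 0, rearranged by the commutator `dy_delta`. It is stated for
a general A because it serves L and L² as well as the square of the changed metric function. -/
theorem delta_dy_of_delta_eq_zero (hL : IsLocalFinsler D L) (hA : SmoothIn D A)
    (h0 : ∀ x y, (x, y) ∈ D → ∀ j, delta L j A x y = 0) (h : (x, y) ∈ D) (i j : Fin n) :
    delta L j (dy i A) x y = ∑ h, dy i (nonlin L h j) x y * dy h A x y := by
  have h1 := hL.dy_delta h hA j i
  rw [dy_congr hL.isOpen h i (A' := fun _ _ => 0) fun x y h => h0 x y h j,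
    dy_eq_pd hL.isOpen (smoothIn_const 0) h, pd_const] at h1
  linarith

theorem delta_dy_dy_of_delta_eq_zero (hL : IsLocalFinsler D L) (hA : SmoothIn D A)
    (h0 : ∀ x y, (x, y) ∈ D → ∀ j, delta L j A x y = 0) (h : (x, y) ∈ D) (i j k : Fin n) :
    delta L j (dy k (dy i A)) x y = ∑ h, dy k (dy i (nonlin L h j)) x y * dy h A x y +
      ∑ h, dy i (nonlin L h j) x y * dy k (dy h A) x y +
      ∑ h, dy k (nonlin L h j) x y * dy h (dy i A) x y := by
  have hD := hL.isOpen
  have h1 := hL.dy_delta h (hA.dy hD i) j k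
  rw [dy_congr hD h k fun x y h => hL.delta_dy_of_delta_eq_zero hA h0 h i j,
    dy_sum_mul hD h k (fun m => (hL.smooth_nonlin m j).dy hD i) (fun m => hA.dy hD m)] at h1
  linarith

theorem sum_y_nonlin (hL : IsLocalFinsler D L) (h : (x, y) ∈ D) (i : Fin n) :
    ∑ k, y k * nonlin L i k x y = 2 * spray L i x y := by
  exact_mod_cast (hL.homog_spray i).euler (hL.smooth_spray i) hL.isOpen h

theorem sum_y_dy_nonlin (hL : IsLocalFinsler D L) (h : (x, y) ∈ D) (i j : Fin n) :
    ∑ k, y k * dy k (nonlin L i j) x y = nonlin L i j x y := by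
  simpa using (hL.homog_nonlin i j).euler (hL.smooth_nonlin i j) hL.isOpen h

theorem sum_y_dy_dy_nonlin (hL : IsLocalFinsler D L) (h : (x, y) ∈ D) (i j k : Fin n) :
    ∑ l, y l * dy l (dy k (nonlin L i j)) x y = 0 := by
  simpa using (hL.homog_dy_nonlin i j k).euler ((hL.smooth_nonlin i j).dy hL.isOpen k) hL.isOpen h

/-- A Finsler metric function that is horizontally constant has the same spray. -/
theorem spray_eq_of_delta_eq_zero (hL : IsLocalFinsler D L)
    {L' : (Fin n → ℝ) → (Fin n → ℝ) → ℝ} (hL' : IsLocalFinsler D L')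
    (h0 : ∀ x y, (x, y) ∈ D → ∀ j, delta L j (sq L') x y = 0) (h : (x, y) ∈ D) (i : Fin n) :
    spray L' i x y = spray L i x y := by
  have hD := hL.isOpen
  refine congrFun (hL'.eq_of_metric_mul h (v := fun i => spray L' i x y)
    (w := fun i => spray L i x y) fun j => ?_) i
  rw [hL'.sum_metric_mul_spray h]
  -- Horizontal constancy and its vertical derivative express all x-derivatives of L'² through the
  -- nonlinear connection of L. Contraction with y, by homogeneity of the connection, leaves the
  -- defining equation of the spray of L', solved by the spray of L.
  have e1 : ∀ k, dx k (dy j (sq L')) x y = ∑ h, nonlin L h k x y * dy h (dy j (sq L')) x y +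
      ∑ h, dy j (nonlin L h k) x y * dy h (sq L') x y := by
    intro k
    have := hL.delta_dy_of_delta_eq_zero hL'.smooth_sq h0 h j k
    rw [delta] at this
    linarith
  have e2 : dx j (sq L') x y = ∑ h, nonlin L h j x y * dy h (sq L') x y := by
    have := h0 x y h j
    rw [delta] at this
    linarith
  have e3 : ∑ k, y k * ∑ h, nonlin L h k x y * dy h (dy j (sq L')) x y =
      4 * ∑ i, metric L' x y j i * spray L i x y := by
    simp only [Finset.mul_sum]
    rw [Finset.sum_comm]
    refine Finset.sum_congr rfl fun m _ => ?_
    have := hL.sum_y_nonlin h m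
    rw [hL'.metric_symm h, metric_eq]
    have e : ∀ k, y k * (nonlin L m k x y * dy m (dy j (sq L')) x y) =
      y k * nonlin L m k x y * dy m (dy j (sq L')) x y := fun k => by ring
    simp only [e]
    rw [← Finset.sum_mul, this]
    ring
  have e4 : ∑ k, y k * ∑ h, dy j (nonlin L h k) x y * dy h (sq L') x y =
      ∑ h, nonlin L h j x y * dy h (sq L') x y := by
    simp only [Finset.mul_sum]
    rw [Finset.sum_comm]
    refine Finset.sum_congr rfl fun m _ => ?_
    rw [← hL.sum_y_dy_nonlin h m j, Finset.sum_mul]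
    refine Finset.sum_congr rfl fun k _ => ?_
    rw [hL.dy_nonlin_comm h m k j]
    ring
  simp only [e1, e2, mul_add, Finset.sum_add_distrib]
  rw [e3, e4]
  ring

theorem hcoef_symm (hL : IsLocalFinsler D L) (h : (x, y) ∈ D) (i j k : Fin n) :
    hcoef L i j k x y = hcoef L i k j x y := by
  have e : ∀ r, delta L r (fun x y => metric L x y j k) x y =
      delta L r (fun x y => metric L x y k j) x y := fun r => by
    rw [hL.delta_eq_pd h (hL.smooth_metric _ _), hL.delta_eq_pd h (hL.smooth_metric _ _)]
    exact pd_congr hL.isOpen h _ fun x y h => hL.metric_symm h j k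
  simp only [hcoef, e]
  congr 1
  exact Finset.sum_congr rfl fun r _ => by ring

theorem delta_metric_symm (hL : IsLocalFinsler D L) (h : (x, y) ∈ D) (i j r : Fin n) :
    delta L r (fun x y => metric L x y i j) x y =
      delta L r (fun x y => metric L x y j i) x y := by
  rw [hL.delta_eq_pd h (hL.smooth_metric _ _), hL.delta_eq_pd h (hL.smooth_metric _ _)]
  exact pd_congr hL.isOpen h _ fun x y h => hL.metric_symm h i j

theorem sum_metric_mul_hcoef (hL : IsLocalFinsler D L) (h : (x, y) ∈ D) (s j k : Fin n) :
    ∑ r, metric L x y s r * hcoef L r j k x y =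
      1 / 2 * (delta L k (fun x y => metric L x y s j) x y +
        delta L j (fun x y => metric L x y s k) x y -
        delta L s (fun x y => metric L x y j k) x y) := by
  rw [← hL.sum_metric_mul_inv h (fun r => delta L k (fun x y => metric L x y r j) x y +
        delta L j (fun x y => metric L x y r k) x y -
        delta L r (fun x y => metric L x y j k) x y) s, Finset.mul_sum]
  exact Finset.sum_congr rfl fun i _ => by rw [hcoef]; ring

/-- The Cartan connection is h-metrical. -/
theorem delta_metric (hL : IsLocalFinsler D L) (h : (x, y) ∈ D) (i j k : Fin n) :
    delta L k (fun x y => metric L x y i j) x y =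
      ∑ r, hcoef L r i k x y * metric L x y r j + ∑ r, hcoef L r j k x y * metric L x y r i := by
  have h1 := hL.sum_metric_mul_hcoef h j i k
  have h2 := hL.sum_metric_mul_hcoef h i j k
  have e : ∀ i j, ∑ r, hcoef L r i k x y * metric L x y r j =
      ∑ r, metric L x y j r * hcoef L r i k x y := fun i j =>
    Finset.sum_congr rfl fun r _ => by rw [hL.metric_symm h, mul_comm]
  rw [e, e, h1, h2, hL.delta_metric_symm h j i k, hL.delta_metric_symm h j k i]
  ring

/-- The h-metrical connection without torsion is unique. -/
theorem hcoef_unique (hL : IsLocalFinsler D L) (h : (x, y) ∈ D)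
    (T : Fin n → Fin n → Fin n → ℝ) (hT : ∀ i j k, T i j k = T i k j)
    (hg : ∀ i j k, delta L k (fun x y => metric L x y i j) x y =
      ∑ r, T r i k * metric L x y r j + ∑ r, T r j k * metric L x y r i) (i j k : Fin n) :
    hcoef L i j k x y = T i j k := by
  refine congrFun (hL.eq_of_metric_mul h (v := fun i => hcoef L i j k x y)
    (w := fun i => T i j k) fun s => ?_) i
  -- Christoffel's argument: in the alternating sum of the three metricity relations, symmetry of T
  -- cancels all but twice one term.
  rw [hL.sum_metric_mul_hcoef h, hg, hg, hg]
  have e : ∀ i j k, ∑ r, T r i j * metric L x y r k = ∑ r, metric L x y k r * T r i j :=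
    fun i j k => Finset.sum_congr rfl fun r _ => by rw [hL.metric_symm h, mul_comm]
  simp only [e, hT _ s, hT _ k j]
  ring

/-- The Landsberg relation between the Cartan and the Berwald connection. -/
theorem sum_metric_mul_hcoef_sub (hL : IsLocalFinsler D L) (h : (x, y) ∈ D) (s i j : Fin n) :
    ∑ r, metric L x y s r * (hcoef L r i j x y - dy i (nonlin L r j) x y) =
      1 / 4 * ∑ r, dy i (dy s (nonlin L r j)) x y * dy r (sq L) x y := by
  have hD := hL.isOpen
  -- Two vertical derivatives of δ_j L² = 0. In the Christoffel combination of these formulas the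
  -- terms in ∂G isolate the Berwald coefficient. The terms in ∂∂G are third derivatives of the
  -- spray, hence totally symmetric, and 1/2 · 1/2 · (1 + 1 - 1) = 1/4.
  have e0 : ∀ i j k, delta L j (fun x y => metric L x y k i) x y =
      1 / 2 * ∑ h, dy k (dy i (nonlin L h j)) x y * dy h (sq L) x y +
      ∑ h, metric L x y k h * dy i (nonlin L h j) x y +
      ∑ h, metric L x y i h * dy k (nonlin L h j) x y := by
    intro i j k
    have e1 : delta L j (fun x y => metric L x y k i) x y =
        1 / 2 * delta L j (dy k (dy i (sq L))) x y := by
      have hs := (hL.smooth_sq.dy hD i).dy hD k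
      rw [hL.delta_eq_pd h (hL.smooth_metric _ _), hL.delta_eq_pd h hs]
      exact pd_const_mul hD h _ (1 / 2) hs
    rw [e1, hL.delta_dy_dy_of_delta_eq_zero hL.smooth_sq (fun x y h j => hL.delta_sq h j) h,
      mul_add, mul_add, Finset.mul_sum _ (fun h => dy i (nonlin L h j) x y * _),
      Finset.mul_sum _ (fun h => dy k (nonlin L h j) x y * _)]
    congr 1
    · congr 1
      exact Finset.sum_congr rfl fun r _ => by rw [metric_eq]; ring
    · exact Finset.sum_congr rfl fun r _ => by rw [hL.metric_symm h, metric_eq]; ring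
  simp only [mul_sub, Finset.sum_sub_distrib]
  rw [hL.sum_metric_mul_hcoef h, e0, e0, e0]
  have c1 : ∀ a b r c, dy a (dy b (nonlin L r c)) x y = dy b (dy a (nonlin L r c)) x y :=
    fun a b r c => dy_dy_comm hD h (hL.smooth_nonlin r c) a b
  have c2 : ∀ a b r c, dy a (dy b (nonlin L r c)) x y = dy a (dy c (nonlin L r b)) x y :=
    fun a b r c => dy_congr hD h a fun x y h => hL.dy_nonlin_comm h r c b
  have f1 : ∀ r, dy s (dy i (nonlin L r j)) x y = dy i (dy s (nonlin L r j)) x y :=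
    fun r => c1 _ _ _ _
  have f2 : ∀ r, dy s (dy j (nonlin L r i)) x y = dy i (dy s (nonlin L r j)) x y :=
    fun r => by rw [c2, c1]
  have f3 : ∀ r, dy i (dy j (nonlin L r s)) x y = dy i (dy s (nonlin L r j)) x y :=
    fun r => c2 _ _ _ _
  simp only [f1, f2, f3]
  simp only [fun r => hL.dy_nonlin_comm h r s i, fun r => hL.dy_nonlin_comm h r s j,
    fun r => hL.dy_nonlin_comm h r i j]
  ring

/-- The Landsberg term in `sum_metric_mul_hcoef_sub` is a vertical derivative of a function
homogeneous of degree 0, so contraction with y kills it. The Berwald coefficient contracts to G^r_j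
by Euler's relation. -/
theorem sum_y_hcoef (hL : IsLocalFinsler D L) (h : (x, y) ∈ D) (r j : Fin n) :
    ∑ i, y i * hcoef L r i j x y = nonlin L r j x y := by
  have hD := hL.isOpen
  refine congrFun (hL.eq_of_metric_mul h (v := fun r => ∑ i, y i * hcoef L r i j x y)
    (w := fun r => nonlin L r j x y) fun s => ?_) r
  have h1 : ∑ i, y i * ∑ r, metric L x y s r *
      (hcoef L r i j x y - dy i (nonlin L r j) x y) = 0 := by
    simp only [hL.sum_metric_mul_hcoef_sub h]
    simp only [Finset.mul_sum]
    rw [Finset.sum_comm]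
    refine Finset.sum_eq_zero fun r _ => ?_
    have := hL.sum_y_dy_dy_nonlin h r j s
    have e : ∀ i, y i * (1 / 4 * (dy i (dy s (nonlin L r j)) x y * dy r (sq L) x y)) =
      y i * dy i (dy s (nonlin L r j)) x y * (1 / 4 * dy r (sq L) x y) := fun i => by ring
    simp only [e]
    rw [← Finset.sum_mul, this, zero_mul]
  have h2 : ∑ i, y i * ∑ r, metric L x y s r *
      (hcoef L r i j x y - dy i (nonlin L r j) x y) =
      ∑ r, metric L x y s r * ∑ i, y i * hcoef L r i j x y -
      ∑ r, metric L x y s r * ∑ i, y i * dy i (nonlin L r j) x y := by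
    simp only [Finset.mul_sum]
    rw [Finset.sum_comm, ← Finset.sum_sub_distrib]
    refine Finset.sum_congr rfl fun r _ => ?_
    rw [← Finset.sum_sub_distrib]
    exact Finset.sum_congr rfl fun r _ => by ring
  simp only [hL.sum_y_dy_nonlin h] at h2
  linarith

/-- `g_{ri} (F^r_{jk} - G^r_{jk})` is orthogonal to the supporting element. -/
theorem sum_hcoef_mul_dy_sq (hL : IsLocalFinsler D L) (h : (x, y) ∈ D) (i j : Fin n) :
    ∑ r, hcoef L r i j x y * dy r (sq L) x y =
      ∑ r, dy i (nonlin L r j) x y * dy r (sq L) x y := by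
  have hD := hL.isOpen
  have e1 : ∀ i, dy i (sq L) x y = 2 * ∑ k, metric L x y i k * y k := fun i => by
    rw [hL.metric_mul_y h]; ring
  -- Here y is contracted with the index s, which is the lowered one; the Landsberg term is
  -- symmetric and vanishes as before.
  have h1 : ∑ s, y s * ∑ r, metric L x y s r *
      (hcoef L r i j x y - dy i (nonlin L r j) x y) = 0 := by
    simp only [hL.sum_metric_mul_hcoef_sub h]
    simp only [Finset.mul_sum]
    rw [Finset.sum_comm]
    refine Finset.sum_eq_zero fun r _ => ?_
    have := hL.sum_y_dy_dy_nonlin h r j i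
    have e : ∀ s, y s * (1 / 4 * (dy i (dy s (nonlin L r j)) x y * dy r (sq L) x y)) =
      y s * dy s (dy i (nonlin L r j)) x y * (1 / 4 * dy r (sq L) x y) := fun s => by
        rw [dy_dy_comm hD h (hL.smooth_nonlin r j) i s]; ring
    simp only [e]
    rw [← Finset.sum_mul, this, zero_mul]
  rw [← sub_eq_zero, ← Finset.sum_sub_distrib]
  have h2 : ∑ r, (hcoef L r i j x y * dy r (sq L) x y -
      dy i (nonlin L r j) x y * dy r (sq L) x y) = 2 * ∑ s, y s * ∑ r, metric L x y s r *
      (hcoef L r i j x y - dy i (nonlin L r j) x y) := by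
    simp only [e1, Finset.mul_sum]
    rw [Finset.sum_comm]
    refine Finset.sum_congr rfl fun r _ => ?_
    rw [← Finset.sum_sub_distrib]
    refine Finset.sum_congr rfl fun s _ => ?_
    rw [hL.metric_symm h]
    ring
  rw [h2, h1, mul_zero]

/-! ### The Cartan tensor and the vertical derivatives of L -/

theorem cartan_symm_left (hL : IsLocalFinsler D L) (h : (x, y) ∈ D) (i j k : Fin n) :
    cartan L i j k x y = cartan L j i k x y := by
  rw [cartan, cartan, dy_congr hL.isOpen h k fun x y h => hL.metric_symm h i j]

theorem cartan_symm_right (hL : IsLocalFinsler D L) (h : (x, y) ∈ D) (i j k : Fin n) :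
    cartan L i j k x y = cartan L i k j x y := by
  have hD := hL.isOpen
  have e : ∀ i j k, dy k (fun x y => metric L x y i j) x y =
      1 / 2 * dy k (dy i (dy j (sq L))) x y := fun i j k =>
    dy_const_mul hD h k (1 / 2) ((hL.smooth_sq.dy hD j).dy hD i)
  rw [cartan, cartan, e, e, dy_congr hD h k fun x y h => dy_dy_comm hD h hL.smooth_sq i j,
    dy_congr hD h j fun x y h => dy_dy_comm hD h hL.smooth_sq i k,
    dy_dy_comm hD h (hL.smooth_sq.dy hD i) k j]

theorem sum_cartan_mul_y (hL : IsLocalFinsler D L) (h : (x, y) ∈ D) (i j : Fin n) :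
    ∑ k, cartan L i j k x y * y k = 0 := by
  have hh : HomogIn D 0 fun x y => metric L x y i j := fun x y h c hc => by
    simp only [hL.homog_metric h hc, pow_zero, one_mul]
  have h1 := hh.euler (hL.smooth_metric i j) hL.isOpen h
  rw [Nat.cast_zero, zero_mul] at h1
  have : ∑ k, cartan L i j k x y * y k =
      1 / 2 * ∑ k, y k * dy k (fun x y => metric L x y i j) x y := by
    rw [Finset.mul_sum]
    exact Finset.sum_congr rfl fun k _ => by rw [cartan]; ring
  rw [this, h1, mul_zero]

theorem dy_sq (hL : IsLocalFinsler D L) (h : (x, y) ∈ D) (i : Fin n) :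
    dy i (sq L) x y = 2 * L x y * dy i L x y := by
  have h1 := dy_mul hL.isOpen h i hL.smoothIn hL.smoothIn
  have h2 : sq L = fun x y => L x y * L x y := by
    funext x y
    exact pow_two _
  rw [h2, h1]
  ring

theorem metric_eq_mul_add (hL : IsLocalFinsler D L) (h : (x, y) ∈ D) (i j : Fin n) :
    metric L x y i j = dy i L x y * dy j L x y + L x y * dy i (dy j L) x y := by
  have hD := hL.isOpen
  rw [metric_eq, dy_congr hD h i fun x y h => hL.dy_sq h j]
  have h1 : dy i (fun x y => 2 * L x y * dy j L x y) x y =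
      dy i (fun x y => 2 * L x y) x y * dy j L x y + 2 * L x y * dy i (dy j L) x y :=
    dy_mul hD h i ((smoothIn_const 2).mul hL.smoothIn) (hL.smoothIn.dy hD j)
  rw [h1, dy_const_mul hD h i 2 hL.smoothIn]
  ring

theorem angular_eq (hL : IsLocalFinsler D L) (h : (x, y) ∈ D) (i j : Fin n) :
    angular L i j x y = metric L x y i j - dy i L x y * dy j L x y := by
  rw [hL.metric_eq_mul_add h, angular]
  ring

theorem delta_self (hL : IsLocalFinsler D L) (h : (x, y) ∈ D) (j : Fin n) :
    delta L j L x y = 0 := by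
  have h1 := hL.delta_sq h j
  have h2 : sq L = fun x y => L x y * L x y := by
    funext x y
    exact pow_two _
  rw [hL.delta_eq_pd h hL.smooth_sq, h2, pd_mul hL.isOpen h _ hL.smoothIn hL.smoothIn,
    ← hL.delta_eq_pd h hL.smoothIn] at h1
  have h3 := hL.pos x y h
  have : 2 * L x y * delta L j L x y = 0 := by linarith
  rcases mul_eq_zero.1 this with h4 | h4
  · linarith
  · exact h4

/-- The general formula for δ_j l_i has the Berwald coefficients in place of F. The two agree after
contraction with l_r because their difference is orthogonal to the supporting element. -/
theorem delta_dy_self (hL : IsLocalFinsler D L) (h : (x, y) ∈ D) (i j : Fin n) :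
    delta L j (dy i L) x y = ∑ r, hcoef L r i j x y * dy r L x y := by
  rw [hL.delta_dy_of_delta_eq_zero hL.smoothIn (fun x y h j => hL.delta_self h j) h]
  have h1 := hL.sum_hcoef_mul_dy_sq h i j
  simp only [hL.dy_sq h] at h1
  have e : ∀ a : Fin n → ℝ, ∑ r, a r * (2 * L x y * dy r L x y) =
      2 * L x y * ∑ r, a r * dy r L x y := fun a => by
    rw [Finset.mul_sum]
    exact Finset.sum_congr rfl fun r _ => by ring
  rw [e, e] at h1
  have h3 := hL.pos x y h
  exact (mul_left_cancel₀ (by positivity) h1).symm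

theorem sum_y_dy_dy_self (hL : IsLocalFinsler D L) (h : (x, y) ∈ D) (i : Fin n) :
    ∑ k, y k * dy k (dy i L) x y = 0 := by
  have : HomogIn D 0 (dy i L) := hL.homog.deriv_dy hL.smoothIn hL.isOpen hL.conic i
  simpa using this.euler (hL.smoothIn.dy hL.isOpen i) hL.isOpen h

theorem metric_mul_y' (hL : IsLocalFinsler D L) (h : (x, y) ∈ D) (i : Fin n) :
    ∑ k, metric L x y i k * y k = L x y * dy i L x y := by
  rw [hL.metric_mul_y h, hL.dy_sq h]
  ring

end IsLocalFinsler

end LocalFinsler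

/-! ### Kropina changes by a parallel h-vector, in coordinates -/

section Kropina

variable {n : ℕ} {D : Set ((Fin n → ℝ) × (Fin n → ℝ))}
  {L L' A A' ρ : (Fin n → ℝ) → (Fin n → ℝ) → ℝ} {b : (Fin n → ℝ) → (Fin n → ℝ) → Fin n → ℝ}
  {x y : Fin n → ℝ}

/-- `A` is smooth and its derivative at `(x, y)` in the direction `w` vanishes. -/
def PdConst (D : Set ((Fin n → ℝ) × (Fin n → ℝ))) (w : (Fin n → ℝ) × (Fin n → ℝ))
    (x y : Fin n → ℝ) (A : (Fin n → ℝ) → (Fin n → ℝ) → ℝ) : Prop :=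
  SmoothIn D A ∧ pd w A x y = 0

theorem pdConst_const (w) (c : ℝ) : PdConst D w x y fun _ _ => c :=
  ⟨smoothIn_const c, pd_const w c⟩

theorem PdConst.mul {w} (hA : PdConst D w x y A) (hA' : PdConst D w x y A') (hD : IsOpen D)
    (h : (x, y) ∈ D) : PdConst D w x y fun x y => A x y * A' x y :=
  ⟨hA.1.mul hA'.1, by rw [pd_mul hD h w hA.1 hA'.1, hA.2, hA'.2]; ring⟩

theorem PdConst.add {w} (hA : PdConst D w x y A) (hA' : PdConst D w x y A') (hD : IsOpen D)
    (h : (x, y) ∈ D) : PdConst D w x y fun x y => A x y + A' x y :=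
  ⟨hA.1.add hA'.1, by rw [pd_add hD h w hA.1 hA'.1, hA.2, hA'.2]; ring⟩

theorem PdConst.div {w} (hA : PdConst D w x y A) (hA' : PdConst D w x y A') (hD : IsOpen D)
    (h : (x, y) ∈ D) (h0 : ∀ x y, (x, y) ∈ D → A' x y ≠ 0) :
    PdConst D w x y fun x y => A x y / A' x y :=
  ⟨hA.1.div hA'.1 h0, by rw [pd_div hD h w hA.1 hA'.1 h0, hA.2, hA'.2]; simp⟩

theorem PdConst.pd_mul {w} (hA : PdConst D w x y A) (hA' : SmoothIn D A') (hD : IsOpen D)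
    (h : (x, y) ∈ D) : pd w (fun x y => A x y * A' x y) x y = A x y * pd w A' x y := by
  rw [FinslerHyp.pd_mul hD h w hA.1 hA', hA.2]
  ring

/-- Two linear equations in at least three unknowns have a nontrivial solution. -/
theorem exists_ne_zero_orthogonal (hn : 3 ≤ n) (a c : Fin n → ℝ) :
    ∃ Z : Fin n → ℝ, Z ≠ 0 ∧ ∑ i, Z i * a i = 0 ∧ ∑ i, Z i * c i = 0 := by
  let φ : (Fin n → ℝ) →ₗ[ℝ] (Fin 2 → ℝ) := Matrix.mulVecLin (Matrix.of ![a, c])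
  have h1 : LinearMap.ker φ ≠ ⊥ := LinearMap.ker_ne_bot_of_finrank_lt (by simp; omega)
  obtain ⟨Z, hZ, hZ0⟩ := (Submodule.ne_bot_iff _).1 h1
  have h2 : φ Z = 0 := hZ
  refine ⟨Z, hZ0, ?_, ?_⟩
  · have := congrFun h2 0
    simpa [φ, Matrix.mulVec, dotProduct, mul_comm] using this
  · have := congrFun h2 1
    simpa [φ, Matrix.mulVec, dotProduct, mul_comm] using this

theorem IsLocalFinsler.sum_metric_pos (hL : IsLocalFinsler D L) (h : (x, y) ∈ D)
    {Z : Fin n → ℝ} (hZ : Z ≠ 0) : 0 < ∑ i, ∑ j, metric L x y i j * Z i * Z j := by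
  have := (hL.posDef x y h).dotProduct_mulVec_pos hZ
  have e : star Z ⬝ᵥ (metric L x y).mulVec Z = ∑ i, ∑ j, metric L x y i j * Z i * Z j := by
    simp only [dotProduct, Matrix.mulVec, Finset.mul_sum]
    refine Finset.sum_congr rfl fun i _ => Finset.sum_congr rfl fun j _ => ?_
    simp
    ring
  rwa [e] at this

/-- On the kernel of l the metric reduces to L times the Hessian of L, so the latter inherits
positivity there. -/
theorem IsLocalFinsler.sum_dy_dy_pos (hL : IsLocalFinsler D L) (h : (x, y) ∈ D)
    {Z : Fin n → ℝ} (hZ : Z ≠ 0) (hy : ∑ i, Z i * dy i L x y = 0) :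
    0 < ∑ i, ∑ j, Z i * Z j * dy i (dy j L) x y := by
  have h1 := hL.sum_metric_pos h hZ
  have e : ∑ i, ∑ j, metric L x y i j * Z i * Z j =
      (∑ i, Z i * dy i L x y) * (∑ j, Z j * dy j L x y) +
      L x y * ∑ i, ∑ j, Z i * Z j * dy i (dy j L) x y := by
    rw [Finset.sum_mul_sum, Finset.mul_sum, ← Finset.sum_add_distrib]
    refine Finset.sum_congr rfl fun i _ => ?_
    rw [Finset.mul_sum, ← Finset.sum_add_distrib]
    refine Finset.sum_congr rfl fun j _ => ?_
    rw [hL.metric_eq_mul_add h]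
    ring
  rw [e, hy, zero_mul, zero_add] at h1
  exact pos_of_mul_pos_right h1 (hL.pos x y h).le

/-- The angular metric tensor has rank at least two if the dimension is at least three. -/
theorem IsLocalFinsler.eq_zero_of_symm (hL : IsLocalFinsler D L) (hn : 3 ≤ n) (h : (x, y) ∈ D)
    (c : Fin n → ℝ) (hc : ∀ i j k, c k * dy i (dy j L) x y = c j * dy i (dy k L) x y)
    (k : Fin n) : c k = 0 := by
  -- Contracting the hypothesis with Zⁱ Zʲ for Z annihilated by l and c leaves c_k times a positive
  -- number. Such a Z exists because n ≥ 3.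
  obtain ⟨Z, hZ, h1, h2⟩ := exists_ne_zero_orthogonal hn (fun i => dy i L x y) c
  have h3 := hL.sum_dy_dy_pos h hZ h1
  have e : c k * ∑ i, ∑ j, Z i * Z j * dy i (dy j L) x y =
      (∑ j, Z j * c j) * ∑ i, Z i * dy i (dy k L) x y := by
    rw [Finset.mul_sum, Finset.mul_sum]
    refine Finset.sum_congr rfl fun i _ => ?_
    rw [Finset.mul_sum, Finset.sum_mul]
    refine Finset.sum_congr rfl fun j _ => ?_
    linear_combination Z i * Z j * hc i j k
  rw [h2, zero_mul] at e
  exact (mul_eq_zero.1 e).resolve_right h3.ne'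

theorem IsLocalFinsler.sum_cartan_eq_pd (hL : IsLocalFinsler D L)
    (h : (x, y) ∈ D) (Z : Fin n → ℝ) (i j : Fin n) :
    ∑ k, cartan L i j k x y * Z k = 1 / 2 * pd (0, Z) (fun x y => metric L x y i j) x y := by
  rw [pd_eq_sum hL.isOpen h (hL.smooth_metric i j)]
  simp only [Pi.zero_apply, zero_mul, Finset.sum_const_zero, zero_add, Finset.mul_sum]
  exact Finset.sum_congr rfl fun k _ => by rw [cartan]; ring

/-- `L' = L² / (b_i yⁱ)` is a Kropina change of `L` by the parallel h-vector `b`. -/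
structure IsParallelKropina (D : Set ((Fin n → ℝ) × (Fin n → ℝ)))
    (L : (Fin n → ℝ) → (Fin n → ℝ) → ℝ) (b : (Fin n → ℝ) → (Fin n → ℝ) → Fin n → ℝ)
    (ρ L' : (Fin n → ℝ) → (Fin n → ℝ) → ℝ) : Prop where
  finsler : IsLocalFinsler D L
  finsler' : IsLocalFinsler D L'
  eq_div : ∀ x y, L' x y = L x y ^ 2 / ∑ i, y i * b x y i
  smooth_b : ∀ i, SmoothIn D fun x y => b x y i
  vcov_eq_zero : ∀ x y, (x, y) ∈ D → ∀ i j, vcov L b i j x y = 0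
  hcov_eq_zero : ∀ x y, (x, y) ∈ D → ∀ i j, hcov L b i j x y = 0
  h_vector : ∀ x y, (x, y) ∈ D → ∀ i j,
    L x y * ∑ h, cartanUp L h i j x y * b x y h = ρ x y * angular L i j x y
  ne_zero : ∀ x y, (x, y) ∈ D → ρ x y ≠ 0

/-- The quotient `L / (b_i yⁱ)`. -/
noncomputable def ratio (L : (Fin n → ℝ) → (Fin n → ℝ) → ℝ)
    (b : (Fin n → ℝ) → (Fin n → ℝ) → Fin n → ℝ) (x y : Fin n → ℝ) : ℝ :=
  L x y / ∑ i, y i * b x y i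

/-- The coefficient of `g_{ij}` in the metric tensor of the Kropina change. -/
noncomputable def factor (L : (Fin n → ℝ) → (Fin n → ℝ) → ℝ)
    (b : (Fin n → ℝ) → (Fin n → ℝ) → Fin n → ℝ) (ρ : (Fin n → ℝ) → (Fin n → ℝ) → ℝ)
    (x y : Fin n → ℝ) : ℝ :=
  ratio L b x y ^ 2 * (2 - ρ x y * ratio L b x y)

namespace IsParallelKropina

variable (hK : IsParallelKropina D L b ρ L')
include hK

theorem isOpen : IsOpen D := hK.finsler.isOpen

/-- The condition b_i|_j = 0 identifies the derivative with C^r_{ij} b_r, which the h-vector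
condition identifies with ρ h_{ij}/L; one factor L cancels. -/
theorem dy_b (h : (x, y) ∈ D) (i j : Fin n) :
    dy j (fun x y => b x y i) x y = ρ x y * dy i (dy j L) x y := by
  have h1 := hK.vcov_eq_zero x y h i j
  have h2 := hK.h_vector x y h i j
  rw [vcov, sub_eq_zero] at h1
  rw [← h1, angular] at h2
  have h3 := (hK.finsler.pos x y h).ne'
  apply mul_left_cancel₀ h3
  rw [h2]
  ring

theorem smooth_beta : SmoothIn D fun x y => ∑ i, y i * b x y i :=
  SmoothIn.sum fun i _ => (smoothIn_coord i).mul (hK.smooth_b i)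

/-- Forced by positivity of the Kropina function L²/β. A vanishing β is also excluded, since
division by zero yields 0. -/
theorem beta_pos (h : (x, y) ∈ D) : 0 < ∑ i, y i * b x y i := by
  have h1 := hK.finsler'.pos x y h
  have h2 := hK.finsler.pos x y h
  rw [hK.eq_div] at h1
  by_contra hc
  exact absurd h1 (not_lt.2 (div_nonpos_of_nonneg_of_nonpos (by positivity) (not_lt.1 hc)))

/-- The remaining term yᵏ ∂b_k/∂yⁱ is ρ yᵏ ∂²L/∂yᵏ∂yⁱ, which vanishes because l_i has degree 0. -/
theorem dy_beta (h : (x, y) ∈ D) (i : Fin n) :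
    dy i (fun x y => ∑ i, y i * b x y i) x y = b x y i := by
  rw [dy_sum_coord_mul hK.isOpen h i hK.smooth_b]
  simp only [hK.dy_b h]
  have h1 := hK.finsler.sum_y_dy_dy_self h i
  have e : ∀ k, y k * (ρ x y * dy k (dy i L) x y) = ρ x y * (y k * dy k (dy i L) x y) :=
    fun k => by ring
  simp only [e]
  rw [← Finset.mul_sum, h1]
  ring

theorem delta_b (h : (x, y) ∈ D) (i j : Fin n) :
    delta L j (fun x y => b x y i) x y = ∑ r, hcoef L r i j x y * b x y r := by
  have h1 := hK.hcov_eq_zero x y h i j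
  rw [hcov] at h1
  rw [delta]
  simp only [mul_comm (nonlin L _ _ _ _)]
  linarith

/-- This is b_{i|j} yⁱ = 0, written out by means of yⁱ F^r_{ij} = G^r_j. -/
theorem delta_beta (h : (x, y) ∈ D) (j : Fin n) :
    delta L j (fun x y => ∑ i, y i * b x y i) x y = 0 := by
  rw [delta, dx_sum_coord_mul hK.isOpen h j hK.smooth_b]
  simp only [hK.dy_beta h]
  have h1 : ∀ i, dx j (fun x y => b x y i) x y = ∑ r, hcoef L r i j x y * b x y r +
      ∑ h, nonlin L h j x y * dy h (fun x y => b x y i) x y := fun i => by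
    have := hK.delta_b h i j
    rw [delta] at this
    linarith
  simp only [h1, mul_add, Finset.sum_add_distrib]
  have h2 : ∑ i, y i * ∑ r, hcoef L r i j x y * b x y r = ∑ r, nonlin L r j x y * b x y r := by
    simp only [Finset.mul_sum]
    rw [Finset.sum_comm]
    refine Finset.sum_congr rfl fun r _ => ?_
    rw [← hK.finsler.sum_y_hcoef h r j, Finset.sum_mul]
    exact Finset.sum_congr rfl fun i _ => by ring
  have h3 : ∑ i, y i * ∑ h, nonlin L h j x y * dy h (fun x y => b x y i) x y = 0 := by
    simp only [Finset.mul_sum]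
    rw [Finset.sum_comm]
    refine Finset.sum_eq_zero fun r _ => ?_
    have := hK.finsler.sum_y_dy_dy_self h r
    have e : ∀ i, y i * (nonlin L r j x y * dy r (fun x y => b x y i) x y) =
        nonlin L r j x y * ρ x y * (y i * dy i (dy r L) x y) := fun i => by
      rw [hK.dy_b h]; ring
    simp only [e]
    rw [← Finset.mul_sum, this, mul_zero]
  rw [h2, h3]
  ring

theorem smooth_ratio : SmoothIn D (ratio L b) :=
  hK.finsler.smoothIn.div hK.smooth_beta fun _ _ h => (hK.beta_pos h).ne'

/-- The scalar ρ is only given as a function. It is recovered as the ratio of the Euclidean inner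
product of ∂b_i/∂yʲ with the Hessian of L to the squared norm of the Hessian, which does not vanish
since the Hessian is positive on the kernel of l. -/
theorem smooth_rho (hn : 3 ≤ n) : SmoothIn D ρ := by
  have hs : ∀ i j, SmoothIn D (dy i (dy j L)) := fun i j =>
    (hK.finsler.smoothIn.dy hK.isOpen j).dy hK.isOpen i
  have h0 : ∀ x y, (x, y) ∈ D → ∑ i, ∑ j, dy i (dy j L) x y * dy i (dy j L) x y ≠ 0 := by
    intro x y h h1
    obtain ⟨Z, hZ, h2, -⟩ := exists_ne_zero_orthogonal hn (fun i => dy i L x y) 0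
    refine (hK.finsler.sum_dy_dy_pos h hZ h2).ne' (Finset.sum_eq_zero fun i _ =>
      Finset.sum_eq_zero fun j _ => ?_)
    rw [Finset.sum_eq_zero_iff_of_nonneg
      fun i _ => Finset.sum_nonneg fun j _ => mul_self_nonneg _] at h1
    have h3 := h1 i (Finset.mem_univ i)
    rw [Finset.sum_eq_zero_iff_of_nonneg fun j _ => mul_self_nonneg _] at h3
    rw [mul_self_eq_zero.1 (h3 j (Finset.mem_univ j)), mul_zero]
  have h1 : SmoothIn D fun x y =>
      (∑ i, ∑ j, dy j (fun x y => b x y i) x y * dy i (dy j L) x y) /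
        ∑ i, ∑ j, dy i (dy j L) x y * dy i (dy j L) x y :=
    SmoothIn.div (SmoothIn.sum fun i _ => SmoothIn.sum fun j _ =>
        ((hK.smooth_b i).dy hK.isOpen j).mul (hs i j))
      (SmoothIn.sum fun i _ => SmoothIn.sum fun j _ => (hs i j).mul (hs i j)) h0
  refine h1.congr fun x y h => ?_
  rw [eq_div_iff (h0 x y h), Finset.mul_sum]
  refine Finset.sum_congr rfl fun i _ => ?_
  rw [Finset.mul_sum]
  refine Finset.sum_congr rfl fun j _ => ?_
  rw [hK.dy_b h]
  ring

theorem smooth_factor (hn : 3 ≤ n) : SmoothIn D (factor L b ρ) :=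
  (hK.smooth_ratio.pow 2).mul ((smoothIn_const 2).sub ((hK.smooth_rho hn).mul hK.smooth_ratio))

/-- The scalar `ρ` does not depend on the supporting element. -/
theorem dy_rho (hn : 3 ≤ n) (h : (x, y) ∈ D) (k : Fin n) : dy k ρ x y = 0 := by
  have hD := hK.isOpen
  have hs : ∀ i j, SmoothIn D (dy i (dy j L)) := fun i j =>
    (hK.finsler.smoothIn.dy hD j).dy hD i
  refine hK.finsler.eq_zero_of_symm hn h (fun k => dy k ρ x y) (fun i j k => ?_) k
  -- Differentiate ∂b_i/∂yʲ = ρ ∂²L/∂yⁱ∂yʲ once more. The left side and the third derivatives of L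
  -- are symmetric in j and k, so the term with ∂ρ must be symmetric too.
  have h1 : ∀ j k, dy k (dy j (fun x y => b x y i)) x y =
      dy k ρ x y * dy i (dy j L) x y + ρ x y * dy k (dy i (dy j L)) x y := fun j k => by
    rw [dy_congr hD h k fun x y h => hK.dy_b h i j, dy_mul hD h k (hK.smooth_rho hn) (hs i j)]
  have h2 := dy_dy_comm hD h (hK.smooth_b i) j k
  rw [h1, h1] at h2
  have h3 : dy k (dy i (dy j L)) x y = dy j (dy i (dy k L)) x y := by
    rw [dy_congr hD h k fun x y h => dy_dy_comm hD h hK.finsler.smoothIn i j,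
      dy_dy_comm hD h (hK.finsler.smoothIn.dy hD i),
      dy_congr hD h j fun x y h => dy_dy_comm hD h hK.finsler.smoothIn k i]
  rw [h3] at h2
  linarith

/-- The scalar `ρ` is horizontally constant. -/
theorem delta_rho (hn : 3 ≤ n) (h : (x, y) ∈ D) (k : Fin n) : delta L k ρ x y = 0 := by
  have hD := hK.isOpen
  have hL := hK.finsler
  have hs : ∀ i j, SmoothIn D (dy i (dy j L)) := fun i j => (hL.smoothIn.dy hD j).dy hD i
  refine hL.eq_zero_of_symm hn h (fun k => delta L k ρ x y) (fun i j k => ?_) k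
  have hb : ∀ x y, (x, y) ∈ D → ∀ a c, dy a (dy c fun x y => ∑ i, y i * b x y i) x y =
      ρ x y * dy a (dy c L) x y := fun x y h a c => by
    rw [dy_congr hD h a fun x y h => hK.dy_beta h c, hK.dy_b h, dy_dy_comm hD h hL.smoothIn]
  -- The formula for δ_k of a Hessian is applied to β and to L; the Hessian of β is ρ times that of
  -- L. Subtraction cancels the terms with Hessians, and what is left on the right is symmetric in j
  -- and k.
  have h1 : ∀ j k, delta L k ρ x y * dy i (dy j L) x y =
      ∑ h, dy i (dy j (nonlin L h k)) x y * (b x y h - ρ x y * dy h L x y) := by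
    intro j k
    have e1 := hL.delta_dy_dy_of_delta_eq_zero hK.smooth_beta
      (fun x y h j => hK.delta_beta h j) h j k i
    have e2 := hL.delta_dy_dy_of_delta_eq_zero hL.smoothIn (fun x y h j => hL.delta_self h j) h j k i
    simp only [hb x y h, hK.dy_beta h] at e1
    rw [hL.delta_eq_pd h (((hK.smooth_beta.dy hD j).dy hD i)),
      pd_congr hD h _ fun x y h => hb x y h i j,
      pd_mul hD h _ (hK.smooth_rho hn) (hs i j), ← hL.delta_eq_pd h (hK.smooth_rho hn),
      ← hL.delta_eq_pd h (hs i j), e2] at e1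
    have e3 : ∀ a c : Fin n → ℝ, ∑ h, a h * (ρ x y * c h) = ρ x y * ∑ h, a h * c h :=
      fun a c => by
        rw [Finset.mul_sum]
        exact Finset.sum_congr rfl fun r _ => by ring
    simp only [mul_sub, Finset.sum_sub_distrib]
    rw [e3] at e1 ⊢
    rw [e3] at e1
    linarith
  rw [h1, h1]
  exact Finset.sum_congr rfl fun r _ => by
    rw [dy_congr hD h i fun x y h => hL.dy_nonlin_comm h r k j]

theorem pdConst_delta_beta (h : (x, y) ∈ D) (k : Fin n) :
    PdConst D (Pi.single k 1, fun h => -nonlin L h k x y) x y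
      fun x y => ∑ i, y i * b x y i :=
  ⟨hK.smooth_beta, by rw [← hK.finsler.delta_eq_pd h hK.smooth_beta, hK.delta_beta h]⟩

theorem pdConst_delta_self (h : (x, y) ∈ D) (k : Fin n) :
    PdConst D (Pi.single k 1, fun h => -nonlin L h k x y) x y L :=
  ⟨hK.finsler.smoothIn, by
    rw [← hK.finsler.delta_eq_pd h hK.finsler.smoothIn, hK.finsler.delta_self h]⟩

theorem pdConst_delta_ratio (h : (x, y) ∈ D) (k : Fin n) :
    PdConst D (Pi.single k 1, fun h => -nonlin L h k x y) x y (ratio L b) :=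
  (hK.pdConst_delta_self h k).div (hK.pdConst_delta_beta h k) hK.isOpen h
    fun _ _ h => (hK.beta_pos h).ne'

theorem pdConst_delta_rho (hn : 3 ≤ n) (h : (x, y) ∈ D) (k : Fin n) :
    PdConst D (Pi.single k 1, fun h => -nonlin L h k x y) x y ρ :=
  ⟨hK.smooth_rho hn, by rw [← hK.finsler.delta_eq_pd h (hK.smooth_rho hn), hK.delta_rho hn h]⟩

/-- Used with Z normal to the hypersurface, where both l and b annihilate Z. The coefficients in
`metric_star` are then constant to first order along Z. -/
theorem pdConst_dy_ratio (h : (x, y) ∈ D) {Z : Fin n → ℝ} (h1 : ∑ k, Z k * dy k L x y = 0)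
    (h2 : ∑ k, Z k * b x y k = 0) : PdConst D (0, Z) x y (ratio L b) := by
  have hb : PdConst D (0, Z) x y fun x y => ∑ i, y i * b x y i :=
    ⟨hK.smooth_beta, by
      rw [pd_eq_sum hK.isOpen h hK.smooth_beta]; simp only [hK.dy_beta h]; simp [h2]⟩
  have hl : PdConst D (0, Z) x y L :=
    ⟨hK.finsler.smoothIn, by rw [pd_eq_sum hK.isOpen h hK.finsler.smoothIn]; simp [h1]⟩
  exact hl.div hb hK.isOpen h fun _ _ h => (hK.beta_pos h).ne'

theorem pdConst_dy_rho (hn : 3 ≤ n) (h : (x, y) ∈ D) (Z : Fin n → ℝ) :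
    PdConst D (0, Z) x y ρ :=
  ⟨hK.smooth_rho hn, by
    rw [pd_eq_sum hK.isOpen h (hK.smooth_rho hn)]; simp [hK.dy_rho hn h]⟩

/-! ### Metric, connection and Cartan tensor of the Kropina change -/

theorem eq_mul_ratio (x y : Fin n → ℝ) : L' x y = L x y * ratio L b x y := by
  rw [hK.eq_div, ratio]
  ring

theorem dy_ratio (h : (x, y) ∈ D) (i : Fin n) :
    dy i (ratio L b) x y =
      (dy i L x y - ratio L b x y * b x y i) / ∑ i, y i * b x y i := by
  rw [dy_eq_pd hK.isOpen hK.smooth_ratio h]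
  have h1 := pd_div hK.isOpen h (0, Pi.single i 1) hK.finsler.smoothIn hK.smooth_beta
    fun _ _ h => (hK.beta_pos h).ne'
  rw [← dy_eq_pd hK.isOpen hK.finsler.smoothIn h, ← dy_eq_pd hK.isOpen hK.smooth_beta h,
    hK.dy_beta h] at h1
  exact h1

theorem dy_star (h : (x, y) ∈ D) (i : Fin n) :
    dy i L' x y = 2 * ratio L b x y * dy i L x y -
      ratio L b x y * ratio L b x y * b x y i := by
  rw [dy_congr hK.isOpen h i fun x y _ => hK.eq_mul_ratio x y,
    dy_mul hK.isOpen h i hK.finsler.smoothIn hK.smooth_ratio, hK.dy_ratio h]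
  have h1 := (hK.beta_pos h).ne'
  rw [ratio]
  field_simp
  ring

theorem dy_dy_star (h : (x, y) ∈ D) (i j : Fin n) :
    dy i (dy j L') x y =
      (2 * ratio L b x y - ρ x y * ratio L b x y ^ 2) * dy i (dy j L) x y +
        2 / (∑ i, y i * b x y i) * (dy i L x y - ratio L b x y * b x y i) *
          (dy j L x y - ratio L b x y * b x y j) := by
  have hD := hK.isOpen
  have s1 : SmoothIn D fun x y => 2 * ratio L b x y := (smoothIn_const 2).mul hK.smooth_ratio
  have s2 : SmoothIn D (dy j L) := hK.finsler.smoothIn.dy hD j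
  have s3 : SmoothIn D fun x y => ratio L b x y * ratio L b x y :=
    hK.smooth_ratio.mul hK.smooth_ratio
  rw [dy_congr hD h i fun x y h => hK.dy_star h j,
    dy_sub hD h i (s1.mul s2) (s3.mul (hK.smooth_b j)), dy_mul hD h i s1 s2,
    dy_mul hD h i s3 (hK.smooth_b j), dy_const_mul hD h i 2 hK.smooth_ratio,
    dy_mul hD h i hK.smooth_ratio hK.smooth_ratio, hK.dy_ratio h, hK.dy_b h,
    dy_dy_comm hD h hK.finsler.smoothIn j i]
  ring

/-- The metric tensor of the Kropina change. -/
theorem metric_star (h : (x, y) ∈ D) (i j : Fin n) :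
    metric L' x y i j = factor L b ρ x y * metric L x y i j +
      (4 * ratio L b x y ^ 2 + ρ x y * ratio L b x y ^ 3) * (dy i L x y * dy j L x y) +
      -4 * ratio L b x y ^ 3 * (dy i L x y * b x y j + dy j L x y * b x y i) +
      3 * ratio L b x y ^ 4 * (b x y i * b x y j) := by
  rw [hK.finsler'.metric_eq_mul_add h, hK.dy_star h, hK.dy_star h, hK.dy_dy_star h,
    hK.finsler.metric_eq_mul_add h, hK.eq_mul_ratio, factor]
  have h1 : L x y * (2 / ∑ i, y i * b x y i) = 2 * ratio L b x y := by
    rw [ratio]; ring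
  linear_combination ratio L b x y * (dy i L x y - ratio L b x y * b x y i) *
          (dy j L x y - ratio L b x y * b x y j) * h1

/-- One formula for two uses: horizontal directions give the connection of the change, vertical
directions normal to the hypersurface give its Cartan tensor. -/
theorem pd_metric_star (h : (x, y) ∈ D) {w : (Fin n → ℝ) × (Fin n → ℝ)}
    (h1 : PdConst D w x y (ratio L b)) (h2 : PdConst D w x y ρ) (i j : Fin n) :
    pd w (fun x y => metric L' x y i j) x y =
      factor L b ρ x y * pd w (fun x y => metric L x y i j) x y +
      (4 * ratio L b x y ^ 2 + ρ x y * ratio L b x y ^ 3) *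
        (pd w (dy i L) x y * dy j L x y + dy i L x y * pd w (dy j L) x y) +
      -4 * ratio L b x y ^ 3 * (pd w (dy i L) x y * b x y j +
        dy i L x y * pd w (fun x y => b x y j) x y +
        (pd w (dy j L) x y * b x y i + dy j L x y * pd w (fun x y => b x y i) x y)) +
      3 * ratio L b x y ^ 4 * (pd w (fun x y => b x y i) x y * b x y j +
        b x y i * pd w (fun x y => b x y j) x y) := by
  have hD := hK.isOpen
  have sL : ∀ i, SmoothIn D (dy i L) := fun i => hK.finsler.smoothIn.dy hD i
  have sb := hK.smooth_b
  have hpow : ∀ k, PdConst D w x y fun x y => ratio L b x y ^ k := by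
    intro k
    induction k with
    | zero => simpa using pdConst_const w 1
    | succ k ih => simpa only [pow_succ] using ih.mul h1 hD h
  have c1 : PdConst D w x y (factor L b ρ) := by
    have := (hpow 2).mul ((pdConst_const w 2).add
      ((pdConst_const w (-1)).mul (h2.mul h1 hD h) hD h) hD h) hD h
    have e : factor L b ρ = fun x y =>
        ratio L b x y ^ 2 * (2 + -1 * (ρ x y * ratio L b x y)) := by
      funext x y; rw [factor]; ring
    rwa [e]
  have c2 : PdConst D w x y fun x y => 4 * ratio L b x y ^ 2 + ρ x y * ratio L b x y ^ 3 :=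
    ((pdConst_const w 4).mul (hpow 2) hD h).add (h2.mul (hpow 3) hD h) hD h
  have c3 : PdConst D w x y fun x y => -4 * ratio L b x y ^ 3 :=
    (pdConst_const w (-4)).mul (hpow 3) hD h
  have c4 : PdConst D w x y fun x y => 3 * ratio L b x y ^ 4 :=
    (pdConst_const w 3).mul (hpow 4) hD h
  have sg := hK.finsler.smooth_metric i j
  have s2 := (sL i).mul (sL j)
  have s31 := (sL i).mul (sb j)
  have s32 := (sL j).mul (sb i)
  have s3 := s31.add s32
  have s4 := (sb i).mul (sb j)
  rw [pd_congr hD h w fun x y h => hK.metric_star h i j,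
    pd_add hD h w (((c1.1.mul sg).add (c2.1.mul s2)).add (c3.1.mul s3)) (c4.1.mul s4),
    pd_add hD h w ((c1.1.mul sg).add (c2.1.mul s2)) (c3.1.mul s3),
    pd_add hD h w (c1.1.mul sg) (c2.1.mul s2), c1.pd_mul sg hD h, c2.pd_mul s2 hD h,
    c3.pd_mul s3 hD h, c4.pd_mul s4 hD h, pd_add hD h w s31 s32,
    pd_mul hD h w (sL i) (sL j), pd_mul hD h w (sL i) (sb j), pd_mul hD h w (sL j) (sb i),
    pd_mul hD h w (sb i) (sb j)]

/-- The factors L and τ of *L are horizontally constant, hence so is *L². -/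
theorem spray_star (h : (x, y) ∈ D) (i : Fin n) : spray L' i x y = spray L i x y := by
  refine hK.finsler.spray_eq_of_delta_eq_zero hK.finsler' (fun x y h j => ?_) h i
  have h1 := (hK.pdConst_delta_self h j).mul (hK.pdConst_delta_ratio h j) hK.isOpen h
  have h2 := h1.mul h1 hK.isOpen h
  rw [hK.finsler.delta_eq_pd h hK.finsler'.smooth_sq]
  have e : sq L' = fun x y => L x y * ratio L b x y * (L x y * ratio L b x y) := by
    funext x y
    rw [sq, hK.eq_mul_ratio, pow_two]
  rw [e]
  exact h2.2

theorem nonlin_star (h : (x, y) ∈ D) (i j : Fin n) : nonlin L' i j x y = nonlin L i j x y :=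
  dy_congr hK.isOpen h j fun _ _ h => hK.spray_star h i

/-- The Kropina change by a parallel h-vector preserves the Cartan connection. -/
theorem hcoef_star (hn : 3 ≤ n) (h : (x, y) ∈ D) (i j k : Fin n) :
    hcoef L' i j k x y = hcoef L i j k x y := by
  have hD := hK.isOpen
  have hL := hK.finsler
  refine hK.finsler'.hcoef_unique h (fun i j k => hcoef L i j k x y)
    (fun i j k => hL.hcoef_symm h i j k) (fun i j k => ?_) i j k
  rw [hK.finsler'.delta_eq_pd h (hK.finsler'.smooth_metric i j)]
  simp only [hK.nonlin_star h]
  -- The tensors g, l and b are all parallel for F, while τ and ρ are horizontally constant. So F is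
  -- h-metrical for the changed metric, which is the hypothesis of uniqueness.
  rw [hK.pd_metric_star h (hK.pdConst_delta_ratio h k) (hK.pdConst_delta_rho hn h k)]
  rw [← hL.delta_eq_pd h (hL.smooth_metric i j), ← hL.delta_eq_pd h (hL.smoothIn.dy hD i),
    ← hL.delta_eq_pd h (hL.smoothIn.dy hD j), ← hL.delta_eq_pd h (hK.smooth_b i),
    ← hL.delta_eq_pd h (hK.smooth_b j), hL.delta_metric h, hL.delta_dy_self h,
    hL.delta_dy_self h, hK.delta_b h, hK.delta_b h]
  have e : ∀ i j, ∑ r, hcoef L r i k x y * metric L' x y r j =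
      factor L b ρ x y * ∑ r, hcoef L r i k x y * metric L x y r j +
      (4 * ratio L b x y ^ 2 + ρ x y * ratio L b x y ^ 3) *
        ((∑ r, hcoef L r i k x y * dy r L x y) * dy j L x y) +
      -4 * ratio L b x y ^ 3 * ((∑ r, hcoef L r i k x y * dy r L x y) * b x y j +
        dy j L x y * ∑ r, hcoef L r i k x y * b x y r) +
      3 * ratio L b x y ^ 4 * ((∑ r, hcoef L r i k x y * b x y r) * b x y j) := by
    intro i j
    simp only [Finset.mul_sum, Finset.sum_mul, ← Finset.sum_add_distrib]
    exact Finset.sum_congr rfl fun r _ => by rw [hK.metric_star h]; ring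
  rw [e, e]
  ring

theorem sum_metric_star (h : (x, y) ∈ D) {Z : Fin n → ℝ} (h1 : ∑ k, Z k * dy k L x y = 0)
    (h2 : ∑ k, Z k * b x y k = 0) (i : Fin n) :
    ∑ j, metric L' x y i j * Z j = factor L b ρ x y * ∑ j, metric L x y i j * Z j := by
  have e : ∑ j, metric L' x y i j * Z j = factor L b ρ x y * ∑ j, metric L x y i j * Z j +
      ((4 * ratio L b x y ^ 2 + ρ x y * ratio L b x y ^ 3) * dy i L x y +
        -4 * ratio L b x y ^ 3 * b x y i) * ∑ k, Z k * dy k L x y +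
      (-4 * ratio L b x y ^ 3 * dy i L x y + 3 * ratio L b x y ^ 4 * b x y i) *
        ∑ k, Z k * b x y k := by
    simp only [Finset.mul_sum, ← Finset.sum_add_distrib]
    exact Finset.sum_congr rfl fun r _ => by rw [hK.metric_star h]; ring
  rw [e, h1, h2]
  ring

/-- On such a Z the two positive definite metrics differ exactly by this factor. -/
theorem factor_pos (h : (x, y) ∈ D) {Z : Fin n → ℝ} (hZ : Z ≠ 0)
    (h1 : ∑ k, Z k * dy k L x y = 0) (h2 : ∑ k, Z k * b x y k = 0) :
    0 < factor L b ρ x y := by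
  have e : ∑ i, ∑ j, metric L' x y i j * Z i * Z j =
      factor L b ρ x y * ∑ i, ∑ j, metric L x y i j * Z i * Z j := by
    rw [Finset.mul_sum]
    refine Finset.sum_congr rfl fun i _ => ?_
    have := hK.sum_metric_star h h1 h2 i
    calc ∑ j, metric L' x y i j * Z i * Z j = Z i * ∑ j, metric L' x y i j * Z j := by
          rw [Finset.mul_sum]; exact Finset.sum_congr rfl fun j _ => by ring
      _ = _ := by
          rw [this]; simp only [Finset.mul_sum]
          exact Finset.sum_congr rfl fun j _ => by ring
  have h3 := hK.finsler'.sum_metric_pos h hZ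
  rw [e] at h3
  exact pos_of_mul_pos_left h3 (hK.finsler.sum_metric_pos h hZ).le

theorem pd_dy_self (h : (x, y) ∈ D) {Z : Fin n → ℝ} (h1 : ∑ k, Z k * dy k L x y = 0)
    (i : Fin n) : pd (0, Z) (dy i L) x y = (∑ k, metric L x y i k * Z k) / L x y := by
  have hL := hK.finsler
  rw [pd_eq_sum hK.isOpen h (hL.smoothIn.dy hK.isOpen i), eq_div_iff (hL.pos x y h).ne']
  have e : ∑ k, metric L x y i k * Z k = dy i L x y * ∑ k, Z k * dy k L x y +
      (∑ k, Z k * dy k (dy i L) x y) * L x y := by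
    rw [Finset.mul_sum, Finset.sum_mul, ← Finset.sum_add_distrib]
    refine Finset.sum_congr rfl fun k _ => ?_
    rw [hL.metric_symm h, hL.metric_eq_mul_add h]
    ring
  rw [e, h1]
  simp

theorem pd_b (h : (x, y) ∈ D) {Z : Fin n → ℝ} (h1 : ∑ k, Z k * dy k L x y = 0)
    (i : Fin n) : pd (0, Z) (fun x y => b x y i) x y =
      ρ x y * ((∑ k, metric L x y i k * Z k) / L x y) := by
  rw [← hK.pd_dy_self h h1, pd_eq_sum hK.isOpen h (hK.smooth_b i),
    pd_eq_sum hK.isOpen h (hK.finsler.smoothIn.dy hK.isOpen i)]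
  simp only [hK.dy_b h, Pi.zero_apply, zero_mul, Finset.sum_const_zero, zero_add, Finset.mul_sum]
  exact Finset.sum_congr rfl fun k _ => by
    rw [dy_dy_comm hK.isOpen h hK.finsler.smoothIn]; ring

/-- The Cartan tensor of the Kropina change, up to multiples of `g_{ij} Z^j`. -/
theorem cartan_star (hn : 3 ≤ n) (h : (x, y) ∈ D) {Z : Fin n → ℝ}
    (h1 : ∑ k, Z k * dy k L x y = 0) (h2 : ∑ k, Z k * b x y k = 0) :
    ∃ a : Fin n → ℝ, ∀ i j, ∑ k, cartan L' i j k x y * Z k =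
      factor L b ρ x y * ∑ k, cartan L i j k x y * Z k +
        a i * (∑ k, metric L x y j k * Z k) + a j * (∑ k, metric L x y i k * Z k) := by
  -- Along Z the derivatives of l_i and b_i are (g Z)_i/L and ρ (g Z)_i/L. The witness is half the
  -- coefficient of (g Z)_j in the product rule for *g_{ij}.
  refine ⟨fun i => 1 / 2 * ((4 * ratio L b x y ^ 2 + ρ x y * ratio L b x y ^ 3) * dy i L x y +
      -4 * ratio L b x y ^ 3 * (ρ x y * dy i L x y + b x y i) +
      3 * ratio L b x y ^ 4 * (ρ x y * b x y i)) / L x y, fun i j => ?_⟩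
  rw [hK.finsler'.sum_cartan_eq_pd h, hK.finsler.sum_cartan_eq_pd h,
    hK.pd_metric_star h (hK.pdConst_dy_ratio h h1 h2) (hK.pdConst_dy_rho hn h Z),
    hK.pd_dy_self h h1, hK.pd_dy_self h h1, hK.pd_b h h1, hK.pd_b h h1]
  ring

end IsParallelKropina

end Kropina

/-! ### Hypersurfaces tangent to a parallel h-vector, in coordinates -/

section Forms

variable {n m : ℕ} {D : Set ((Fin n → ℝ) × (Fin n → ℝ))}
  {L : (Fin n → ℝ) → (Fin n → ℝ) → ℝ} {x y : Fin n → ℝ} {X : (Fin m → ℝ) → Fin n → ℝ}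
  {u v : Fin m → ℝ} {N : Fin n → ℝ}

/-- The bilinear form `g_{ij} Vⁱ Wʲ`. -/
noncomputable def form (g : Matrix (Fin n) (Fin n) ℝ) :
    (Fin n → ℝ) →ₗ[ℝ] (Fin n → ℝ) →ₗ[ℝ] ℝ := Matrix.toLinearMap₂' ℝ g

theorem form_apply (g : Matrix (Fin n) (Fin n) ℝ) (V W : Fin n → ℝ) :
    form g V W = ∑ i, ∑ j, g i j * V i * W j := by
  rw [form, Matrix.toLinearMap₂'_apply]
  refine Finset.sum_congr rfl fun i _ => Finset.sum_congr rfl fun j _ => ?_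
  simp only [smul_eq_mul]
  ring

theorem form_eq_sum_left (g : Matrix (Fin n) (Fin n) ℝ) (V W : Fin n → ℝ) :
    form g V W = ∑ i, V i * ∑ j, g i j * W j := by
  rw [form_apply]
  refine Finset.sum_congr rfl fun i _ => ?_
  rw [Finset.mul_sum]
  exact Finset.sum_congr rfl fun j _ => by ring

theorem form_sum_left (g : Matrix (Fin n) (Fin n) ℝ) {ι : Type*} [Fintype ι] (c : ι → ℝ)
    (e : ι → Fin n → ℝ) (W : Fin n → ℝ) :
    form g (∑ α, c α • e α) W = ∑ α, c α * form g (e α) W := by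
  simp only [map_sum, map_smul, LinearMap.sum_apply, LinearMap.smul_apply, smul_eq_mul]

theorem form_comm {g : Matrix (Fin n) (Fin n) ℝ} (hg : ∀ i j, g i j = g j i) (V W : Fin n → ℝ) :
    form g V W = form g W V := by
  rw [form_apply, form_apply, Finset.sum_comm]
  exact Finset.sum_congr rfl fun i _ => Finset.sum_congr rfl fun j _ => by rw [hg]; ring

/-- The contracted Cartan tensor `C_{ijk} Zᵏ`. -/
noncomputable def cartanMat (L : (Fin n → ℝ) → (Fin n → ℝ) → ℝ) (x y Z : Fin n → ℝ) :
    Matrix (Fin n) (Fin n) ℝ :=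
  Matrix.of fun i j => ∑ k, cartan L i j k x y * Z k

theorem form_cartanMat (V W Z : Fin n → ℝ) : form (cartanMat L x y Z) V W =
    ∑ i, ∑ j, ∑ k, cartan L i j k x y * V i * W j * Z k := by
  rw [form_apply]
  refine Finset.sum_congr rfl fun i _ => Finset.sum_congr rfl fun j _ => ?_
  rw [cartanMat, Matrix.of_apply, mul_assoc, Finset.sum_mul]
  exact Finset.sum_congr rfl fun k _ => by ring

theorem IsLocalFinsler.form_metric_comm (hL : IsLocalFinsler D L) (h : (x, y) ∈ D)
    (V W : Fin n → ℝ) : form (metric L x y) V W = form (metric L x y) W V :=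
  form_comm (hL.metric_symm h) V W

theorem IsLocalFinsler.form_metric_pos (hL : IsLocalFinsler D L) (h : (x, y) ∈ D)
    {V : Fin n → ℝ} (hV : V ≠ 0) : 0 < form (metric L x y) V V := by
  rw [form_apply]
  exact hL.sum_metric_pos h hV

theorem IsLocalFinsler.form_cartanMat_comm (hL : IsLocalFinsler D L) (h : (x, y) ∈ D)
    (Z V W : Fin n → ℝ) : form (cartanMat L x y Z) V W = form (cartanMat L x y Z) W V :=
  form_comm (fun i j => by
    simp only [cartanMat, Matrix.of_apply]
    exact Finset.sum_congr rfl fun k _ => by rw [hL.cartan_symm_left h]) V W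

theorem IsLocalFinsler.form_cartanMat_swap (hL : IsLocalFinsler D L) (h : (x, y) ∈ D)
    (Z V W : Fin n → ℝ) : form (cartanMat L x y Z) V W = form (cartanMat L x y W) V Z := by
  rw [form_cartanMat, form_cartanMat]
  refine Finset.sum_congr rfl fun i _ => ?_
  rw [Finset.sum_comm]
  refine Finset.sum_congr rfl fun j _ => Finset.sum_congr rfl fun k _ => ?_
  rw [hL.cartan_symm_right h]
  ring

theorem IsLocalFinsler.form_cartanMat_y (hL : IsLocalFinsler D L) (h : (x, y) ∈ D)
    (Z V : Fin n → ℝ) : form (cartanMat L x y Z) V y = 0 := by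
  rw [hL.form_cartanMat_swap h, form_apply]
  simp [cartanMat, hL.sum_cartan_mul_y h]

theorem IsLocalFinsler.form_metric_y (hL : IsLocalFinsler D L) (h : (x, y) ∈ D)
    (Z : Fin n → ℝ) : form (metric L x y) Z y = L x y * ∑ k, Z k * dy k L x y := by
  rw [form_eq_sum_left, Finset.mul_sum]
  exact Finset.sum_congr rfl fun i _ => by rw [hL.metric_mul_y' h]; ring

/-- The tangent vector with components `B^i_α`. -/
noncomputable def frame (X : (Fin m → ℝ) → Fin n → ℝ) (u : Fin m → ℝ) (α : Fin m) : Fin n → ℝ :=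
  fun i => proj X α i u

theorem supp_eq_sum : supp X u v = ∑ α, v α • frame X u α := by
  funext i
  simp [supp, frame, Finset.sum_apply, mul_comm]

theorem isUnitNormal_iff : IsUnitNormal L X u v N ↔
    (∀ α, form (metric L (X u) (supp X u v)) (frame X u α) N = 0) ∧
      form (metric L (X u) (supp X u v)) N N = 1 := by
  simp only [form_apply]
  rfl

theorem indMetric_eq (α β : Fin m) : indMetric L X u v α β =
    form (metric L (X u) (supp X u v)) (frame X u α) (frame X u β) := by
  rw [form_apply]
  rfl

theorem sum_lower_mul (V : Fin n → ℝ) : ∑ i, lower L X u v N i * V i =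
    form (metric L (X u) (supp X u v)) V N := by
  rw [form_eq_sum_left]
  exact Finset.sum_congr rfl fun i _ => by rw [lower, mul_comm]

theorem Hvec_eq (α : Fin m) : Hvec L X u v N α =
    form (metric L (X u) (supp X u v)) (accNonlin L X u v α) N := sum_lower_mul _

theorem Mtens_eq (α β : Fin m) : Mtens L X u v N α β =
    form (cartanMat L (X u) (supp X u v) N) (frame X u α) (frame X u β) := by
  rw [form_cartanMat]
  rfl

theorem Mvec_eq (α : Fin m) : Mvec L X u v N α =
    form (cartanMat L (X u) (supp X u v) N) (frame X u α) N := by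
  rw [form_cartanMat]
  rfl

theorem Htens_eq (α β : Fin m) : Htens L X u v N α β =
    form (metric L (X u) (supp X u v)) (accHcoef L X u v α β) N +
      Mvec L X u v N α * Hvec L X u v N β := by
  rw [Htens, sum_lower_mul]

theorem sum_invProj_mul (α : Fin m) (V : Fin n → ℝ) : ∑ i, invProj L X u v α i * V i =
    ∑ β, (indMetric L X u v)⁻¹ α β *
      form (metric L (X u) (supp X u v)) V (frame X u β) := by
  simp only [invProj, Finset.sum_mul, form_eq_sum_left, Finset.mul_sum]
  rw [Finset.sum_comm]
  refine Finset.sum_congr rfl fun β _ => Finset.sum_congr rfl fun i _ =>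
    Finset.sum_congr rfl fun j _ => ?_
  rw [frame]
  ring

namespace IsLocalFinsler

variable (hL : IsLocalFinsler D L) (h : (X u, supp X u v) ∈ D)
  (hB : LinearIndependent ℝ (frame X u))
include hL h hB

theorem det_indMetric_ne_zero : (indMetric L X u v).det ≠ 0 := by
  intro h0
  obtain ⟨c, hc, h1⟩ := Matrix.exists_mulVec_eq_zero_iff.2 h0
  have h2 : ∀ α, form (metric L (X u) (supp X u v)) (frame X u α) (∑ β, c β • frame X u β) = 0 := by
    intro α
    have := congrFun h1 α
    simp only [Matrix.mulVec, dotProduct, indMetric_eq, Pi.zero_apply] at this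
    simp only [map_sum, map_smul, smul_eq_mul]
    rw [← this]
    exact Finset.sum_congr rfl fun β _ => mul_comm _ _
  have h3 : form (metric L (X u) (supp X u v)) (∑ β, c β • frame X u β)
      (∑ β, c β • frame X u β) = 0 := by
    rw [form_sum_left]
    exact Finset.sum_eq_zero fun α _ => by rw [h2, mul_zero]
  have h4 : ∑ β, c β • frame X u β = 0 := by
    by_contra h4
    exact (hL.form_metric_pos h h4).ne' h3
  exact hc (funext fun β => Fintype.linearIndependent_iff.1 hB c h4 β)

theorem sum_indMetric_inv_mul (c : Fin m → ℝ) (α : Fin m) :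
    ∑ β, (indMetric L X u v)⁻¹ α β * ∑ γ, indMetric L X u v β γ * c γ = c α := by
  have h1 := Matrix.nonsing_inv_mul (indMetric L X u v)
    (Ne.isUnit (hL.det_indMetric_ne_zero h hB))
  have h2 : (indMetric L X u v)⁻¹.mulVec ((indMetric L X u v).mulVec c) = c := by
    rw [Matrix.mulVec_mulVec, h1, Matrix.one_mulVec]
  exact congrFun h2 α

theorem sum_indMetric_mul_inv (c : Fin m → ℝ) (α : Fin m) :
    ∑ β, indMetric L X u v α β * ∑ γ, (indMetric L X u v)⁻¹ β γ * c γ = c α := by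
  have h1 := Matrix.mul_nonsing_inv (indMetric L X u v)
    (Ne.isUnit (hL.det_indMetric_ne_zero h hB))
  have h2 : (indMetric L X u v).mulVec ((indMetric L X u v)⁻¹.mulVec c) = c := by
    rw [Matrix.mulVec_mulVec, h1, Matrix.one_mulVec]
  exact congrFun h2 α

omit hB in
theorem form_frame_eq_zero_y {Z : Fin n → ℝ}
    (hZ : ∀ α, form (metric L (X u) (supp X u v)) (frame X u α) Z = 0) :
    ∑ k, Z k * dy k L (X u) (supp X u v) = 0 := by
  have h1 := hL.form_metric_y h Z
  rw [hL.form_metric_comm h] at h1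
  have h2 : form (metric L (X u) (supp X u v)) (supp X u v) Z = 0 := by
    nth_rw 2 [supp_eq_sum]
    rw [form_sum_left]
    exact Finset.sum_eq_zero fun α _ => by rw [hZ, mul_zero]
  rw [h2] at h1
  exact (mul_eq_zero.1 h1.symm).resolve_left (hL.pos _ _ h).ne'

/-- The projection of a vector onto the hypersurface along the normal. -/
theorem sum_invProj_of_decomp (c : Fin m → ℝ) {Z : Fin n → ℝ}
    (hZ : ∀ α, form (metric L (X u) (supp X u v)) (frame X u α) Z = 0) (α : Fin m) :
    ∑ i, invProj L X u v α i * (∑ β, c β • frame X u β + Z) i = c α := by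
  rw [sum_invProj_mul, ← hL.sum_indMetric_inv_mul h hB c α]
  refine Finset.sum_congr rfl fun β _ => ?_
  rw [hL.form_metric_comm h, map_add, hZ, add_zero, map_sum]
  congr 1
  exact Finset.sum_congr rfl fun γ _ => by rw [map_smul, indMetric_eq, smul_eq_mul, mul_comm]

end IsLocalFinsler

end Forms

/-! ### Comparison of the two hypersurfaces at a single line element -/

section Hypersurface

variable {m : ℕ} {D : Set ((Fin (m + 1) → ℝ) × (Fin (m + 1) → ℝ))}
  {L L' ρ : (Fin (m + 1) → ℝ) → (Fin (m + 1) → ℝ) → ℝ}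
  {b : (Fin (m + 1) → ℝ) → (Fin (m + 1) → ℝ) → Fin (m + 1) → ℝ}
  {X : (Fin m → ℝ) → Fin (m + 1) → ℝ} {u v : Fin m → ℝ} {N : Fin (m + 1) → ℝ}

theorem IsUnitNormal.exists_decomp (hN : IsUnitNormal L X u v N)
    (hB : LinearIndependent ℝ (frame X u))
    (V : Fin (m + 1) → ℝ) : ∃ (c : Fin m → ℝ) (r : ℝ), V = ∑ α, c α • frame X u α + r • N := by
  obtain ⟨h1, h2⟩ := isUnitNormal_iff.1 hN
  have h3 : N ∉ Submodule.span ℝ (Set.range (frame X u)) := by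
    intro h3
    obtain ⟨c, hc⟩ := (Submodule.mem_span_range_iff_exists_fun ℝ).1 h3
    have : form (metric L (X u) (supp X u v)) N N = 0 := by
      nth_rw 1 [← hc]
      rw [form_sum_left]
      exact Finset.sum_eq_zero fun α _ => by rw [h1, mul_zero]
    rw [h2] at this
    exact one_ne_zero this
  have h4 : LinearIndependent ℝ (Fin.cons N (frame X u) : Fin (m + 1) → Fin (m + 1) → ℝ) :=
    linearIndependent_finCons.2 ⟨hB, h3⟩
  have h5 := h4.span_eq_top_of_card_eq_finrank (by simp)
  have h6 : V ∈ Submodule.span ℝ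
      (Set.range (Fin.cons N (frame X u) : Fin (m + 1) → Fin (m + 1) → ℝ)) := by
    rw [h5]; trivial
  obtain ⟨c, hc⟩ := (Submodule.mem_span_range_iff_exists_fun ℝ).1 h6
  rw [Fin.sum_univ_succ] at hc
  exact ⟨fun α => c α.succ, c 0, hc.symm.trans (add_comm _ _)⟩

namespace IsLocalFinsler

/-- Orthogonality to the m tangent vectors is a system of m linear equations in m + 1 unknowns; a
nonzero solution is normalized. -/
theorem exists_unitNormal (hL : IsLocalFinsler D L) (h : (X u, supp X u v) ∈ D) :
    ∃ N, IsUnitNormal L X u v N := by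
  let φ : (Fin (m + 1) → ℝ) →ₗ[ℝ] (Fin m → ℝ) :=
    LinearMap.pi fun α => form (metric L (X u) (supp X u v)) (frame X u α)
  have h1 : LinearMap.ker φ ≠ ⊥ := LinearMap.ker_ne_bot_of_finrank_lt (by simp)
  obtain ⟨Z, hZ, hZ0⟩ := (Submodule.ne_bot_iff _).1 h1
  have h2 : φ Z = 0 := hZ
  have h3 : ∀ α, form (metric L (X u) (supp X u v)) (frame X u α) Z = 0 :=
    fun α => congrFun h2 α
  have h4 := hL.form_metric_pos h hZ0
  have h5 := Real.mul_self_sqrt h4.le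
  have h6 := (Real.sqrt_pos.2 h4).ne'
  refine ⟨(√(form (metric L (X u) (supp X u v)) Z Z))⁻¹ • Z, isUnitNormal_iff.2 ⟨fun α => ?_, ?_⟩⟩
  · rw [map_smul, h3, smul_zero]
  · simp only [map_smul, LinearMap.smul_apply, smul_eq_mul]
    field_simp
    nlinarith

theorem eq_zero_of_form_eq_zero (hL : IsLocalFinsler D L) (h : (X u, supp X u v) ∈ D)
    (hB : LinearIndependent ℝ (frame X u)) (hN : IsUnitNormal L X u v N)
    {V : Fin (m + 1) → ℝ}
    (h1 : ∀ α, form (metric L (X u) (supp X u v)) (frame X u α) V = 0)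
    (h2 : form (metric L (X u) (supp X u v)) N V = 0) : V = 0 := by
  by_contra hV
  refine (hL.form_metric_pos h hV).ne' ?_
  obtain ⟨c, r, hc⟩ := hN.exists_decomp hB V
  nth_rw 1 [hc]
  simp only [map_add, map_sum, map_smul, LinearMap.add_apply, LinearMap.sum_apply,
    LinearMap.smul_apply, h1, h2]
  simp

end IsLocalFinsler

/-- The h-vector `b` is tangent to the hypersurface at the line element `(u, v)`. -/
structure IsTangentAt (D : Set ((Fin (m + 1) → ℝ) × (Fin (m + 1) → ℝ)))
    (L : (Fin (m + 1) → ℝ) → (Fin (m + 1) → ℝ) → ℝ)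
    (b : (Fin (m + 1) → ℝ) → (Fin (m + 1) → ℝ) → Fin (m + 1) → ℝ)
    (X : (Fin m → ℝ) → Fin (m + 1) → ℝ) (u v : Fin m → ℝ) : Prop where
  mem : (X u, supp X u v) ∈ D
  indep : LinearIndependent ℝ (frame X u)
  tangent : ∀ N, IsUnitNormal L X u v N → ∑ i, b (X u) (supp X u v) i * N i = 0

namespace IsParallelKropina

variable (hK : IsParallelKropina D L b ρ L') (hT : IsTangentAt D L b X u v)
include hK hT

theorem sum_mul_b_eq_zero {Z : Fin (m + 1) → ℝ}
    (hZ : ∀ α, form (metric L (X u) (supp X u v)) (frame X u α) Z = 0) :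
    ∑ k, Z k * b (X u) (supp X u v) k = 0 := by
  by_cases h0 : Z = 0
  · simp [h0]
  have h4 := hK.finsler.form_metric_pos hT.mem h0
  have h5 := Real.mul_self_sqrt h4.le
  have h6 := (Real.sqrt_pos.2 h4).ne'
  have h7 := hT.tangent ((√(form (metric L (X u) (supp X u v)) Z Z))⁻¹ • Z)
    (isUnitNormal_iff.2 ⟨fun α => by rw [map_smul, hZ, smul_zero], by
      simp only [map_smul, LinearMap.smul_apply, smul_eq_mul]
      field_simp
      nlinarith⟩)
  have e : ∑ k, Z k * b (X u) (supp X u v) k = √(form (metric L (X u) (supp X u v)) Z Z) *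
      ∑ i, b (X u) (supp X u v) i * ((√(form (metric L (X u) (supp X u v)) Z Z))⁻¹ • Z) i := by
    rw [Finset.mul_sum]
    refine Finset.sum_congr rfl fun i _ => ?_
    simp only [Pi.smul_apply, smul_eq_mul]
    field_simp
  rw [e, h7, mul_zero]

/-- The vector dual to b has no normal component, since its product with N is b_i Nⁱ = 0; so it is a
combination of the B_α. The second clause is the h-vector condition with total symmetry of the
Cartan tensor, the bracket being the angular metric. -/
theorem exists_sharp : ∃ c : Fin m → ℝ,
    (∀ V, form (metric L (X u) (supp X u v)) V (∑ α, c α • frame X u α) =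
      ∑ k, V k * b (X u) (supp X u v) k) ∧
    ∀ V W, L (X u) (supp X u v) * form (cartanMat L (X u) (supp X u v) W)
      (∑ α, c α • frame X u α) V = ρ (X u) (supp X u v) *
        (form (metric L (X u) (supp X u v)) V W -
          (∑ k, V k * dy k L (X u) (supp X u v)) * ∑ k, W k * dy k L (X u) (supp X u v)) := by
  have hL := hK.finsler
  have h := hT.mem
  obtain ⟨N, hN⟩ := hL.exists_unitNormal h
  set g := metric L (X u) (supp X u v) with hg
  set B : Fin (m + 1) → ℝ := fun r => ∑ k, g⁻¹ r k * b (X u) (supp X u v) k with hBdef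
  have h1 : ∀ V, form g V B = ∑ k, V k * b (X u) (supp X u v) k := fun V => by
    rw [form_eq_sum_left]
    exact Finset.sum_congr rfl fun k _ => by rw [hBdef, hL.sum_metric_mul_inv h]
  obtain ⟨c, r, hc⟩ := hN.exists_decomp hT.indep B
  have h2 : r = 0 := by
    obtain ⟨h3, h4⟩ := isUnitNormal_iff.1 hN
    have h5 := h1 N
    rw [hK.sum_mul_b_eq_zero hT h3, hc] at h5
    rw [map_add, map_smul, hL.form_metric_comm h N, form_sum_left, h4] at h5
    simpa [h3] using h5
  rw [h2, zero_smul, add_zero] at hc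
  refine ⟨c, fun V => by rw [← hc, h1], fun V W => ?_⟩
  rw [← hc]
  have hsymm : ∀ i j, g⁻¹ i j = g⁻¹ j i := by
    have h6 : g.transpose = g := by
      ext i j
      exact hL.metric_symm h j i
    have h7 := Matrix.transpose_nonsing_inv g
    rw [h6] at h7
    intro i j
    exact congrFun (congrFun h7 j) i
  have h8 : ∀ i j, L (X u) (supp X u v) * ∑ r, cartan L r i j (X u) (supp X u v) * B r =
      ρ (X u) (supp X u v) * angular L i j (X u) (supp X u v) := fun i j => by
    rw [← hK.h_vector _ _ h]
    congr 1
    simp only [cartanUp, hBdef, Finset.mul_sum, Finset.sum_mul]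
    rw [Finset.sum_comm]
    refine Finset.sum_congr rfl fun r _ => Finset.sum_congr rfl fun k _ => ?_
    rw [hsymm]
    ring
  have h9 : L (X u) (supp X u v) * form (cartanMat L (X u) (supp X u v) W) B V =
      ∑ i, ∑ j, V i * W j *
        (L (X u) (supp X u v) * ∑ r, cartan L r i j (X u) (supp X u v) * B r) := by
    rw [form_cartanMat]
    simp only [Finset.mul_sum]
    rw [Finset.sum_comm]
    refine Finset.sum_congr rfl fun i _ => ?_
    rw [Finset.sum_comm]
    exact Finset.sum_congr rfl fun j _ => Finset.sum_congr rfl fun k _ => by ring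
  rw [h9, form_apply, Finset.sum_mul_sum, ← Finset.sum_sub_distrib, Finset.mul_sum]
  refine Finset.sum_congr rfl fun i _ => ?_
  rw [← Finset.sum_sub_distrib, Finset.mul_sum]
  refine Finset.sum_congr rfl fun j _ => ?_
  rw [h8, hL.angular_eq h]
  ring

/-- Tangency of the h-vector is possible only if the dimension is at least three. -/
theorem three_le (hm : 1 ≤ m) : 3 ≤ m + 1 := by
  by_contra hc
  obtain rfl : m = 1 := by omega
  have hL := hK.finsler
  obtain ⟨N, hN⟩ := hL.exists_unitNormal hT.mem
  obtain ⟨h1, h2⟩ := isUnitNormal_iff.1 hN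
  obtain ⟨c, -, h3⟩ := hK.exists_sharp hT
  have h4 := h3 N N
  rw [h2, hL.form_frame_eq_zero_y hT.mem h1] at h4
  -- For m = 1 the tangent line is spanned by the supporting element, so the dual of b is a multiple
  -- of y and is annihilated by the Cartan tensor. The h-vector condition on (N, N) then reads 0 =
  -- ρ.
  have h5 := hL.form_cartanMat_y hT.mem N N
  rw [hL.form_cartanMat_comm hT.mem] at h5
  nth_rw 2 [supp_eq_sum] at h5
  have hv : v 0 ≠ 0 := by
    intro h0
    refine hL.ne_zero _ _ hT.mem ?_
    rw [supp_eq_sum]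
    simp [h0]
  simp only [Finset.univ_unique, Fin.default_eq_zero, Finset.sum_singleton, map_smul,
    LinearMap.smul_apply, smul_eq_mul, mul_eq_zero] at h4 h5
  rw [h5.resolve_left hv] at h4
  exact hK.ne_zero _ _ hT.mem (by linarith)

theorem factor_pos_of_isTangentAt : 0 < factor L b ρ (X u) (supp X u v) := by
  obtain ⟨N, hN⟩ := hK.finsler.exists_unitNormal hT.mem
  obtain ⟨h1, h2⟩ := isUnitNormal_iff.1 hN
  refine hK.factor_pos hT.mem (Z := N) ?_ (hK.finsler.form_frame_eq_zero_y hT.mem h1)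
    (hK.sum_mul_b_eq_zero hT h1)
  rintro rfl
  simp at h2

theorem form_metric_star {Z : Fin (m + 1) → ℝ}
    (hZ : ∀ α, form (metric L (X u) (supp X u v)) (frame X u α) Z = 0) (V : Fin (m + 1) → ℝ) :
    form (metric L' (X u) (supp X u v)) V Z =
      factor L b ρ (X u) (supp X u v) * form (metric L (X u) (supp X u v)) V Z := by
  rw [form_eq_sum_left, form_eq_sum_left, Finset.mul_sum]
  refine Finset.sum_congr rfl fun i _ => ?_
  rw [hK.sum_metric_star hT.mem (hK.finsler.form_frame_eq_zero_y hT.mem hZ)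
    (hK.sum_mul_b_eq_zero hT hZ)]
  ring

/-- Both metrics have the same normal directions. -/
theorem form_frame_eq_zero_iff {Z : Fin (m + 1) → ℝ} :
    (∀ α, form (metric L' (X u) (supp X u v)) (frame X u α) Z = 0) ↔
      ∀ α, form (metric L (X u) (supp X u v)) (frame X u α) Z = 0 := by
  refine ⟨fun hZ => ?_, fun hZ α => by rw [hK.form_metric_star hT hZ, hZ, mul_zero]⟩
  obtain ⟨N, hN⟩ := hK.finsler.exists_unitNormal hT.mem
  obtain ⟨h1, h2⟩ := isUnitNormal_iff.1 hN
  -- The normal component of Z is already orthogonal for both metrics. The tangential one is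
  -- therefore orthogonal to the whole tangent space in the changed metric, hence zero by
  -- definiteness.
  obtain ⟨c, r, hc⟩ := hN.exists_decomp hT.indep Z
  have h3 : ∀ α, form (metric L' (X u) (supp X u v)) (frame X u α)
      (∑ β, c β • frame X u β) = 0 := fun α => by
    have := hZ α
    rw [hc, map_add, map_smul, hK.form_metric_star hT h1, h1] at this
    simpa using this
  have h4 : ∑ β, c β • frame X u β = 0 := by
    by_contra h4
    refine (hK.finsler'.form_metric_pos hT.mem h4).ne' ?_
    rw [form_sum_left]
    exact Finset.sum_eq_zero fun α _ => by rw [h3, mul_zero]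
  intro α
  rw [hc, h4, zero_add, map_smul, h1, smul_zero]

/-- The unit normals of the two hypersurfaces correspond to each other. -/
theorem isUnitNormal_star_iff :
    IsUnitNormal L' X u v ((√(factor L b ρ (X u) (supp X u v)))⁻¹ • N) ↔
      IsUnitNormal L X u v N := by
  have h1 := hK.factor_pos_of_isTangentAt hT
  have h2 := Real.mul_self_sqrt h1.le
  have h3 := (Real.sqrt_pos.2 h1).ne'
  rw [isUnitNormal_iff, isUnitNormal_iff, hK.form_frame_eq_zero_iff hT]
  simp only [map_smul, smul_eq_zero, inv_eq_zero, h3, false_or]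
  refine and_congr_right fun h4 => ?_
  rw [LinearMap.smul_apply, hK.form_metric_star hT h4, smul_eq_mul, smul_eq_mul]
  nth_rw 3 [← h2]
  field_simp

theorem accNonlin_star (α : Fin m) : accNonlin L' X u v α = accNonlin L X u v α := by
  funext i
  simp only [accNonlin, hK.nonlin_star hT.mem]

theorem accHcoef_star (hm : 1 ≤ m) (α β : Fin m) :
    accHcoef L' X u v α β = accHcoef L X u v α β := by
  funext i
  simp only [accHcoef, hK.hcoef_star (hK.three_le hT hm) hT.mem]

theorem form_metric_star_smul (hN : IsUnitNormal L X u v N) (V : Fin (m + 1) → ℝ) :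
    form (metric L' (X u) (supp X u v)) V ((√(factor L b ρ (X u) (supp X u v)))⁻¹ • N) =
      √(factor L b ρ (X u) (supp X u v)) * form (metric L (X u) (supp X u v)) V N := by
  have h1 := hK.factor_pos_of_isTangentAt hT
  have h2 := Real.mul_self_sqrt h1.le
  have h3 := (Real.sqrt_pos.2 h1).ne'
  rw [map_smul, hK.form_metric_star hT (isUnitNormal_iff.1 hN).1, smul_eq_mul]
  nth_rw 2 [← h2]
  field_simp

/-- The extra terms of `cartan_star` each contain the product of V or W with N. For tangent V and W
only f C survives, and normalizing N turns f into √f. -/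
theorem form_cartanMat_star_smul (hm : 1 ≤ m) (hN : IsUnitNormal L X u v N)
    {V W : Fin (m + 1) → ℝ} (hV : form (metric L (X u) (supp X u v)) V N = 0)
    (hW : form (metric L (X u) (supp X u v)) W N = 0) :
    form (cartanMat L' (X u) (supp X u v) ((√(factor L b ρ (X u) (supp X u v)))⁻¹ • N)) V W =
      √(factor L b ρ (X u) (supp X u v)) * form (cartanMat L (X u) (supp X u v) N) V W := by
  have h1 := hK.factor_pos_of_isTangentAt hT
  have h2 := Real.mul_self_sqrt h1.le
  have h3 := (Real.sqrt_pos.2 h1).ne'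
  have hN1 := (isUnitNormal_iff.1 hN).1
  obtain ⟨a, ha⟩ := hK.cartan_star (hK.three_le hT hm) hT.mem
    (hK.finsler.form_frame_eq_zero_y hT.mem hN1) (hK.sum_mul_b_eq_zero hT hN1)
  have h4 : form (cartanMat L' (X u) (supp X u v) N) V W =
      factor L b ρ (X u) (supp X u v) * form (cartanMat L (X u) (supp X u v) N) V W := by
    have e : form (cartanMat L' (X u) (supp X u v) N) V W =
        factor L b ρ (X u) (supp X u v) * form (cartanMat L (X u) (supp X u v) N) V W +
        (∑ i, V i * a i) * form (metric L (X u) (supp X u v)) W N +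
        form (metric L (X u) (supp X u v)) V N * ∑ j, W j * a j := by
      simp only [form_eq_sum_left]
      rw [Finset.sum_mul_sum, Finset.sum_mul_sum, Finset.mul_sum, ← Finset.sum_add_distrib,
        ← Finset.sum_add_distrib]
      refine Finset.sum_congr rfl fun i _ => ?_
      rw [Finset.mul_sum, Finset.mul_sum, Finset.mul_sum, ← Finset.sum_add_distrib,
        ← Finset.sum_add_distrib]
      refine Finset.sum_congr rfl fun j _ => ?_
      simp only [cartanMat, Matrix.of_apply]
      rw [ha]
      ring
    rw [e, hV, hW]
    ring
  rw [hK.finsler'.form_cartanMat_swap hT.mem, map_smul, ← hK.finsler'.form_cartanMat_swap hT.mem,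
    h4, smul_eq_mul]
  nth_rw 2 [← h2]
  field_simp

theorem Hvec_star (hN : IsUnitNormal L X u v N) (α : Fin m) :
    Hvec L' X u v ((√(factor L b ρ (X u) (supp X u v)))⁻¹ • N) α =
      √(factor L b ρ (X u) (supp X u v)) * Hvec L X u v N α := by
  rw [Hvec_eq, Hvec_eq, hK.form_metric_star_smul hT hN, hK.accNonlin_star hT]

theorem Mtens_star (hm : 1 ≤ m) (hN : IsUnitNormal L X u v N) (α β : Fin m) :
    Mtens L' X u v ((√(factor L b ρ (X u) (supp X u v)))⁻¹ • N) α β =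
      √(factor L b ρ (X u) (supp X u v)) * Mtens L X u v N α β := by
  have hN1 := (isUnitNormal_iff.1 hN).1
  rw [Mtens_eq, Mtens_eq, hK.form_cartanMat_star_smul hT hm hN (hN1 _) (hN1 _)]

/-- Both sides read off the tangential coordinates of V; the splitting into tangential and normal
parts is the same for the two metrics. -/
theorem sum_invProj_star (α : Fin m) (V : Fin (m + 1) → ℝ) :
    ∑ i, invProj L' X u v α i * V i = ∑ i, invProj L X u v α i * V i := by
  obtain ⟨N, hN⟩ := hK.finsler.exists_unitNormal hT.mem
  obtain ⟨c, r, hc⟩ := hN.exists_decomp hT.indep V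
  have h1 : ∀ α, form (metric L (X u) (supp X u v)) (frame X u α) (r • N) = 0 := fun α => by
    rw [map_smul, (isUnitNormal_iff.1 hN).1, smul_zero]
  rw [hc, hK.finsler.sum_invProj_of_decomp hT.mem hT.indep c h1,
    hK.finsler'.sum_invProj_of_decomp hT.mem hT.indep c
      ((hK.form_frame_eq_zero_iff hT).2 h1)]

theorem indNonlin_star (α β : Fin m) :
    indNonlin L' X u v α β = indNonlin L X u v α β := by
  rw [indNonlin, indNonlin, hK.accNonlin_star hT, hK.sum_invProj_star hT]

/-- The inverse induced metrics are not proportional in general. They become so on M_{δβ}: the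
tangent vector W dual to M_{·β} is orthogonal to y and to the dual of b, and on such vectors the
changed metric is f g. -/
theorem sum_indMetric_inv_star (hN : IsUnitNormal L X u v N) (α β : Fin m) :
    factor L b ρ (X u) (supp X u v) *
      ∑ δ, (indMetric L' X u v)⁻¹ α δ * Mtens L X u v N δ β =
        ∑ δ, (indMetric L X u v)⁻¹ α δ * Mtens L X u v N δ β := by
  have hL := hK.finsler
  have h := hT.mem
  set c : Fin m → ℝ := fun α => ∑ δ, (indMetric L X u v)⁻¹ α δ * Mtens L X u v N δ β with hc
  set W := ∑ α, c α • frame X u α with hW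
  have hN1 := (isUnitNormal_iff.1 hN).1
  have h1 : ∀ ε, form (metric L (X u) (supp X u v)) (frame X u ε) W = Mtens L X u v N ε β := by
    intro ε
    rw [← hL.sum_indMetric_mul_inv h hT.indep (fun δ => Mtens L X u v N δ β) ε, hW, map_sum]
    exact Finset.sum_congr rfl fun γ _ => by rw [map_smul, indMetric_eq, smul_eq_mul, mul_comm]
  have h2 : ∀ a : Fin m → ℝ, form (metric L (X u) (supp X u v)) (∑ ε, a ε • frame X u ε) W =
      form (cartanMat L (X u) (supp X u v) N) (∑ ε, a ε • frame X u ε) (frame X u β) := by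
    intro a
    simp only [map_sum, map_smul, LinearMap.sum_apply, LinearMap.smul_apply, h1, Mtens_eq]
  have h3 : ∑ k, W k * dy k L (X u) (supp X u v) = 0 := by
    have h4 := hL.form_metric_y h W
    rw [hL.form_metric_comm h] at h4
    nth_rw 2 [supp_eq_sum] at h4
    rw [h2, ← supp_eq_sum, hL.form_cartanMat_comm h, hL.form_cartanMat_y h] at h4
    exact (mul_eq_zero.1 h4.symm).resolve_left (hL.pos _ _ h).ne'
  -- The h-vector condition turns the Cartan tensor evaluated on the dual of b, B_β and N into a
  -- multiple of the angular metric on (B_β, N), which vanishes.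
  have h5 : ∑ k, W k * b (X u) (supp X u v) k = 0 := by
    obtain ⟨a, ha1, ha2⟩ := hK.exists_sharp hT
    rw [← ha1, hL.form_metric_comm h, h2]
    have h6 := ha2 (frame X u β) N
    rw [hN1, hL.form_frame_eq_zero_y h hN1, mul_zero, sub_zero, mul_zero] at h6
    exact (mul_eq_zero.1 h6).resolve_left (hL.pos _ _ h).ne'
  have h7 : ∀ ε, ∑ γ, indMetric L' X u v ε γ * c γ =
      factor L b ρ (X u) (supp X u v) * Mtens L X u v N ε β := by
    intro ε
    have h8 : ∑ γ, indMetric L' X u v ε γ * c γ =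
        form (metric L' (X u) (supp X u v)) (frame X u ε) W := by
      rw [hW, map_sum]
      exact Finset.sum_congr rfl fun γ _ => by rw [map_smul, indMetric_eq, smul_eq_mul, mul_comm]
    rw [h8, ← h1, form_eq_sum_left, form_eq_sum_left, Finset.mul_sum]
    refine Finset.sum_congr rfl fun i _ => ?_
    rw [hK.sum_metric_star h h3 h5]
    ring
  have h9 := hK.finsler'.sum_indMetric_inv_mul h hT.indep c α
  simp only [h7] at h9
  refine Eq.trans ?_ h9
  rw [Finset.mul_sum]
  exact Finset.sum_congr rfl fun δ _ => by ring

theorem indHcoef_star (hm : 1 ≤ m) (hN : IsUnitNormal L X u v N) (α β γ : Fin m) :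
    indHcoef L' X u v ((√(factor L b ρ (X u) (supp X u v)))⁻¹ • N) α β γ =
      indHcoef L X u v N α β γ := by
  have h2 := Real.mul_self_sqrt (hK.factor_pos_of_isTangentAt hT).le
  rw [indHcoef, indHcoef, hK.accHcoef_star hT hm, hK.sum_invProj_star hT, hK.Hvec_star hT hN,
    ← hK.sum_indMetric_inv_star hT hN]
  congr 1
  simp only [hK.Mtens_star hT hm hN]
  rw [Finset.mul_sum, Finset.sum_mul, Finset.sum_mul]
  refine Finset.sum_congr rfl fun δ _ => ?_
  linear_combination (indMetric L' X u v)⁻¹ α δ * Mtens L X u v N δ β * Hvec L X u v N γ * h2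

end IsParallelKropina

/-! ### Vanishing of the second fundamental tensors -/

namespace IsLocalFinsler

theorem sum_v_accHcoef (hL : IsLocalFinsler D L) (h : (X u, supp X u v) ∈ D) (β : Fin m) :
    ∑ α, v α • accHcoef L X u v α β = accNonlin L X u v β := by
  funext i
  simp only [Finset.sum_apply, Pi.smul_apply, smul_eq_mul, accHcoef, accNonlin, mul_add,
    Finset.sum_add_distrib]
  congr 1
  · exact Finset.sum_congr rfl fun α _ => mul_comm _ _
  · simp only [← hL.sum_y_hcoef h, supp, Finset.sum_mul, Finset.mul_sum]
    rw [Finset.sum_comm]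
    refine (Finset.sum_congr rfl fun j _ => Finset.sum_comm).trans (Finset.sum_comm.trans ?_)
    exact Finset.sum_congr rfl fun k _ => Finset.sum_congr rfl fun j _ =>
      Finset.sum_congr rfl fun α _ => by ring

theorem sum_v_Mvec (hL : IsLocalFinsler D L) (h : (X u, supp X u v) ∈ D) :
    ∑ α, v α * Mvec L X u v N α = 0 := by
  have h1 := hL.form_cartanMat_y h N N
  rw [hL.form_cartanMat_comm h] at h1
  nth_rw 2 [supp_eq_sum] at h1
  simpa only [map_sum, map_smul, LinearMap.sum_apply, LinearMap.smul_apply, ← Mvec_eq,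
    smul_eq_mul] using h1

/-- The second fundamental h-tensor vanishes if and only if its two normal parts do. -/
theorem Htens_eq_zero_iff (hL : IsLocalFinsler D L) (h : (X u, supp X u v) ∈ D) :
    (∀ α β, Htens L X u v N α β = 0) ↔ (∀ β, Hvec L X u v N β = 0) ∧
      ∀ α β, form (metric L (X u) (supp X u v)) (accHcoef L X u v α β) N = 0 := by
  refine ⟨fun h0 => ?_, fun h0 α β => by rw [Htens_eq, h0.1, h0.2, mul_zero, add_zero]⟩
  have h1 : ∀ β, Hvec L X u v N β = 0 := fun β => by
    -- Contraction of the first index with v removes M_α and turns F into G, leaving H_β.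
    have h2 : ∑ α, v α * Htens L X u v N α β = Hvec L X u v N β := by
      simp only [Htens_eq, mul_add, Finset.sum_add_distrib, ← mul_assoc]
      rw [← Finset.sum_mul, hL.sum_v_Mvec h, zero_mul, add_zero, Hvec_eq,
        ← hL.sum_v_accHcoef h β]
      simp only [map_sum, map_smul, LinearMap.sum_apply, LinearMap.smul_apply, smul_eq_mul]
    rw [← h2]
    exact Finset.sum_eq_zero fun α _ => by rw [h0, mul_zero]
  refine ⟨h1, fun α β => ?_⟩
  have := h0 α β
  rwa [Htens_eq, h1, mul_zero, add_zero] at this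

end IsLocalFinsler

theorem IsParallelKropina.Htens_star_eq_zero_iff (hK : IsParallelKropina D L b ρ L')
    (hT : IsTangentAt D L b X u v) (hm : 1 ≤ m) (hN : IsUnitNormal L X u v N) :
    (∀ α β, Htens L' X u v ((√(factor L b ρ (X u) (supp X u v)))⁻¹ • N) α β = 0) ↔
      ∀ α β, Htens L X u v N α β = 0 := by
  have h3 := (Real.sqrt_pos.2 (hK.factor_pos_of_isTangentAt hT)).ne'
  rw [hK.finsler.Htens_eq_zero_iff hT.mem, hK.finsler'.Htens_eq_zero_iff hT.mem]
  simp only [hK.Hvec_star hT hN, hK.form_metric_star_smul hT hN, hK.accHcoef_star hT hm,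
    mul_eq_zero, h3, false_or]

theorem IsParallelKropina.Mtens_star_eq_zero_iff (hK : IsParallelKropina D L b ρ L')
    (hT : IsTangentAt D L b X u v) (hm : 1 ≤ m) (hN : IsUnitNormal L X u v N) :
    (∀ α β, Mtens L' X u v ((√(factor L b ρ (X u) (supp X u v)))⁻¹ • N) α β = 0) ↔
      ∀ α β, Mtens L X u v N α β = 0 := by
  have h3 := (Real.sqrt_pos.2 (hK.factor_pos_of_isTangentAt hT)).ne'
  simp only [hK.Mtens_star hT hm hN, mul_eq_zero, h3, false_or]

end Hypersurface

/-! ### Vector fields along curves of line elements -/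

section Curves

variable {n m : ℕ} {D : Set ((Fin n → ℝ) × (Fin n → ℝ))}
  {L : (Fin n → ℝ) → (Fin n → ℝ) → ℝ} {X : (Fin m → ℝ) → Fin n → ℝ}
  {x y V W N : ℝ → Fin n → ℝ} {u v : ℝ → Fin m → ℝ} {t : ℝ}

/-- The vertical part `y'ⁱ + G^i_j x'ʲ` of the velocity of a curve of line elements. -/
noncomputable def vertVel (L : (Fin n → ℝ) → (Fin n → ℝ) → ℝ) (x y : ℝ → Fin n → ℝ) (t : ℝ) :
    Fin n → ℝ :=
  fun k => deriv y t k + ∑ l, nonlin L k l (x t) (y t) * deriv x t l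

/-- The matrix of the Cartan connection along a curve of line elements. -/
noncomputable def connMat (L : (Fin n → ℝ) → (Fin n → ℝ) → ℝ) (x y : ℝ → Fin n → ℝ) (t : ℝ)
    (i j : Fin n) : ℝ :=
  ∑ k, (hcoef L i j k (x t) (y t) * deriv x t k + cartanUp L i j k (x t) (y t) * vertVel L x y t k)

theorem absDeriv_eq (i : Fin n) :
    absDeriv L x y V t i = deriv V t i + ∑ j, V t j * connMat L x y t i j := by
  simp only [absDeriv, connMat, vertVel, Finset.mul_sum]

theorem IsLocalFinsler.sum_metric_mul_cartanUp (hL : IsLocalFinsler D L) {x y : Fin n → ℝ}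
    (h : (x, y) ∈ D) (s i k : Fin n) :
    ∑ r, metric L x y s r * cartanUp L r i k x y = cartan L s i k x y :=
  hL.sum_metric_mul_inv h (fun r => cartan L r i k x y) s

theorem IsLocalFinsler.hasDerivAt_metric (hL : IsLocalFinsler D L) (h : (x t, y t) ∈ D)
    (hx : DifferentiableAt ℝ x t) (hy : DifferentiableAt ℝ y t) (i j : Fin n) :
    HasDerivAt (fun s => metric L (x s) (y s) i j)
      (∑ r, connMat L x y t r i * metric L (x t) (y t) r j +
        ∑ r, connMat L x y t r j * metric L (x t) (y t) r i) t := by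
  have h1 : HasDerivAt (fun s => metric L (x s) (y s) i j)
      (pd (deriv x t, deriv y t) (fun x y => metric L x y i j) (x t) (y t)) t :=
    HasFDerivAt.comp_hasDerivAt (f := fun s => (x s, y s)) t
      ((hL.smooth_metric i j).differentiableAt hL.isOpen h).hasFDerivAt
      (hx.hasDerivAt.prodMk hy.hasDerivAt)
  refine h1.congr_deriv (Eq.symm ?_)
  -- Each connection term splits into a horizontal part, governed by h-metricity, and a part C_{ijk}
  -- w^k, where w is the vertical velocity. The two copies of the latter make up the vertical change
  -- 2C of the metric.
  have e1 : ∀ i j, ∑ r, connMat L x y t r i * metric L (x t) (y t) r j =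
      ∑ k, deriv x t k * ∑ r, hcoef L r i k (x t) (y t) * metric L (x t) (y t) r j +
      ∑ k, vertVel L x y t k * cartan L i j k (x t) (y t) := by
    intro i j
    simp only [connMat, Finset.sum_mul, add_mul, Finset.sum_add_distrib]
    congr 1
    · simp only [Finset.mul_sum]
      rw [Finset.sum_comm]
      exact Finset.sum_congr rfl fun k _ => Finset.sum_congr rfl fun r _ => by ring
    · rw [Finset.sum_comm]
      refine Finset.sum_congr rfl fun k _ => ?_
      rw [hL.cartan_symm_left h, ← hL.sum_metric_mul_cartanUp h, Finset.mul_sum]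
      exact Finset.sum_congr rfl fun r _ => by rw [hL.metric_symm h]; ring
  have e2 : ∀ k, deriv x t k * dx k (fun x y => metric L x y i j) (x t) (y t) =
      deriv x t k * ∑ r, hcoef L r i k (x t) (y t) * metric L (x t) (y t) r j +
      deriv x t k * ∑ r, hcoef L r j k (x t) (y t) * metric L (x t) (y t) r i +
      ∑ l, 2 * cartan L i j l (x t) (y t) * (nonlin L l k (x t) (y t) * deriv x t k) := by
    intro k
    have h2 := hL.delta_metric h i j k
    rw [delta, sub_eq_iff_eq_add] at h2
    rw [h2, mul_add, mul_add, Finset.mul_sum _ (fun l => nonlin L l k (x t) (y t) * _)]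
    congr 1
    exact Finset.sum_congr rfl fun l _ => by rw [cartan]; ring
  rw [pd_eq_sum hL.isOpen h (hL.smooth_metric i j), e1, e1]
  simp only [e2, Finset.sum_add_distrib]
  rw [Finset.sum_comm (f := fun k l => 2 * cartan L i j l (x t) (y t) *
    (nonlin L l k (x t) (y t) * deriv x t k))]
  have e3 : ∑ k, vertVel L x y t k * cartan L i j k (x t) (y t) +
      ∑ k, vertVel L x y t k * cartan L j i k (x t) (y t) =
      ∑ l, ∑ k, 2 * cartan L i j l (x t) (y t) * (nonlin L l k (x t) (y t) * deriv x t k) +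
      ∑ k, deriv y t k * dy k (fun x y => metric L x y i j) (x t) (y t) := by
    rw [← Finset.sum_add_distrib, ← Finset.sum_add_distrib]
    refine Finset.sum_congr rfl fun l _ => ?_
    rw [← Finset.mul_sum, hL.cartan_symm_left h j i, vertVel, cartan]
    ring
  linarith

/-- The absolute derivative of the Cartan connection is metrical. -/
theorem IsLocalFinsler.hasDerivAt_form (hL : IsLocalFinsler D L) (h : (x t, y t) ∈ D)
    (hx : DifferentiableAt ℝ x t) (hy : DifferentiableAt ℝ y t) (hV : DifferentiableAt ℝ V t)
    (hW : DifferentiableAt ℝ W t) :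
    HasDerivAt (fun s => form (metric L (x s) (y s)) (V s) (W s))
      (form (metric L (x t) (y t)) (absDeriv L x y V t) (W t) +
        form (metric L (x t) (y t)) (V t) (absDeriv L x y W t)) t := by
  simp only [form_apply]
  have h1 := HasDerivAt.fun_sum (u := Finset.univ) fun i (_ : i ∈ Finset.univ) =>
    HasDerivAt.fun_sum (u := Finset.univ) fun j (_ : j ∈ Finset.univ) =>
      ((hL.hasDerivAt_metric h hx hy i j).fun_mul (hasDerivAt_pi.1 hV.hasDerivAt i)).fun_mul
        (hasDerivAt_pi.1 hW.hasDerivAt j)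
  refine h1.congr_deriv (Eq.symm ?_)
  simp only [absDeriv_eq, add_mul, mul_add, Finset.sum_add_distrib]
  have e1 : ∑ i, ∑ j, metric L (x t) (y t) i j * (∑ r, V t r * connMat L x y t i r) * W t j =
      ∑ i, ∑ j, (∑ r, connMat L x y t r i * metric L (x t) (y t) r j) * V t i * W t j := by
    simp only [Finset.mul_sum, Finset.sum_mul]
    refine (Finset.sum_congr rfl fun i _ => Finset.sum_comm).trans (Finset.sum_comm.trans ?_)
    refine Finset.sum_congr rfl fun i _ => Finset.sum_comm.trans ?_
    exact Finset.sum_congr rfl fun j _ => Finset.sum_congr rfl fun r _ => by ring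
  have e2 : ∑ i, ∑ j, metric L (x t) (y t) i j * V t i * (∑ r, W t r * connMat L x y t j r) =
      ∑ i, ∑ j, (∑ r, connMat L x y t r j * metric L (x t) (y t) r i) * V t i * W t j := by
    simp only [Finset.mul_sum, Finset.sum_mul]
    refine Finset.sum_congr rfl fun i _ => Finset.sum_comm.trans ?_
    refine Finset.sum_congr rfl fun j _ => Finset.sum_congr rfl fun r _ => ?_
    rw [hL.metric_symm h]
    ring
  rw [e1, e2]
  ring

theorem hasDerivAt_comp_eq_sum {f : (Fin m → ℝ) → ℝ} (hf : DifferentiableAt ℝ f (u t))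
    (hu : DifferentiableAt ℝ u t) : HasDerivAt (fun s => f (u s))
      (∑ β, fderiv ℝ f (u t) (Pi.single β 1) * deriv u t β) t := by
  refine (hf.hasFDerivAt.comp_hasDerivAt t hu.hasDerivAt).congr_deriv (Eq.symm ?_)
  conv_rhs => rw [← Finset.univ_sum_single (deriv u t), map_sum]
  refine Finset.sum_congr rfl fun β _ => ?_
  have : (Pi.single β (deriv u t β) : Fin m → ℝ) = deriv u t β • Pi.single β 1 := by
    rw [← Pi.single_smul]; simp
  rw [this, map_smul, smul_eq_mul, mul_comm]

theorem differentiableAt_proj {u : Fin m → ℝ} (hX : ContDiffAt ℝ ∞ X u) (α : Fin m) (i : Fin n) :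
    DifferentiableAt ℝ (proj X α i) u := by
  have h1 : DifferentiableAt ℝ (fderiv ℝ X) u :=
    (hX.fderiv_right (m := ∞) (by simp)).differentiableAt (by simp)
  have h2 : DifferentiableAt ℝ (fun u => fderiv ℝ X u (Pi.single α 1)) u :=
    h1.clm_apply (differentiableAt_const _)
  exact differentiableAt_pi.1 h2 i

theorem hasDerivAt_position (hX : ContDiffAt ℝ ∞ X (u t)) (hu : DifferentiableAt ℝ u t) :
    HasDerivAt (fun s => X (u s)) (∑ β, deriv u t β • frame X (u t) β) t := by
  refine hasDerivAt_pi.2 fun i => ?_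
  have h0 := hX.differentiableAt (by simp)
  have h1 : ∀ β, fderiv ℝ (fun u => X u i) (u t) (Pi.single β 1) = proj X β i (u t) := fun β => by
    have := (hasFDerivAt_pi'.1 h0.hasFDerivAt i).fderiv
    rw [this]
    rfl
  have h2 := hasDerivAt_comp_eq_sum (f := fun u => X u i) (differentiableAt_pi.1 h0 i) hu
  simp only [h1] at h2
  refine h2.congr_deriv (Eq.symm ?_)
  simp only [Finset.sum_apply, Pi.smul_apply, smul_eq_mul, frame]
  exact Finset.sum_congr rfl fun β _ => mul_comm _ _

theorem hasDerivAt_frame (hX : ContDiffAt ℝ ∞ X (u t)) (hu : DifferentiableAt ℝ u t) (α : Fin m) :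
    HasDerivAt (fun s => frame X (u s) α)
      (∑ β, deriv u t β • fun i => proj₂ X α β i (u t)) t := by
  refine hasDerivAt_pi.2 fun i => ?_
  refine (hasDerivAt_comp_eq_sum (differentiableAt_proj hX α i) hu).congr_deriv (Eq.symm ?_)
  simp only [Finset.sum_apply, Pi.smul_apply, smul_eq_mul, proj₂]
  exact Finset.sum_congr rfl fun β _ => mul_comm _ _

theorem hasDerivAt_supp (hX : ContDiffAt ℝ ∞ X (u t)) (hu : DifferentiableAt ℝ u t)
    (hv : DifferentiableAt ℝ v t) :
    HasDerivAt (fun s => supp X (u s) (v s)) (∑ α, (deriv v t α • frame X (u t) α +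
      v t α • ∑ β, deriv u t β • fun i => proj₂ X α β i (u t))) t := by
  simp only [supp_eq_sum]
  refine HasDerivAt.fun_sum fun α _ => ?_
  rw [add_comm]
  exact (hasDerivAt_pi.1 hv.hasDerivAt α).fun_smul (hasDerivAt_frame hX hu α)

/-- Up to tangent vectors the vertical velocity is u'^β (B_{0β} + G B_β), so its normal component is
H_β u'^β. -/
theorem vertVel_eq (hX : ContDiffAt ℝ ∞ X (u t)) (hu : DifferentiableAt ℝ u t)
    (hv : DifferentiableAt ℝ v t) :
    vertVel L (fun s => X (u s)) (fun s => supp X (u s) (v s)) t =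
      ∑ β, deriv u t β • accNonlin L X (u t) (v t) β + ∑ α, deriv v t α • frame X (u t) α := by
  funext i
  rw [vertVel, (hasDerivAt_position hX hu).deriv, (hasDerivAt_supp hX hu hv).deriv]
  simp only [Finset.sum_apply, Pi.add_apply, Pi.smul_apply, smul_eq_mul, accNonlin,
    Finset.sum_add_distrib, mul_add, Finset.mul_sum]
  have e1 : ∑ α, ∑ β, v t α * (deriv u t β * proj₂ X α β i (u t)) =
      ∑ β, ∑ α, deriv u t β * (proj₂ X α β i (u t) * v t α) := by
    rw [Finset.sum_comm]
    exact Finset.sum_congr rfl fun β _ => Finset.sum_congr rfl fun α _ => by ring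
  have e2 : ∑ l, ∑ β, nonlin L i l (X (u t)) (supp X (u t) (v t)) *
      (deriv u t β * frame X (u t) β l) = ∑ β, ∑ l, deriv u t β *
      (nonlin L i l (X (u t)) (supp X (u t) (v t)) * proj X β l (u t)) := by
    rw [Finset.sum_comm]
    exact Finset.sum_congr rfl fun β _ => Finset.sum_congr rfl fun α _ => by rw [frame]; ring
  rw [e1, e2]
  ring

/-- The absolute derivative of the tangent vectors `B_α` along a curve of line elements. -/
theorem IsLocalFinsler.form_absDeriv_frame (hL : IsLocalFinsler D L)
    (h : (X (u t), supp X (u t) (v t)) ∈ D) (hX : ContDiffAt ℝ ∞ X (u t))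
    (hu : DifferentiableAt ℝ u t) (α : Fin m) (Z : Fin n → ℝ) :
    form (metric L (X (u t)) (supp X (u t) (v t)))
      (absDeriv L (fun s => X (u s)) (fun s => supp X (u s) (v s)) (fun s => frame X (u s) α) t) Z =
      ∑ β, deriv u t β * form (metric L (X (u t)) (supp X (u t) (v t)))
        (accHcoef L X (u t) (v t) α β) Z +
      form (cartanMat L (X (u t)) (supp X (u t) (v t)) Z) (frame X (u t) α)
        (vertVel L (fun s => X (u s)) (fun s => supp X (u s) (v s)) t) := by
  set x₀ := X (u t) with hx₀
  set y₀ := supp X (u t) (v t) with hy₀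
  set w := vertVel L (fun s => X (u s)) (fun s => supp X (u s) (v s)) t with hw
  -- The second derivatives of the embedding combine with the F-terms; the rest is the Cartan tensor
  -- contracted with the vertical velocity.
  have e1 : absDeriv L (fun s => X (u s)) (fun s => supp X (u s) (v s))
      (fun s => frame X (u s) α) t = ∑ β, deriv u t β • accHcoef L X (u t) (v t) α β +
        fun i => ∑ j, ∑ k, frame X (u t) α j * (cartanUp L i j k x₀ y₀ * w k) := by
    funext i
    rw [absDeriv_eq, (hasDerivAt_frame hX hu α).deriv]
    simp only [connMat, (hasDerivAt_position hX hu).deriv, ← hw, ← hx₀, ← hy₀]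
    simp only [Finset.sum_apply, Pi.add_apply, Pi.smul_apply, smul_eq_mul, accHcoef,
      Finset.sum_add_distrib, mul_add, Finset.mul_sum, add_assoc]
    congr 2
    refine (Finset.sum_congr rfl fun j _ => Finset.sum_comm).trans (Finset.sum_comm.trans ?_)
    exact Finset.sum_congr rfl fun β _ => Finset.sum_congr rfl fun j _ =>
      Finset.sum_congr rfl fun k _ => by simp only [frame]; ring
  rw [e1, map_add, LinearMap.add_apply, form_sum_left]
  congr 1
  rw [hL.form_metric_comm h, hL.form_cartanMat_swap h, hL.form_cartanMat_comm h,
    form_eq_sum_left, form_eq_sum_left]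
  refine Finset.sum_congr rfl fun i _ => ?_
  simp only [cartanMat, Matrix.of_apply, ← hL.sum_metric_mul_cartanUp h, Finset.mul_sum,
    Finset.sum_mul]
  rw [Finset.sum_comm]
  refine Finset.sum_congr rfl fun j _ => ?_
  rw [Finset.sum_comm]
  exact Finset.sum_congr rfl fun k _ => Finset.sum_congr rfl fun r _ => by ring

end Curves

/-! ### Parallel normals in terms of the second fundamental tensors -/

section NormalParallel

variable {m : ℕ} {D : Set ((Fin (m + 1) → ℝ) × (Fin (m + 1) → ℝ))}
  {L L' ρ : (Fin (m + 1) → ℝ) → (Fin (m + 1) → ℝ) → ℝ}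
  {b : (Fin (m + 1) → ℝ) → (Fin (m + 1) → ℝ) → Fin (m + 1) → ℝ}
  {X : (Fin m → ℝ) → Fin (m + 1) → ℝ}

/-- The normal is parallel along a curve if and only if the second fundamental tensors vanish
on its velocity. -/
theorem IsLocalFinsler.absDeriv_unitNormal_eq_zero_iff {u v : ℝ → Fin m → ℝ}
    {N : ℝ → Fin (m + 1) → ℝ} {t : ℝ} (hL : IsLocalFinsler D L)
    (h : (X (u t), supp X (u t) (v t)) ∈ D) (hX : ContDiffAt ℝ ∞ X (u t))
    (hB : LinearIndependent ℝ (frame X (u t))) (hu : DifferentiableAt ℝ u t)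
    (hv : DifferentiableAt ℝ v t) (hN : DifferentiableAt ℝ N t)
    (hn : ∀ᶠ s in nhds t, IsUnitNormal L X (u s) (v s) (N s)) :
    (∀ i, absDeriv L (fun s => X (u s)) (fun s => supp X (u s) (v s)) N t i = 0) ↔
      ∀ α, ∑ β, deriv u t β * form (metric L (X (u t)) (supp X (u t) (v t)))
        (accHcoef L X (u t) (v t) α β) (N t) +
      form (cartanMat L (X (u t)) (supp X (u t) (v t)) (N t)) (frame X (u t) α)
        (vertVel L (fun s => X (u s)) (fun s => supp X (u s) (v s)) t) = 0 := by
  have hx := (hasDerivAt_position hX hu).differentiableAt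
  have hy := (hasDerivAt_supp hX hu hv).differentiableAt
  -- Differentiating the relations (B_α, N) = 0 and (N, N) = 1 along the curve shows that the
  -- derivative of N is orthogonal to N and determined by those of the B_α.
  have h1 : ∀ α, form (metric L (X (u t)) (supp X (u t) (v t)))
      (absDeriv L (fun s => X (u s)) (fun s => supp X (u s) (v s))
        (fun s => frame X (u s) α) t) (N t) +
      form (metric L (X (u t)) (supp X (u t) (v t))) (frame X (u t) α)
        (absDeriv L (fun s => X (u s)) (fun s => supp X (u s) (v s)) N t) = 0 := fun α =>
    (hL.hasDerivAt_form h hx hy (hasDerivAt_frame hX hu α).differentiableAt hN).unique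
      ((hasDerivAt_const t (0 : ℝ)).congr_of_eventuallyEq
        (hn.mono fun s hs => (isUnitNormal_iff.1 hs).1 α))
  have h2 : form (metric L (X (u t)) (supp X (u t) (v t)))
      (absDeriv L (fun s => X (u s)) (fun s => supp X (u s) (v s)) N t) (N t) +
      form (metric L (X (u t)) (supp X (u t) (v t))) (N t)
        (absDeriv L (fun s => X (u s)) (fun s => supp X (u s) (v s)) N t) = 0 :=
    (hL.hasDerivAt_form h hx hy hN hN).unique
      ((hasDerivAt_const t (1 : ℝ)).congr_of_eventuallyEq
        (hn.mono fun s hs => (isUnitNormal_iff.1 hs).2))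
  simp only [hL.form_absDeriv_frame h hX hu] at h1
  refine ⟨fun h3 α => ?_, fun h3 => ?_⟩
  · have h4 := h1 α
    rwa [(funext h3 : absDeriv L (fun s => X (u s)) (fun s => supp X (u s) (v s)) N t = 0),
      map_zero, add_zero] at h4
  · refine congrFun (hL.eq_zero_of_form_eq_zero h hB hn.self_of_nhds (fun α => ?_) ?_)
    · have h4 := h1 α
      rwa [h3, zero_add] at h4
    · rw [hL.form_metric_comm h] at h2
      linarith

/-- The Cartan tensor drops out because v^α B_α is the supporting element, and F contracts to G.
Hence the parallelism condition contains the tangency of the vertical velocity. -/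
theorem IsLocalFinsler.sum_v_normal_part (hL : IsLocalFinsler D L) {u v : Fin m → ℝ}
    (h : (X u, supp X u v) ∈ D) {N : Fin (m + 1) → ℝ} (hN : IsUnitNormal L X u v N)
    (a c : Fin m → ℝ) {w : Fin (m + 1) → ℝ}
    (hw : w = ∑ β, a β • accNonlin L X u v β + ∑ α, c α • frame X u α) :
    ∑ α, v α * (∑ β, a β * form (metric L (X u) (supp X u v)) (accHcoef L X u v α β) N +
      form (cartanMat L (X u) (supp X u v) N) (frame X u α) w) =
      form (metric L (X u) (supp X u v)) w N := by
  have h1 : ∑ α, v α * form (cartanMat L (X u) (supp X u v) N) (frame X u α) w = 0 := by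
    rw [← form_sum_left, ← supp_eq_sum, hL.form_cartanMat_comm h, hL.form_cartanMat_y h]
  have h2 : form (metric L (X u) (supp X u v)) w N =
      ∑ β, a β * form (metric L (X u) (supp X u v)) (accNonlin L X u v β) N := by
    rw [hw, map_add, LinearMap.add_apply, form_sum_left, form_sum_left]
    simp [(isUnitNormal_iff.1 hN).1]
  simp only [mul_add, Finset.sum_add_distrib]
  rw [h1, h2, add_zero]
  simp only [← hL.sum_v_accHcoef h, form_sum_left, Finset.mul_sum]
  rw [Finset.sum_comm]
  exact Finset.sum_congr rfl fun β _ => Finset.sum_congr rfl fun α _ => by ring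

/-- The Cartan term scales by √f only when w is tangent, since `form_cartanMat_star_smul` requires
it. Either side of the equivalence implies that tangency through `sum_v_normal_part`. -/
theorem IsParallelKropina.normal_part_star_eq_zero_iff (hK : IsParallelKropina D L b ρ L')
    {u v : Fin m → ℝ} (hT : IsTangentAt D L b X u v) (hm : 1 ≤ m) {N : Fin (m + 1) → ℝ}
    (hN : IsUnitNormal L X u v N) (a c : Fin m → ℝ) {w : Fin (m + 1) → ℝ}
    (hw : w = ∑ β, a β • accNonlin L X u v β + ∑ α, c α • frame X u α) :
    (∀ α, ∑ β, a β * form (metric L' (X u) (supp X u v)) (accHcoef L' X u v α β)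
        ((√(factor L b ρ (X u) (supp X u v)))⁻¹ • N) +
      form (cartanMat L' (X u) (supp X u v) ((√(factor L b ρ (X u) (supp X u v)))⁻¹ • N))
        (frame X u α) w = 0) ↔
    ∀ α, ∑ β, a β * form (metric L (X u) (supp X u v)) (accHcoef L X u v α β) N +
      form (cartanMat L (X u) (supp X u v) N) (frame X u α) w = 0 := by
  have h3 := (Real.sqrt_pos.2 (hK.factor_pos_of_isTangentAt hT)).ne'
  have h1 : form (metric L (X u) (supp X u v)) w N = 0 → ∀ α,
      ∑ β, a β * form (metric L' (X u) (supp X u v)) (accHcoef L' X u v α β)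
        ((√(factor L b ρ (X u) (supp X u v)))⁻¹ • N) +
      form (cartanMat L' (X u) (supp X u v) ((√(factor L b ρ (X u) (supp X u v)))⁻¹ • N))
        (frame X u α) w = √(factor L b ρ (X u) (supp X u v)) *
      (∑ β, a β * form (metric L (X u) (supp X u v)) (accHcoef L X u v α β) N +
      form (cartanMat L (X u) (supp X u v) N) (frame X u α) w) := by
    intro h0 α
    rw [hK.form_cartanMat_star_smul hT hm hN ((isUnitNormal_iff.1 hN).1 α) h0, mul_add,
      Finset.mul_sum]
    congr 1
    refine Finset.sum_congr rfl fun β _ => ?_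
    rw [hK.form_metric_star_smul hT hN, hK.accHcoef_star hT hm]
    ring
  constructor
  · intro h0
    have h4 := hK.finsler'.sum_v_normal_part hT.mem ((hK.isUnitNormal_star_iff hT).2 hN) a c
      (w := w) (by simpa only [hK.accNonlin_star hT] using hw)
    simp only [h0, mul_zero, Finset.sum_const_zero] at h4
    rw [hK.form_metric_star_smul hT hN] at h4
    have h5 := (mul_eq_zero.1 h4.symm).resolve_left h3
    intro α
    have h6 := h0 α
    rw [h1 h5] at h6
    exact (mul_eq_zero.1 h6).resolve_left h3
  · intro h0 α
    have h4 := hK.finsler.sum_v_normal_part hT.mem hN a c hw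
    simp only [h0, mul_zero, Finset.sum_const_zero] at h4
    rw [h1 h4.symm, h0, mul_zero]

end NormalParallel

/-! ### The kinds of hyperplanes, in coordinates -/

section LocalKinds

variable {m : ℕ} {D : Set ((Fin (m + 1) → ℝ) × (Fin (m + 1) → ℝ))}
  {L L' ρ : (Fin (m + 1) → ℝ) → (Fin (m + 1) → ℝ) → ℝ}
  {b : (Fin (m + 1) → ℝ) → (Fin (m + 1) → ℝ) → Fin (m + 1) → ℝ}
  {X : (Fin m → ℝ) → Fin (m + 1) → ℝ} {U : Set (Fin m → ℝ)}

theorem IsHPath.congr {n : ℕ} {I : Set ℝ} {Γ Γ' : ℝ → Fin n → Fin n → Fin n → ℝ}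
    {P P' : ℝ → Fin n → Fin n → ℝ} {x y : ℝ → Fin n → ℝ} (h : IsHPath I Γ P x y)
    (hΓ : ∀ t ∈ I, ∀ i j k, Γ' t i j k = Γ t i j k) (hP : ∀ t ∈ I, ∀ i j, P' t i j = P t i j) :
    IsHPath I Γ' P' x y := by
  intro t ht
  simpa only [hΓ t ht, hP t ht] using h t ht

theorem IsParallelKropina.smul_inv_smul (hK : IsParallelKropina D L b ρ L') {u v : Fin m → ℝ}
    (hT : IsTangentAt D L b X u v) (N : Fin (m + 1) → ℝ) :
    (√(factor L b ρ (X u) (supp X u v)))⁻¹ • √(factor L b ρ (X u) (supp X u v)) • N = N :=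
  inv_smul_smul₀ (Real.sqrt_pos.2 (hK.factor_pos_of_isTangentAt hT)).ne' N

theorem IsParallelKropina.isUnitNormal_smul (hK : IsParallelKropina D L b ρ L')
    {u v : Fin m → ℝ} (hT : IsTangentAt D L b X u v) {N : Fin (m + 1) → ℝ}
    (hN : IsUnitNormal L' X u v N) :
    IsUnitNormal L X u v (√(factor L b ρ (X u) (supp X u v)) • N) := by
  rw [← hK.isUnitNormal_star_iff hT, hK.smul_inv_smul hT]
  exact hN

/-- Induced and ambient connections are both unchanged, so the same curves are h-paths in the two
spaces; only the auxiliary normal field is rescaled. -/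
theorem IsParallelKropina.localSecondKind_iff (hK : IsParallelKropina D L b ρ L') (hm : 1 ≤ m)
    (hT : ∀ u v, (u, v) ∈ hypDom D U X → IsTangentAt D L b X u v) :
    LocalSecondKind D L' U X ↔ LocalSecondKind D L U X := by
  constructor
  · intro h a c u v N hN hp
    have ht : ∀ t ∈ Set.Ioo a c, IsTangentAt D L b X (u t) (v t) :=
      fun t h1 => hT _ _ (hN t h1).1
    refine (h a c u v (fun t => (√(factor L b ρ (X (u t)) (supp X (u t) (v t))))⁻¹ • N t)
      (fun t h1 => ⟨(hN t h1).1, (hK.isUnitNormal_star_iff (ht t h1)).2 (hN t h1).2⟩)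
      (hp.congr (fun t h1 i j k => hK.indHcoef_star (ht t h1) hm (hN t h1).2 i j k)
        (fun t h1 i j => hK.indNonlin_star (ht t h1) i j))).congr
      (fun t h1 i j k => (hK.hcoef_star (hK.three_le (ht t h1) hm) (ht t h1).mem i j k).symm)
      (fun t h1 i j => (hK.nonlin_star (ht t h1).mem i j).symm)
  · intro h a c u v N hN hp
    have ht : ∀ t ∈ Set.Ioo a c, IsTangentAt D L b X (u t) (v t) :=
      fun t h1 => hT _ _ (hN t h1).1
    have hN' : ∀ t ∈ Set.Ioo a c, IsUnitNormal L X (u t) (v t)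
        (√(factor L b ρ (X (u t)) (supp X (u t) (v t))) • N t) :=
      fun t h1 => hK.isUnitNormal_smul (ht t h1) (hN t h1).2
    refine (h a c u v (fun t => √(factor L b ρ (X (u t)) (supp X (u t) (v t))) • N t)
      (fun t h1 => ⟨(hN t h1).1, hN' t h1⟩)
      (hp.congr (fun t h1 i j k => ?_)
        (fun t h1 i j => (hK.indNonlin_star (ht t h1) i j).symm))).congr
      (fun t h1 i j k => hK.hcoef_star (hK.three_le (ht t h1) hm) (ht t h1).mem i j k)
      (fun t h1 i j => hK.nonlin_star (ht t h1).mem i j)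
    rw [← hK.indHcoef_star (ht t h1) hm (hN' t h1) i j k, hK.smul_inv_smul (ht t h1)]

/-- Rescaled normal fields must again be differentiable along the curve; this is where smoothness of
ρ is needed for the third kind. -/
theorem IsParallelKropina.differentiableAt_sqrt_factor (hK : IsParallelKropina D L b ρ L')
    (hm : 1 ≤ m) {u v : ℝ → Fin m → ℝ} {t : ℝ} (hT : IsTangentAt D L b X (u t) (v t))
    (hX : ContDiffAt ℝ ∞ X (u t)) (hu : DifferentiableAt ℝ u t) (hv : DifferentiableAt ℝ v t) :
    DifferentiableAt ℝ (fun s => √(factor L b ρ (X (u s)) (supp X (u s) (v s)))) t := by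
  refine DifferentiableAt.sqrt ?_ (hK.factor_pos_of_isTangentAt hT).ne'
  exact DifferentiableAt.comp (f := fun s => (X (u s), supp X (u s) (v s))) t
    ((hK.smooth_factor (hK.three_le hT hm)).differentiableAt hK.isOpen hT.mem)
    ((hasDerivAt_position hX hu).differentiableAt.prodMk
      (hasDerivAt_supp hX hu hv).differentiableAt)

theorem IsParallelKropina.absDeriv_star_eq_zero_iff (hK : IsParallelKropina D L b ρ L')
    (hm : 1 ≤ m) {u v : ℝ → Fin m → ℝ} {N N' : ℝ → Fin (m + 1) → ℝ} {t : ℝ}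
    (hT : IsTangentAt D L b X (u t) (v t)) (hX : ContDiffAt ℝ ∞ X (u t))
    (hu : DifferentiableAt ℝ u t) (hv : DifferentiableAt ℝ v t)
    (hN : DifferentiableAt ℝ N t) (hN' : DifferentiableAt ℝ N' t)
    (hn : ∀ᶠ s in nhds t, IsUnitNormal L X (u s) (v s) (N s))
    (hn' : ∀ᶠ s in nhds t, IsUnitNormal L' X (u s) (v s) (N' s))
    (hNN : N' t = (√(factor L b ρ (X (u t)) (supp X (u t) (v t))))⁻¹ • N t) :
    (∀ i, absDeriv L' (fun s => X (u s)) (fun s => supp X (u s) (v s)) N' t i = 0) ↔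
      ∀ i, absDeriv L (fun s => X (u s)) (fun s => supp X (u s) (v s)) N t i = 0 := by
  have hw : vertVel L' (fun s => X (u s)) (fun s => supp X (u s) (v s)) t =
      vertVel L (fun s => X (u s)) (fun s => supp X (u s) (v s)) t := by
    rw [vertVel_eq hX hu hv, vertVel_eq hX hu hv]
    simp only [hK.accNonlin_star hT]
  rw [hK.finsler.absDeriv_unitNormal_eq_zero_iff hT.mem hX hT.indep hu hv hN hn,
    hK.finsler'.absDeriv_unitNormal_eq_zero_iff hT.mem hX hT.indep hu hv hN' hn', hNN, hw]
  exact hK.normal_part_star_eq_zero_iff hT hm hn.self_of_nhds _ _ (vertVel_eq hX hu hv)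

theorem IsParallelKropina.localThirdKind_iff (hK : IsParallelKropina D L b ρ L') (hm : 1 ≤ m)
    (hX : ∀ u ∈ U, ContDiffAt ℝ ∞ X u)
    (hT : ∀ u v, (u, v) ∈ hypDom D U X → IsTangentAt D L b X u v) :
    LocalThirdKind D L' U X ↔ LocalThirdKind D L U X := by
  constructor
  · intro h a c u v N hN t ht
    have hT' : ∀ t ∈ Set.Ioo a c, IsTangentAt D L b X (u t) (v t) :=
      fun t h1 => hT _ _ (hN t h1).1
    have hd : ∀ t ∈ Set.Ioo a c, DifferentiableAt ℝ
        (fun s => (√(factor L b ρ (X (u s)) (supp X (u s) (v s))))⁻¹ • N s) t := fun t h1 =>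
      ((hK.differentiableAt_sqrt_factor hm (hT' t h1) (hX _ (hN t h1).1.1) (hN t h1).2.2.1
        (hN t h1).2.2.2.1).fun_inv
          (Real.sqrt_pos.2 (hK.factor_pos_of_isTangentAt (hT' t h1))).ne').fun_smul
        (hN t h1).2.2.2.2
    have hn : ∀ t ∈ Set.Ioo a c, IsUnitNormal L' X (u t) (v t)
        ((√(factor L b ρ (X (u t)) (supp X (u t) (v t))))⁻¹ • N t) := fun t h1 =>
      (hK.isUnitNormal_star_iff (hT' t h1)).2 (hN t h1).2.1
    have hmem := Ioo_mem_nhds ht.1 ht.2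
    exact (hK.absDeriv_star_eq_zero_iff hm (hT' t ht) (hX _ (hN t ht).1.1) (hN t ht).2.2.1
      (hN t ht).2.2.2.1 (hN t ht).2.2.2.2 (hd t ht)
      (Filter.mem_of_superset hmem fun s hs => (hN s hs).2.1)
      (Filter.mem_of_superset hmem hn) rfl).1
      (h a c u v _ (fun s hs => ⟨(hN s hs).1, hn s hs, (hN s hs).2.2.1, (hN s hs).2.2.2.1,
        hd s hs⟩) t ht)
  · intro h a c u v N hN t ht
    have hT' : ∀ t ∈ Set.Ioo a c, IsTangentAt D L b X (u t) (v t) :=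
      fun t h1 => hT _ _ (hN t h1).1
    have hd : ∀ t ∈ Set.Ioo a c, DifferentiableAt ℝ
        (fun s => √(factor L b ρ (X (u s)) (supp X (u s) (v s))) • N s) t := fun t h1 =>
      (hK.differentiableAt_sqrt_factor hm (hT' t h1) (hX _ (hN t h1).1.1) (hN t h1).2.2.1
        (hN t h1).2.2.2.1).fun_smul (hN t h1).2.2.2.2
    have hn : ∀ t ∈ Set.Ioo a c, IsUnitNormal L X (u t) (v t)
        (√(factor L b ρ (X (u t)) (supp X (u t) (v t))) • N t) := fun t h1 =>
      hK.isUnitNormal_smul (hT' t h1) (hN t h1).2.1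
    have hmem := Ioo_mem_nhds ht.1 ht.2
    exact (hK.absDeriv_star_eq_zero_iff hm (hT' t ht) (hX _ (hN t ht).1.1) (hN t ht).2.2.1
      (hN t ht).2.2.2.1 (hd t ht) (hN t ht).2.2.2.2
      (Filter.mem_of_superset hmem hn)
      (Filter.mem_of_superset hmem fun s hs => (hN s hs).2.1)
      (hK.smul_inv_smul (hT' t ht) _).symm).2
      (h a c u v _ (fun s hs => ⟨(hN s hs).1, hn s hs, (hN s hs).2.2.1, (hN s hs).2.2.2.1,
        hd s hs⟩) t ht)

/-- Rescaling by √f is a bijection between the unit normals of the two spaces, so the quantifier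
over N transfers. -/
theorem IsParallelKropina.forall_Htens_star_iff (hK : IsParallelKropina D L b ρ L') (hm : 1 ≤ m)
    {u v : Fin m → ℝ} (hT : IsTangentAt D L b X u v) :
    (∀ N, IsUnitNormal L' X u v N → ∀ α β, Htens L' X u v N α β = 0) ↔
      ∀ N, IsUnitNormal L X u v N → ∀ α β, Htens L X u v N α β = 0 := by
  refine ⟨fun h N hN => (hK.Htens_star_eq_zero_iff hT hm hN).1
    (h _ ((hK.isUnitNormal_star_iff hT).2 hN)), fun h N hN => ?_⟩
  have hN' := hK.isUnitNormal_smul hT hN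
  have := (hK.Htens_star_eq_zero_iff hT hm hN').2 (h _ hN')
  rwa [hK.smul_inv_smul hT] at this

theorem IsParallelKropina.forall_Mtens_star_iff (hK : IsParallelKropina D L b ρ L') (hm : 1 ≤ m)
    {u v : Fin m → ℝ} (hT : IsTangentAt D L b X u v) :
    (∀ N, IsUnitNormal L' X u v N → ∀ α β, Mtens L' X u v N α β = 0) ↔
      ∀ N, IsUnitNormal L X u v N → ∀ α β, Mtens L X u v N α β = 0 := by
  refine ⟨fun h N hN => (hK.Mtens_star_eq_zero_iff hT hm hN).1
    (h _ ((hK.isUnitNormal_star_iff hT).2 hN)), fun h N hN => ?_⟩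
  have hN' := hK.isUnitNormal_smul hT hN
  have := (hK.Mtens_star_eq_zero_iff hT hm hN').2 (h _ hN')
  rwa [hK.smul_inv_smul hT] at this

end LocalKinds

/-! ### Reduction to coordinates -/

section Charts

variable {m : ℕ} {M : Type*} [TopologicalSpace M] [ChartedSpace (Fin (m + 1) → ℝ) M]
  {S : Type*} [TopologicalSpace S] [ChartedSpace (Fin m → ℝ) S]
  {f : S → M}
  {D : Set (TangentBundle 𝓘(ℝ, Fin (m + 1) → ℝ) M)}
  {L : TangentBundle 𝓘(ℝ, Fin (m + 1) → ℝ) M → ℝ}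
  {b : ∀ p : TangentBundle 𝓘(ℝ, Fin (m + 1) → ℝ) M,
    TangentSpace 𝓘(ℝ, Fin (m + 1) → ℝ) p.proj →L[ℝ] ℝ}
  {e : OpenPartialHomeomorph M (Fin (m + 1) → ℝ)} {ψ : OpenPartialHomeomorph S (Fin m → ℝ)}

/-- By linearity b_i yⁱ is the value of b on the supporting vector, the denominator of the Kropina
function. -/
theorem sum_mul_locCov (x y : Fin (m + 1) → ℝ) :
    ∑ i, y i * locCov b e x y i = b (tvec e x y) (tvec e x y).snd := by
  have h1 : (tvec e x y).snd = mfderiv 𝓘(ℝ, Fin (m + 1) → ℝ) 𝓘(ℝ, Fin (m + 1) → ℝ) e.symm x y := rfl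
  let φ : (Fin (m + 1) → ℝ) →ₗ[ℝ] ℝ := (b (tvec e x y)).toLinearMap ∘ₗ
    (mfderiv 𝓘(ℝ, Fin (m + 1) → ℝ) 𝓘(ℝ, Fin (m + 1) → ℝ) e.symm x).toLinearMap
  have h2 : φ y = ∑ i, y i * φ (Pi.single i 1) := by
    conv_lhs => rw [LinearMap.pi_apply_eq_sum_univ φ y]
    refine Finset.sum_congr rfl fun i _ => ?_
    rw [smul_eq_mul]
    congr 2
    funext j
    simp [Pi.single_apply, eq_comm]
  exact h2.symm

theorem contDiffAt_locMap (hf : IsImmersed (n := m + 1) (m := m) f)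
    (he : e ∈ IsManifold.maximalAtlas 𝓘(ℝ, Fin (m + 1) → ℝ) ∞ M)
    (hψ : ψ ∈ IsManifold.maximalAtlas 𝓘(ℝ, Fin m → ℝ) ∞ S) {u : Fin m → ℝ}
    (hu : u ∈ locPar f ψ e) : ContDiffAt ℝ ∞ (locMap f ψ e) u := by
  have h1 := (contMDiffOn_symm_of_mem_maximalAtlas hψ).contMDiffAt
    (ψ.open_target.mem_nhds hu.1)
  have h2 := (contMDiffOn_of_mem_maximalAtlas he).contMDiffAt (e.open_source.mem_nhds hu.2)
  have h3 := ContMDiffAt.comp u (ContMDiffAt.comp (ψ.symm u) h2 (hf.1 (ψ.symm u))) h1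
  exact contMDiffAt_iff_contDiffAt.1 h3

/-- The differential of the local equations is a composite of three injective maps: those of the
inverse chart of S, of f and of the chart of M. -/
theorem linearIndependent_frame_locMap [IsManifold 𝓘(ℝ, Fin (m + 1) → ℝ) ∞ M]
    [IsManifold 𝓘(ℝ, Fin m → ℝ) ∞ S] (hf : IsImmersed (n := m + 1) (m := m) f)
    (he : e ∈ IsManifold.maximalAtlas 𝓘(ℝ, Fin (m + 1) → ℝ) ∞ M)
    (hψ : ψ ∈ IsManifold.maximalAtlas 𝓘(ℝ, Fin m → ℝ) ∞ S) {u : Fin m → ℝ}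
    (hu : u ∈ locPar f ψ e) : LinearIndependent ℝ (frame (locMap f ψ e) u) := by
  have hed : e.MDifferentiable 𝓘(ℝ, Fin (m + 1) → ℝ) 𝓘(ℝ, Fin (m + 1) → ℝ) :=
    ⟨(contMDiffOn_of_mem_maximalAtlas he).mdifferentiableOn (by simp),
      (contMDiffOn_symm_of_mem_maximalAtlas he).mdifferentiableOn (by simp)⟩
  have hψd : ψ.symm.MDifferentiable 𝓘(ℝ, Fin m → ℝ) 𝓘(ℝ, Fin m → ℝ) :=
    ⟨(contMDiffOn_symm_of_mem_maximalAtlas hψ).mdifferentiableOn (by simp),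
      (contMDiffOn_of_mem_maximalAtlas hψ).mdifferentiableOn (by simp)⟩
  have h1 : Function.Injective (fderiv ℝ (locMap f ψ e) u) := by
    have d1 : MDifferentiableAt 𝓘(ℝ, Fin m → ℝ) 𝓘(ℝ, Fin m → ℝ) ψ.symm u :=
      hψd.mdifferentiableAt hu.1
    have d2 : MDifferentiableAt 𝓘(ℝ, Fin m → ℝ) 𝓘(ℝ, Fin (m + 1) → ℝ) f (ψ.symm u) :=
      (hf.1 (ψ.symm u)).mdifferentiableAt (by simp)
    have d3 : MDifferentiableAt 𝓘(ℝ, Fin (m + 1) → ℝ) 𝓘(ℝ, Fin (m + 1) → ℝ) e (f (ψ.symm u)) :=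
      hed.mdifferentiableAt hu.2
    have h2 := d3.hasMFDerivAt.comp u (d2.hasMFDerivAt.comp u d1.hasMFDerivAt)
    have h3 : fderiv ℝ (locMap f ψ e) u = _ := mfderiv_eq_fderiv.symm.trans h2.mfderiv
    rw [h3]
    exact (hed.mfderiv_injective hu.2).comp ((hf.2 _).comp (hψd.mfderiv_injective hu.1))
  have h2 : frame (locMap f ψ e) u = fun α => fderiv ℝ (locMap f ψ e) u (Pi.single α 1) := rfl
  have h3 := (Pi.basisFun ℝ (Fin m)).linearIndependent.map'
    (fderiv ℝ (locMap f ψ e) u).toLinearMap (LinearMap.ker_eq_bot.2 h1)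
  have h4 : (fun α => fderiv ℝ (locMap f ψ e) u (Pi.single α 1)) =
      (fderiv ℝ (locMap f ψ e) u).toLinearMap ∘ Pi.basisFun ℝ (Fin m) := by
    funext α
    simp
  rw [h2, h4]
  exact h3

theorem locFun_kropina (x y : Fin (m + 1) → ℝ) :
    locFun (kropina L b) e x y = locFun L e x y ^ 2 / ∑ i, y i * locCov b e x y i := by
  rw [sum_mul_locCov]
  rfl

end Charts

end FinslerHyp

/-- Every notion involved is quantified over pairs of charts, so the coordinate equivalences apply
pair by pair. The scalar ρ of the h-vector is chosen once, globally, and then expressed in each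
chart. -/
theorem mainTheorem5 {m : ℕ} (hm : 1 ≤ m)
    {M : Type*} [TopologicalSpace M] [ChartedSpace (Fin (m + 1) → ℝ) M]
    [IsManifold 𝓘(ℝ, Fin (m + 1) → ℝ) ∞ M]
    {S : Type*} [TopologicalSpace S] [ChartedSpace (Fin m → ℝ) S]
    [IsManifold 𝓘(ℝ, Fin m → ℝ) ∞ S]
    (f : S → M) (hf : FinslerHyp.IsImmersed (n := m + 1) (m := m) f)
    (D : Set (TangentBundle 𝓘(ℝ, Fin (m + 1) → ℝ) M))
    (L : TangentBundle 𝓘(ℝ, Fin (m + 1) → ℝ) M → ℝ)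
    (hL : FinslerHyp.IsFinsler D L)
    (b : ∀ p : TangentBundle 𝓘(ℝ, Fin (m + 1) → ℝ) M,
      TangentSpace 𝓘(ℝ, Fin (m + 1) → ℝ) p.proj →L[ℝ] ℝ)
    (hb : FinslerHyp.IsHVector D L b)
    (hstar : FinslerHyp.IsFinsler D (FinslerHyp.kropina L b))
    (hpar : FinslerHyp.IsHParallel D L b)
    (htan : FinslerHyp.IsTangentTo (m := m) D L b f) :
    (FinslerHyp.IsHyperplaneSecondKind (m := m) D (FinslerHyp.kropina L b) f ↔
      FinslerHyp.IsHyperplaneSecondKind (m := m) D L f) ∧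
    (FinslerHyp.IsHyperplaneThirdKind (m := m) D (FinslerHyp.kropina L b) f ↔
      FinslerHyp.IsHyperplaneThirdKind (m := m) D L f) ∧
    (FinslerHyp.HtensVanishes (m := m) D (FinslerHyp.kropina L b) f ↔
      FinslerHyp.HtensVanishes (m := m) D L f) ∧
    ((FinslerHyp.HtensVanishes (m := m) D (FinslerHyp.kropina L b) f ∧
        FinslerHyp.MtensVanishes (m := m) D (FinslerHyp.kropina L b) f) ↔
      (FinslerHyp.HtensVanishes (m := m) D L f ∧
        FinslerHyp.MtensVanishes (m := m) D L f)) := by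
  obtain ⟨ρ, hρ, hbρ⟩ := hb
  have hK : ∀ e ∈ IsManifold.maximalAtlas 𝓘(ℝ, Fin (m + 1) → ℝ) ∞ M,
      FinslerHyp.IsParallelKropina (FinslerHyp.locDom D e) (FinslerHyp.locFun L e)
        (FinslerHyp.locCov b e) (FinslerHyp.locFun ρ e)
        (FinslerHyp.locFun (FinslerHyp.kropina L b) e) := fun e he =>
    { finsler := hL e he
      finsler' := hstar e he
      eq_div := FinslerHyp.locFun_kropina
      smooth_b := fun i => contDiffOn_pi.1 (hbρ e he).1 i
      vcov_eq_zero := fun x y h i j => ((hbρ e he).2 x y h i j).1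
      hcov_eq_zero := fun x y h i j => hpar e he x y h i j
      h_vector := fun x y h i j => ((hbρ e he).2 x y h i j).2
      ne_zero := fun x y h => hρ _ h.2 }
  have hT : ∀ e ∈ IsManifold.maximalAtlas 𝓘(ℝ, Fin (m + 1) → ℝ) ∞ M,
      ∀ ψ ∈ IsManifold.maximalAtlas 𝓘(ℝ, Fin m → ℝ) ∞ S, ∀ u v,
        (u, v) ∈ FinslerHyp.hypDom (FinslerHyp.locDom D e) (FinslerHyp.locPar f ψ e)
          (FinslerHyp.locMap f ψ e) →
        FinslerHyp.IsTangentAt (FinslerHyp.locDom D e) (FinslerHyp.locFun L e)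
          (FinslerHyp.locCov b e) (FinslerHyp.locMap f ψ e) u v := fun e he ψ hψ u v h =>
    { mem := h.2
      indep := FinslerHyp.linearIndependent_frame_locMap hf he hψ h.1
      tangent := htan e he ψ hψ u v h }
  have hH : FinslerHyp.HtensVanishes (m := m) D (FinslerHyp.kropina L b) f ↔
      FinslerHyp.HtensVanishes (m := m) D L f :=
    forall₂_congr fun e he => forall₂_congr fun ψ hψ => forall₃_congr fun u v h =>
      (hK e he).forall_Htens_star_iff hm (hT e he ψ hψ u v h)
  have hM : FinslerHyp.MtensVanishes (m := m) D (FinslerHyp.kropina L b) f ↔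
      FinslerHyp.MtensVanishes (m := m) D L f :=
    forall₂_congr fun e he => forall₂_congr fun ψ hψ => forall₃_congr fun u v h =>
      (hK e he).forall_Mtens_star_iff hm (hT e he ψ hψ u v h)
  exact ⟨forall₂_congr fun e he => forall₂_congr fun ψ hψ =>
      (hK e he).localSecondKind_iff hm (hT e he ψ hψ),
    forall₂_congr fun e he => forall₂_congr fun ψ hψ =>
      (hK e he).localThirdKind_iff hm
        (fun u hu => FinslerHyp.contDiffAt_locMap hf he hψ hu) (hT e he ψ hψ),
    hH, and_congr hH hM⟩
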